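/- **Proposition 3.4 (Modified wave operator).** Let $\frac12<\alpha<1$, $\lambda\neq0$, $w(x)=\lambda|x|^{-\alpha}$ on $\mathbb{R}^3$, and write $\langle y\rangle=(1+|y|^2)^{1/2}$. For every $D>0$ there are constants $\eta_0>0$ and $C>0$, depending only on $\alpha,\lambda,D$, such that the following holds for every $0<\eta_*\le\eta_0$. Let $f_0\ge0$ on $\mathbb{R}^3\times\mathbb{R}^3$ satisfy $$\|\langle x\rangle f_0\|_{W^{1,1}_{x,v}\cap W^{1,\infty}_{x,v}}+\|\langle x\rangle f_0\|_{W^{1,1}_xW^{1,\infty}_v\cap W^{1,1}_vW^{1,\infty}_x}\le\eta_*,$$ where $\|u\|_{W^{1,1}_xW^{1,\infty}_v}=\sum_{|m|\le1,|m'|\le1}\big\|\,\|\nabla_x^m\nabla_v^{m'}u\|_{L^\infty_v}\big\|_{L^1_x}$ (and likewise with $x,v$ interchanged). Let $f\in C([0,\infty);L^1(\mathbb{R}^6)\cap L^\infty(\mathbb{R}^6))$, $f\ge0$, be a global weak solution of the Vlasov–Riesz system $$\partial_tf+v\cdot\nabla_xf+\mathbf{E}_f\cdot\nabla_vf=0,\quad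 f(0)=f_0,\quad \mathbf{E}_f(t,x)=-\int_{\mathbb{R}^3}\nabla w(x-y)\,\rho_f(t,y)\,dy,\quad \rho_f(t,x)=\int_{\mathbb{R}^3}f(t,x,v)\,dv$$ (the integral defining $\mathbf{E}_f(t,x)$ being absolutely convergent for all $t\ge 0$, $x\in\mathbb{R}^3$), which satisfies the dispersion bounds: for all $t\ge0$, $\mathbf E_f(t)$ is differentiable and $$\langle t\rangle^{1+\alpha}\|\mathbf{E}_f(t)\|_{L^\infty}\le D\eta_*,\qquad \langle t\rangle^{2+\alpha}\|\nabla\mathbf{E}_f(t)\|_{L^\infty}\le D\eta_*,\qquad \langle t\rangle^{3}\|\nabla^2\mathbf{E}_f(t)\|_{L^\infty}\le D\eta_*,$$ the last one being read as a bound on the Lipschitz constant of $\nabla\mathbf{E}_f(t)$. Then the characteristic flow $\Phi(t)(x,v)=(\mathcal{X}(t),\mathcal{V}(t))$, $t\ge0$, given by $\dot{\mathcal{X}}=\mathcal{V}$, $\dot{\mathcal{V}}=\mathbf{E}_f(t,\mathcal{X})$, $(\mathcal{X},\mathcal{V})(0)=(x,v)$, exists. Write $\Phi(t)(x,v)=(\mathcal{X}(t,0,x,v),\mathcal{V}(t,0,x,v))$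 and $$\mathbf{A}_t(v)=-\iint_{\mathbb{R}^6}\nabla w\big(v-\mathcal{V}(t,0,\tilde x,\tilde v)\big)f_0(\tilde x,\tilde v)\,d\tilde x\,d\tilde v,\qquad \tilde\Phi^{\mathrm{ref}}(t)(x,v)=\Big(x+tv-\tfrac{t^{1-\alpha}-1}{1-\alpha}\mathbf{A}_t(v),\,v\Big),$$ where the integral defining $\mathbf A_t(v)$ converges absolutely for all $t\ge0$, $v\in\mathbb{R}^3$. The finite-time modified wave operators $\mathcal{W}^{\mathrm{mod}}(t)=\tilde\Phi^{\mathrm{ref}}(t)^{-1}\circ\Phi(t)=(\mathcal{W}^{\mathrm{mod}}_1(t),\mathcal{W}^{\mathrm{mod}}_2(t))$ have the following properties. 1. (Existence and convergence rate) For each $(x,v)\in\mathbb{R}^6$ the limit $\mathcal{W}^{\mathrm{mod},+}(x,v)=\lim_{t\to\infty}\mathcal{W}^{\mathrm{mod}}(t)(x,v)$ exists, and for all $t\ge1$ and all $(x,v)\in\mathbb{R}^6$ $$\frac{|\mathcal{W}^{\mathrm{mod}}_1(t)(x,v)-\mathcal{W}^{\mathrm{mod},+}_1(x,v)|}{\langle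 x\rangle}\le\frac{C\eta_*}{t^{2\alpha-1}},\qquad |\mathcal{W}^{\mathrm{mod}}_2(t)(x,v)-\mathcal{W}^{\mathrm{mod},+}_2(x,v)|\le\frac{C\eta_*}{t^{\alpha}}.$$ 2. (Almost identity) For all $t\ge1$, and also for $t=\infty$ with $\mathcal{W}^{\mathrm{mod}}(\infty)=\mathcal{W}^{\mathrm{mod},+}$, and all $(x,v)\in\mathbb{R}^6$ $$\frac{|\mathcal{W}^{\mathrm{mod}}_1(t)(x,v)-x|}{\langle x\rangle}\le C\eta_*,\qquad|\mathcal{W}^{\mathrm{mod}}_2(t)(x,v)-v|\le C\eta_*.$$ -/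

import Mathlib

open MeasureTheory Filter Topology Set
open scoped ENNReal ContDiff Gradient

noncomputable section

namespace VlasovRiesz

/-- Position space (and velocity space) `ℝ³`, with the Euclidean norm. -/
abbrev R3 : Type := EuclideanSpace ℝ (Fin 3)

/-- Phase space `ℝ³ × ℝ³`; a point is `(x, v)`, and `volume` is `dx dv`. -/
abbrev Phase : Type := R3 × R3

/-- `⟨x⟩ = (1 + |x|²)^{1/2}`, for `x ∈ ℝ³` and for a time `x ∈ ℝ`. -/
def bracket {F : Type*} [NormedAddCommGroup F] (x : F) : ℝ := Real.sqrt (1 + ‖x‖ ^ 2)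

/-! ### Weak derivatives and Sobolev norms on phase space -/

/-- Iterated directional derivative of `φ` along the vectors in the list. -/
def iterDeriv : List Phase → (Phase → ℝ) → Phase → ℝ
  | [], φ => φ
  | d :: l, φ => fun z => fderiv ℝ (iterDeriv l φ) z d

/-- `g` is the weak derivative of `u` along the directions in `l`
(for `l = []` this says that `g = u` almost everywhere). -/
def IsWeakDeriv (l : List Phase) (u g : Phase → ℝ) : Prop :=
  LocallyIntegrable u volume ∧ LocallyIntegrable g volume ∧
    ∀ φ : Phase → ℝ, ContDiff ℝ ∞ φ → HasCompactSupport φ →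
      ∫ z, u z * iterDeriv l φ z = (-1) ^ l.length * ∫ z, g z * φ z

/-- The value of a norm `N` on the weak derivative of `u` along `l`. The weak derivative is
unique up to null sets, so for a norm `N` that ignores null sets all terms of the infimum agree;
the value is `∞` if the weak derivative does not exist. -/
def weakDerivNorm (N : (Phase → ℝ) → ℝ≥0∞) (l : List Phase) (u : Phase → ℝ) : ℝ≥0∞ :=
  ⨅ (g : Phase → ℝ) (_ : IsWeakDeriv l u g), N g

/-- The coordinate direction `x_i` in phase space. -/
def dirX (i : Fin 3) : Phase := (EuclideanSpace.single i 1, 0)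

/-- The coordinate direction `v_i` in phase space. -/
def dirV (i : Fin 3) : Phase := (0, EuclideanSpace.single i 1)

/-- The multi-indices in `x` of order at most one, as lists of directions. -/
def multiX : Option (Fin 3) → List Phase
  | none => []
  | some i => [dirX i]

/-- The multi-indices in `v` of order at most one, as lists of directions. -/
def multiV : Option (Fin 3) → List Phase
  | none => []
  | some i => [dirV i]

/-- The norm of `W^{1,r}_{x,v}(ℝ⁶)`: sum over all multi-indices of order at most one. -/
def sobolevNorm (r : ℝ≥0∞) (u : Phase → ℝ) : ℝ≥0∞ :=
  weakDerivNorm (fun g => eLpNorm g r volume) [] u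
    + ∑ i : Fin 3, weakDerivNorm (fun g => eLpNorm g r volume) [dirX i] u
    + ∑ i : Fin 3, weakDerivNorm (fun g => eLpNorm g r volume) [dirV i] u

/-- The norm of `L¹_x(ℝ³; L^∞_v(ℝ³))`. -/
def normL1xLinfv (g : Phase → ℝ) : ℝ≥0∞ :=
  ∫⁻ x : R3, eLpNorm (fun v : R3 => g (x, v)) ∞ volume

/-- The norm of `L¹_v(ℝ³; L^∞_x(ℝ³))`. -/
def normL1vLinfx (g : Phase → ℝ) : ℝ≥0∞ :=
  ∫⁻ v : R3, eLpNorm (fun x : R3 => g (x, v)) ∞ volume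

/-- The norm of `W^{1,1}_x(ℝ³; W^{1,∞}_v(ℝ³))`: the sum of the `L¹_x L^∞_v` norms of
`∇_x^m ∇_v^{m'} u` over all `|m| ≤ 1`, `|m'| ≤ 1`. -/
def mixedNormXV (u : Phase → ℝ) : ℝ≥0∞ :=
  ∑ m : Option (Fin 3), ∑ m' : Option (Fin 3),
    weakDerivNorm normL1xLinfv (multiX m ++ multiV m') u

/-- The norm of `W^{1,1}_v(ℝ³; W^{1,∞}_x(ℝ³))`. -/
def mixedNormVX (u : Phase → ℝ) : ℝ≥0∞ :=
  ∑ m : Option (Fin 3), ∑ m' : Option (Fin 3),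
    weakDerivNorm normL1vLinfx (multiV m ++ multiX m') u

/-- `‖⟨x⟩ f₀‖_{W^{1,1} ∩ W^{1,∞}} + ‖⟨x⟩ f₀‖_{W^{1,1}_x W^{1,∞}_v ∩ W^{1,1}_v W^{1,∞}_x}`,
the norm of an intersection being the maximum of the two norms. -/
def weightedDataNorm (f₀ : Phase → ℝ) : ℝ≥0∞ :=
  let u : Phase → ℝ := fun z => bracket z.1 * f₀ z
  max (sobolevNorm 1 u) (sobolevNorm ∞ u) + max (mixedNormXV u) (mixedNormVX u)

/-! ### The Vlasov--Riesz system -/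

/-- The interaction potential `w(x) = λ / |x|^α`. Its gradient is only ever used up to the null
set `{0}`. -/
def potential (α lam : ℝ) (x : R3) : ℝ := lam / ‖x‖ ^ α

/-- The spatial density `ρ_h(x) = ∫ h(x,v) dv`. -/
def density (h : Phase → ℝ) (x : R3) : ℝ := ∫ v : R3, h (x, v)

/-- The force field `E_h(x) = - ∫ ∇w(x-y) ρ_h(y) dy` of a distribution `h`. -/
def forceField (α lam : ℝ) (h : Phase → ℝ) (x : R3) : R3 :=
  - ∫ y : R3, density h y • ∇ (potential α lam) (x - y)

/-- `f ∈ C([0,∞); L¹ ∩ L^∞)`, `f ≥ 0`, is a weak solution of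
`∂_t f + v·∇_x f + E_f·∇_v f = 0` on `[0,∞) × ℝ³ × ℝ³` with initial datum `f₀`. Only the values
`f t` for `t ≥ 0` matter. -/
structure IsSolution (α lam : ℝ) (f₀ : Phase → ℝ) (f : ℝ → Phase → ℝ) : Prop where
  nonneg : ∀ t, 0 ≤ t → ∀ᵐ z, 0 ≤ f t z
  memL1 : ∀ t, 0 ≤ t → MemLp (f t) 1 volume
  memLinf : ∀ t, 0 ≤ t → MemLp (f t) ∞ volume
  continuousL1 : ∀ t, 0 ≤ t →
    Tendsto (fun s => eLpNorm (f s - f t) 1 volume) (𝓝[Ici 0] t) (𝓝 0)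
  continuousLinf : ∀ t, 0 ≤ t →
    Tendsto (fun s => eLpNorm (f s - f t) ∞ volume) (𝓝[Ici 0] t) (𝓝 0)
  initial : f 0 =ᵐ[volume] f₀
  /-- The integral that defines the force field converges absolutely. -/
  force_integrable : ∀ t, 0 ≤ t → ∀ x : R3,
    Integrable (fun y : R3 => density (f t) y • ∇ (potential α lam) (x - y)) volume
  /-- The derivative of `φ` at `(x,v)` along `(v, E_f)` is `v·∇_x φ + E_f·∇_v φ`. -/
  weak_form : ∀ φ : Phase → ℝ, ContDiff ℝ ∞ φ → HasCompactSupport φ → ∀ t, 0 ≤ t →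
    HasDerivWithinAt (fun s => ∫ z, f s z * φ z)
      (∫ z, f t z * fderiv ℝ φ z (z.2, forceField α lam (f t) z.1)) (Ici 0) t

/-- The dispersion bounds, with right-hand side `B`:
`⟨t⟩^{1+α} ‖E(t)‖_∞ ≤ B`, `⟨t⟩^{2+α} ‖∇E(t)‖_∞ ≤ B`, `⟨t⟩³ ‖∇²E(t)‖_∞ ≤ B` for all `t ≥ 0`,
where the last one, for the distributional second derivative, is expressed by the Lipschitz
constant of `∇E(t)`. -/
structure DispersionBound (α B : ℝ) (E : ℝ → R3 → R3) : Prop where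
  differentiable : ∀ t, 0 ≤ t → Differentiable ℝ (E t)
  bound : ∀ t, 0 ≤ t → ∀ x, bracket t ^ (1 + α) * ‖E t x‖ ≤ B
  bound_deriv : ∀ t, 0 ≤ t → ∀ x, bracket t ^ (2 + α) * ‖fderiv ℝ (E t) x‖ ≤ B
  bound_deriv_two : ∀ t, 0 ≤ t → ∀ x y,
    bracket t ^ (3 : ℝ) * ‖fderiv ℝ (E t) x - fderiv ℝ (E t) y‖ ≤ B * ‖x - y‖

/-- `Φ` is the forward characteristic flow `Φ(t)(x,v) = (𝒳(t,0,x,v), 𝒱(t,0,x,v))` of the force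
field `E` for `t ≥ 0`. -/
def IsFlow (E : ℝ → R3 → R3) (Φ : ℝ → Phase → Phase) : Prop :=
  ∀ z : Phase, Φ 0 z = z ∧ ∀ t, 0 ≤ t →
    HasDerivWithinAt (fun s => Φ s z) ((Φ t z).2, E t (Φ t z).1) (Ici 0) t

/-! ### Modified reference flow and modified wave operator -/

/-- The integrand of the velocity correction,
`(x̃,ṽ) ↦ ∇w(v - 𝒱(t,0,x̃,ṽ)) f₀(x̃,ṽ)`. -/
def correctionIntegrand (α lam : ℝ) (f₀ : Phase → ℝ) (Φ : ℝ → Phase → Phase)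
    (t : ℝ) (v : R3) (z : Phase) : R3 :=
  f₀ z • ∇ (potential α lam) (v - (Φ t z).2)

/-- The velocity correction `A_t(v) = - ∬ ∇w(v - 𝒱(t,0,x̃,ṽ)) f₀(x̃,ṽ) dx̃ dṽ`. -/
def correction (α lam : ℝ) (f₀ : Phase → ℝ) (Φ : ℝ → Phase → Phase) (t : ℝ) (v : R3) : R3 :=
  - ∫ z, correctionIntegrand α lam f₀ Φ t v z

/-- The modified reference flow
`(x,v) ↦ (x + t v - (t^{1-α} - 1)/(1-α) A_t(v), v)`, a bijection of phase space. -/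
def refFlow (α lam : ℝ) (f₀ : Phase → ℝ) (Φ : ℝ → Phase → Phase) (t : ℝ) : Phase ≃ Phase where
  toFun z :=
    (z.1 + t • z.2 - ((t ^ (1 - α) - 1) / (1 - α)) • correction α lam f₀ Φ t z.2, z.2)
  invFun z :=
    (z.1 - t • z.2 + ((t ^ (1 - α) - 1) / (1 - α)) • correction α lam f₀ Φ t z.2, z.2)
  left_inv z := by refine Prod.ext ?_ rfl; dsimp only; abel
  right_inv z := by refine Prod.ext ?_ rfl; dsimp only; abel

/-- The finite-time modified wave operator: the inverse of the modified reference flow composed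
with the characteristic flow. -/
def waveOp (α lam : ℝ) (f₀ : Phase → ℝ) (Φ : ℝ → Phase → Phase) (t : ℝ) : Phase → Phase :=
  (refFlow α lam f₀ Φ t).symm ∘ Φ t

end VlasovRiesz

end

open VlasovRiesz

/-! Put K(x) = x/|x|^{2+α}, so that ∇w = -αλ K and A_t(v) = αλ ∫ f₀ K(v - 𝒱(t)). Along a
characteristic the quantity 𝒳 - t𝒱 has derivative -t E(t,𝒳), which is only of size t^{-α} and need
not be integrable: this is the long-range effect. The leading part of the force has to be
identified. Since f(t) is the push-forward of f₀ by the flow, E(t,𝒳) = αλ ∫ f₀ K(𝒳 - 𝒳(t,·))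
(`IsSolution.forceField_eq`). The decay of E gives 𝒳 = t𝒱 + O(⟨x⟩ t^{1-α}), and K is homogeneous of
degree -(1+α), so E(t,𝒳) = t^{-(1+α)} A_t(𝒱) + O(η⟨x⟩ t^{-(1+2α)}) (`norm_force_sub_le`).

The coefficient (t^{1-α}-1)/(1-α) has derivative t^{-α}, so the correction cancels the leading part
of -tE. What is left is O(η⟨x⟩ t^{-2α}) from the error, plus t^{1-α} times the variation of A_t(𝒱)
in time, which is O(η t^{-(1+α)}) (`norm_velocityKernel_sub_le`). The modified position thus moves
at speed O(η⟨x⟩ t^{-2α}), integrable because α > 1/2, and the tail gives the rate t^{-(2α-1)}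
(`norm_modifiedPosition_sub_le`). The velocity converges at rate t^{-α} directly from the decay of
E.

Two ingredients support this. Differences of K cost a kernel |·|^{-(2+α)}, locally integrable in
dimension three. For small η the maps v ↦ 𝒱(t,x,v) and v ↦ 𝒳(t,x,v)/t expand distances by at least
1/2, so these singular integrals against ⟨x⟩f₀ are controlled by its L¹ and L¹_x L^∞_v norms
(`integrable_singular`).

The other is the push-forward formula for a merely weak solution (`IsTransported.map_withDensity`).
A test function is carried backwards by the flow. It stays only C^{1,1}, expressed by second
differences, so the derivative of the flow is never needed. Mollifying it at scale h costs O(h²),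
negligible over a time step h, hence the pairing with f is constant in time. -/

namespace VlasovRiesz

/-! ### The kernel x/|x|^{2+α}: homogeneity, difference bound, local integrability. -/

/-- The vector field `x / |x|^{2+α}`, equal to `∇w` up to the factor `-αλ`. -/
noncomputable def rieszKernel (α : ℝ) (x : R3) : R3 := (‖x‖ ^ (-(2 + α))) • x

theorem rieszKernel_zero (α : ℝ) : rieszKernel α 0 = 0 := by simp [rieszKernel]

/-- The identity holds at every point, so no null set has to be carried along. At the origin `lam /
0 ^ α` is 0 by convention while the potential is at least |λ| in absolute value on small spheres; it
is discontinuous there and its gradient takes the default value 0, as does the kernel. -/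
theorem gradient_potential {α lam : ℝ} (hα : 0 < α) (hlam : lam ≠ 0) (x : R3) :
    ∇ (potential α lam) x = (-(α * lam)) • rieszKernel α x := by
  by_cases hx : x = 0
  · subst hx
    rw [rieszKernel_zero, smul_zero, gradient, fderiv_zero_of_not_differentiableAt, map_zero]
    intro hd
    have hc := hd.continuousAt
    have h0 : potential α lam 0 = 0 := by
      simp [potential, Real.zero_rpow hα.ne']
    rw [Metric.continuousAt_iff] at hc
    obtain ⟨δ, hδ, h⟩ := hc |lam| (abs_pos.2 hlam)
    obtain ⟨y, hy⟩ := NormedSpace.exists_lt_norm ℝ R3 0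
    set m := min (δ / 2) 1
    have hm : 0 < m := by positivity
    have hn : ‖(m / ‖y‖) • y‖ = m := by
      rw [norm_smul, Real.norm_of_nonneg (by positivity), div_mul_cancel₀ _ hy.ne']
    have h1 : dist ((m / ‖y‖) • y) 0 < δ := by
      rw [dist_zero_right, hn]
      exact (min_le_left _ _).trans_lt (by linarith)
    have h2 := h h1
    rw [h0, dist_zero_right, potential, hn, Real.norm_eq_abs, abs_div,
      abs_of_pos (Real.rpow_pos_of_pos hm _), div_lt_iff₀ (Real.rpow_pos_of_pos hm _)] at h2
    have h3 : m ^ α ≤ 1 := Real.rpow_le_one hm.le (min_le_right _ _) hα.le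
    nlinarith [abs_nonneg lam]
  · have hn : 0 < ‖x‖ := norm_pos_iff.2 hx
    -- Through the square of the norm the potential is a power of a function differentiable
    -- everywhere.
    have hp : potential α lam = fun y : R3 => lam * (‖y‖ ^ 2) ^ (-(α / 2)) := by
      funext y
      rw [potential, div_eq_mul_inv, Real.rpow_neg (by positivity), ← Real.rpow_natCast,
        ← Real.rpow_mul (norm_nonneg y)]
      congr 3
      push_cast
      ring
    have h1 := (((hasStrictFDerivAt_norm_sq x).hasFDerivAt).rpow_const (p := -(α / 2))
      (Or.inl (by positivity))).const_mul lam
    rw [← hp] at h1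
    rw [gradient, h1.fderiv, rieszKernel]
    apply (InnerProductSpace.toDual ℝ R3).injective
    rw [LinearIsometryEquiv.apply_symm_apply]
    have h2 : (‖x‖ ^ 2) ^ (-(α / 2) - 1) = ‖x‖ ^ (-(2 + α)) := by
      rw [← Real.rpow_natCast, ← Real.rpow_mul (norm_nonneg x)]
      congr 1
      push_cast
      ring
    ext y
    simp only [h2, smul_apply, InnerProductSpace.toDual_apply_apply,
      innerSL_apply_apply, inner_smul_left, smul_eq_mul, nsmul_eq_mul]
    simp
    ring

theorem rieszKernel_smul (α : ℝ) {t : ℝ} (ht : 0 < t) (x : R3) :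
    rieszKernel α (t • x) = t ^ (-(1 + α)) • rieszKernel α x := by
  simp only [rieszKernel, norm_smul, Real.norm_of_nonneg ht.le]
  rw [Real.mul_rpow ht.le (norm_nonneg x), smul_smul, smul_smul]
  congr 1
  have : t ^ (-(1 + α)) = t ^ (-(2 + α)) * t := by
    rw [← Real.rpow_add_one ht.ne']
    congr 1
    ring
  rw [this]
  ring

theorem norm_rieszKernel_le {α : ℝ} (hα : -1 < α) (x : R3) :
    ‖rieszKernel α x‖ ≤ 1 + ‖x‖ ^ (-(2 + α)) := by
  rw [rieszKernel, norm_smul, Real.norm_of_nonneg (by positivity)]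
  rcases le_total ‖x‖ 1 with h | h
  · have : 0 ≤ ‖x‖ ^ (-(2 + α)) := by positivity
    nlinarith
  · have h0 : 0 < ‖x‖ := by linarith
    rw [← Real.rpow_add_one h0.ne']
    have : ‖x‖ ^ (-(2 + α) + 1) ≤ 1 := Real.rpow_le_one_of_one_le_of_nonpos h (by linarith)
    have : 0 ≤ ‖x‖ ^ (-(2 + α)) := by positivity
    linarith

theorem measurable_rieszKernel (α : ℝ) : Measurable (rieszKernel α) := by
  unfold rieszKernel
  fun_prop

/-- Bernoulli's inequality for (q/p)^β. The factor q keeps the singularity on the right at the order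
q^{-β}. -/
theorem rpow_neg_sub_mul_le {β p q : ℝ} (hβ : 1 ≤ β) (hq : 0 < q) (hpq : q ≤ p) :
    |p ^ (-β) - q ^ (-β)| * q ≤ β * q ^ (-β) * (p - q) := by
  have hp : 0 < p := hq.trans_le hpq
  have h1 : p ^ (-β) ≤ q ^ (-β) :=
    Real.rpow_le_rpow_of_nonpos hq hpq (by linarith)
  have hB := one_add_mul_self_le_rpow_one_add (s := q / p - 1) (p := β)
    (by have := div_pos hq hp; linarith) hβ
  have h2 : p ^ (-β) = q ^ (-β) * (q / p) ^ β := by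
    rw [Real.div_rpow hq.le hp.le, Real.rpow_neg hp.le, Real.rpow_neg hq.le]
    have := (Real.rpow_pos_of_pos hq β).ne'
    field_simp
  rw [abs_sub_comm, abs_of_nonneg (by linarith)]
  have h3 : (1 - q / p) * q ≤ p - q := by
    have : (1 - q / p) = (p - q) / p := by field_simp
    rw [this, div_mul_eq_mul_div, div_le_iff₀ hp]
    nlinarith
  have h4 : (0 : ℝ) < q ^ (-β) := by positivity
  rw [show 1 + (q / p - 1) = q / p by ring] at hB
  calc (q ^ (-β) - p ^ (-β)) * q = q ^ (-β) * ((1 - (q / p) ^ β) * q) := by rw [h2]; ring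
    _ ≤ q ^ (-β) * ((β * (1 - q / p)) * q) := by gcongr; linarith
    _ = q ^ (-β) * (β * ((1 - q / p) * q)) := by ring
    _ ≤ q ^ (-β) * (β * (p - q)) := by gcongr
    _ = _ := by ring

/-- Only the weights vary once a - b is split off, and that variation multiplies the shorter vector
b. No path from b to a is followed, so it does not matter whether the segment passes near the
origin. -/
theorem norm_rieszKernel_sub_le_of_norm_le {α : ℝ} (hα : -1 ≤ α) {a b : R3} (hab : ‖b‖ ≤ ‖a‖) :
    ‖rieszKernel α a - rieszKernel α b‖
      ≤ (2 + α) * ‖a - b‖ * (‖a‖ ^ (-(2 + α)) + ‖b‖ ^ (-(2 + α))) := by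
  have hA : 0 ≤ ‖a‖ ^ (-(2 + α)) := by positivity
  have hB : 0 ≤ ‖b‖ ^ (-(2 + α)) := by positivity
  have key : ‖rieszKernel α a - rieszKernel α b‖
      ≤ ‖a‖ ^ (-(2 + α)) * ‖a - b‖ + |‖a‖ ^ (-(2 + α)) - ‖b‖ ^ (-(2 + α))| * ‖b‖ := by
    have : rieszKernel α a - rieszKernel α b = ‖a‖ ^ (-(2 + α)) • (a - b)
        + (‖a‖ ^ (-(2 + α)) - ‖b‖ ^ (-(2 + α))) • b := by
      simp only [rieszKernel, smul_sub, sub_smul]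
      abel
    rw [this]
    refine (norm_add_le _ _).trans ?_
    rw [norm_smul, norm_smul, Real.norm_of_nonneg hA, Real.norm_eq_abs]
  refine key.trans ?_
  have h0 := norm_nonneg (a - b)
  have h1 : |‖a‖ ^ (-(2 + α)) - ‖b‖ ^ (-(2 + α))| * ‖b‖
      ≤ (2 + α) * ‖b‖ ^ (-(2 + α)) * ‖a - b‖ := by
    -- For b = 0 the left side vanishes, whatever value the negative power of 0 is given.
    rcases (norm_nonneg b).eq_or_lt with h | h
    · rw [← h, mul_zero]
      have : (0 : ℝ) ≤ 0 ^ (-(2 + α)) := by positivity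
      have : 0 ≤ 2 + α := by linarith
      positivity
    · refine (rpow_neg_sub_mul_le (by linarith) h hab).trans ?_
      have := norm_sub_norm_le a b
      have : 0 ≤ 2 + α := by linarith
      gcongr
  have : ‖a‖ ^ (-(2 + α)) * ‖a - b‖ ≤ (2 + α) * (‖a‖ ^ (-(2 + α)) * ‖a - b‖) :=
    le_mul_of_one_le_left (by positivity) (by linarith)
  linarith

theorem norm_rieszKernel_sub_le {α : ℝ} (hα : -1 ≤ α) (a b : R3) :
    ‖rieszKernel α a - rieszKernel α b‖
      ≤ (2 + α) * ‖a - b‖ * (‖a‖ ^ (-(2 + α)) + ‖b‖ ^ (-(2 + α))) := by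
  rcases le_total ‖b‖ ‖a‖ with h | h
  · exact norm_rieszKernel_sub_le_of_norm_le hα h
  · rw [norm_sub_rev, norm_sub_rev a, add_comm (‖a‖ ^ _)]
    exact norm_rieszKernel_sub_le_of_norm_le hα h

theorem integrableOn_norm_rpow_ball {β : ℝ} (hβ : β < 3) :
    IntegrableOn (fun x : R3 => ‖x‖ ^ (-β)) (Metric.ball 0 1) volume := by
  rw [integrableOn_fun_norm_addHaar (volume : Measure R3) (f := fun r => r ^ (-β))]
  have h1 : IntegrableOn (fun y : ℝ => y ^ (2 - β)) (Ioo 0 1) volume :=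
    (intervalIntegral.integrableOn_Ioo_rpow_iff one_pos).2 (by linarith)
  refine h1.congr_fun (fun y hy => ?_) measurableSet_Ioo
  simp only [finrank_euclideanSpace, Fintype.card_fin, smul_eq_mul]
  rw [← Real.rpow_natCast, ← Real.rpow_add hy.1]
  norm_num
  ring_nf

instance : (volume : Measure Phase).IsAddHaarMeasure :=
  inferInstanceAs ((volume : Measure R3).prod (volume : Measure R3)).IsAddHaarMeasure

/-! ### Comparison principles in time, expanding maps, time weights. -/

/-- A function whose right increments are bounded to first order by `B'` grows at most like `B`. -/
theorem norm_sub_le_of_eventually_increment_le {F : Type*} [NormedAddCommGroup F]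
    {f : ℝ → F} {B B' : ℝ → ℝ} {a b : ℝ} (hab : a ≤ b) (hf : ContinuousOn f (Icc a b))
    (hB : ContinuousOn B (Icc a b)) (hB' : ∀ x ∈ Ico a b, HasDerivWithinAt B (B' x) (Ici x) x)
    (h : ∀ x ∈ Ico a b, ∀ ε > 0, ∀ᶠ z in 𝓝[>] x, ‖f z - f x‖ ≤ (B' x + ε) * (z - x)) :
    ‖f b - f a‖ ≤ B b - B a := by
  have key : ∀ ε > 0, ‖f b - f a‖ ≤ B b - B a + ε * (b - a) := by
    intro ε hε
    refine image_norm_le_of_liminf_right_slope_norm_lt_deriv_boundary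
      (f := fun x => f x - f a) (f' := B') (B := fun x => B x - B a + ε * (x - a))
      (B' := fun x => B' x + ε) (a := a) (b := b) (hf.sub continuousOn_const) ?_ (by simp)
      ((hB.sub continuousOn_const).add (by fun_prop)) ?_ ?_ (right_mem_Icc.2 hab)
    · intro x hx r hr
      refine Eventually.frequently ?_
      filter_upwards [h x hx ((r - B' x) / 2) (by linarith), self_mem_nhdsWithin] with z hz hxz
      have hxz' : 0 < z - x := sub_pos.2 hxz
      rw [slope_def_field, div_lt_iff₀ hxz']
      have h1 : ‖f z - f a‖ - ‖f x - f a‖ ≤ ‖f z - f x‖ := by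
        have := norm_sub_norm_le (f z - f a) (f x - f a)
        rwa [sub_sub_sub_cancel_right] at this
      simp only [Function.comp]
      nlinarith
    · intro x hx
      have := ((hB' x hx).sub_const (B a)).add
        ((((hasDerivAt_id x).sub_const a).const_mul ε).hasDerivWithinAt (s := Ici x))
      rw [mul_one] at this
      exact this
    · intro x _ _
      linarith
  refine le_of_forall_pos_le_add fun δ hδ => ?_
  have h2 := key (δ / (b - a + 1)) (div_pos hδ (by linarith))
  have h3 : δ / (b - a + 1) * (b - a) ≤ δ := by
    rw [div_mul_eq_mul_div, div_le_iff₀ (by linarith)]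
    nlinarith
  linarith

theorem norm_sub_le_of_norm_deriv_right_le {F : Type*} [NormedAddCommGroup F] [NormedSpace ℝ F]
    {f f' : ℝ → F} {B B' : ℝ → ℝ} {a b : ℝ} (hab : a ≤ b) (hf : ContinuousOn f (Icc a b))
    (hf' : ∀ x ∈ Ico a b, HasDerivWithinAt f (f' x) (Ici x) x)
    (hB : ContinuousOn B (Icc a b)) (hB' : ∀ x ∈ Ico a b, HasDerivWithinAt B (B' x) (Ici x) x)
    (h : ∀ x ∈ Ico a b, ‖f' x‖ ≤ B' x) :
    ‖f b - f a‖ ≤ B b - B a := by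
  refine image_norm_le_of_norm_deriv_right_le_deriv_boundary'
      (f := fun x => f x - f a) (f' := f') (B := fun x => B x - B a)
      (B' := B') (a := a) (b := b) (hf.sub continuousOn_const) (fun x hx => (hf' x hx).sub_const _)
      (by simp) (hB.sub continuousOn_const) (fun x hx => (hB' x hx).sub_const _) h
      (right_mem_Icc.2 hab)

/-- Lebesgue measure is a multiple of three-dimensional Hausdorff measure, which an antilipschitz
map controls under preimages. This replaces a Jacobian change of variables and needs neither
differentiability nor surjectivity. -/
theorem volume_preimage_le_of_expanding {G : R3 → R3} {c : ℝ} (hc : 0 < c)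
    (hG : ∀ x y, c * ‖x - y‖ ≤ ‖G x - G y‖) (s : Set R3) :
    volume (G ⁻¹' s) ≤ ENNReal.ofReal (c⁻¹ ^ 3) * volume s := by
  have hA : AntilipschitzWith (Real.toNNReal c⁻¹) G := by
    refine AntilipschitzWith.of_le_mul_dist fun x y => ?_
    rw [dist_eq_norm, dist_eq_norm, Real.coe_toNNReal _ (by positivity), inv_mul_eq_div,
      le_div_iff₀ hc, mul_comm]
    exact hG x y
  have h := hA.hausdorffMeasure_preimage_le (d := 3) (by norm_num) s
  rw [← EuclideanSpace.euclideanHausdorffMeasure_eq_volume 3,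
    Measure.euclideanHausdorffMeasure_def]
  simp only [Measure.smul_apply, ENNReal.smul_def, smul_eq_mul]
  have h3 : ENNReal.ofReal (c⁻¹ ^ 3) = ((Real.toNNReal c⁻¹ : NNReal) : ℝ≥0∞) ^ (3 : ℝ) := by
    rw [ENNReal.ofReal_pow (by positivity)]
    norm_cast
  rw [h3, mul_left_comm]
  gcongr
  exact_mod_cast h

theorem lintegral_comp_le_of_expanding {G : R3 → R3} {c : ℝ} (hc : 0 < c) (hGm : Measurable G)
    (hG : ∀ x y, c * ‖x - y‖ ≤ ‖G x - G y‖) {h : R3 → ℝ≥0∞} (hh : Measurable h) :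
    ∫⁻ v, h (G v) ≤ ENNReal.ofReal (c⁻¹ ^ 3) * ∫⁻ y, h y := by
  rw [← lintegral_map hh hGm, ← smul_eq_mul, ← lintegral_smul_measure]
  refine lintegral_mono' (Measure.le_iff.2 fun s hs => ?_) le_rfl
  rw [Measure.map_apply hGm hs, Measure.smul_apply, smul_eq_mul]
  exact volume_preimage_le_of_expanding hc hG s

theorem one_le_bracket {F : Type*} [NormedAddCommGroup F] (x : F) : 1 ≤ bracket x := by
  rw [bracket, Real.one_le_sqrt]
  nlinarith [norm_nonneg x]

theorem norm_le_bracket {F : Type*} [NormedAddCommGroup F] (x : F) : ‖x‖ ≤ bracket x :=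
  Real.le_sqrt_of_sq_le (by linarith)

/-- Since (1+t)/2 ≤ ⟨t⟩, exchanging the weights costs 2^p ≤ 2³ = 8. Powers of 1+t are easy to
integrate in time. -/
theorem le_mul_rpow_of_bracket_rpow_mul_le {t p y B : ℝ} (ht : 0 ≤ t) (hp : 0 ≤ p) (hp3 : p ≤ 3)
    (hy : 0 ≤ y) (h : bracket t ^ p * y ≤ B) : y ≤ 8 * B * (1 + t) ^ (-p) := by
  have h1 : (1 + t) / 2 ≤ bracket t := by
    have := one_le_bracket t
    have := norm_le_bracket t
    rw [Real.norm_of_nonneg ht] at this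
    linarith
  have h2 : ((1 + t) / 2) ^ p ≤ bracket t ^ p := Real.rpow_le_rpow (by positivity) h1 hp
  rw [Real.div_rpow (by linarith) (by norm_num)] at h2
  have h3 : (2 : ℝ) ^ p ≤ 8 := by
    calc (2 : ℝ) ^ p ≤ 2 ^ (3 : ℝ) := Real.rpow_le_rpow_of_exponent_le (by norm_num) hp3
      _ = 8 := by norm_num
  have h4 : (0 : ℝ) < (1 + t) ^ p := by positivity
  have h5 : (1 + t) ^ p / 8 ≤ bracket t ^ p :=
    le_trans (div_le_div_of_nonneg_left h4.le (by positivity) h3) h2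
  rw [Real.rpow_neg (by linarith), ← div_eq_mul_inv, le_div_iff₀ h4]
  nlinarith

/-! ### Characteristic flow of a regular field: existence, Lipschitz and second-difference bounds.
-/

/-- A bounded force field, `C^{1,1}` in space (in the sense of second differences) and continuous
in time uniformly in space, with bounds `B`. -/
structure RegularField (B : ℝ) (E : ℝ → R3 → R3) : Prop where
  bound : ∀ t, 0 ≤ t → ∀ x, ‖E t x‖ ≤ B
  lipschitz : ∀ t, 0 ≤ t → ∀ x y, ‖E t x - E t y‖ ≤ B * ‖x - y‖
  second : ∀ t, 0 ≤ t → ∀ x y c, ‖E t x + E t y - (2 : ℝ) • E t c‖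
    ≤ B * ‖x + y - (2 : ℝ) • c‖ + B * (‖x - c‖ ^ 2 + ‖y - c‖ ^ 2)
  continuous : ∀ t, 0 ≤ t → ∀ ε > 0, ∀ᶠ s in 𝓝[Ici 0] t, ∀ x, ‖E s x - E t x‖ ≤ ε

section RegularField

variable {B : ℝ} {E : ℝ → R3 → R3}

theorem RegularField.nonneg (hE : RegularField B E) : 0 ≤ B :=
  (norm_nonneg _).trans (hE.bound 0 le_rfl 0)

theorem RegularField.shift (hE : RegularField B E) {s : ℝ} (hs : 0 ≤ s) :
    RegularField B (fun r => E (s + r)) where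
  bound t ht := hE.bound _ (add_nonneg hs ht)
  lipschitz t ht := hE.lipschitz _ (add_nonneg hs ht)
  second t ht := hE.second _ (add_nonneg hs ht)
  continuous t ht ε hε := by
    have h := hE.continuous (s + t) (add_nonneg hs ht) ε hε
    have hc : Tendsto (fun r : ℝ => s + r) (𝓝[Ici 0] t) (𝓝[Ici 0] (s + t)) := by
      refine tendsto_nhdsWithin_iff.2 ⟨?_, ?_⟩
      · exact ((continuous_const.add continuous_id).tendsto t).mono_left nhdsWithin_le_nhds
      · filter_upwards [self_mem_nhdsWithin] with r hr
        exact add_nonneg hs hr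
    exact hc.eventually h

theorem RegularField.continuousOn_comp (hE : RegularField B E) {c : ℝ → R3}
    (hc : ContinuousOn c (Ici 0)) : ContinuousOn (fun t => E t (c t)) (Ici 0) := by
  intro t ht
  rw [ContinuousWithinAt, tendsto_iff_norm_sub_tendsto_zero]
  have hB := hE.nonneg
  rw [Metric.tendsto_nhds]
  intro ε hε
  have h1 := hE.continuous t ht (ε / 3) (by positivity)
  have h2 := (Metric.tendsto_nhds.1 (hc t ht)) (ε / (3 * (B + 1))) (by positivity)
  filter_upwards [h1, h2] with s hs1 hs2
  rw [dist_eq_norm] at hs2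
  have h3 := hE.lipschitz t ht (c s) (c t)
  have h4 : B * ‖c s - c t‖ ≤ ε / 3 := by
    rw [lt_div_iff₀ (by positivity)] at hs2
    nlinarith [norm_nonneg (c s - c t)]
  have h5 := norm_sub_le_norm_sub_add_norm_sub (E s (c s)) (E t (c s)) (E t (c t))
  rw [Real.dist_eq, sub_zero, abs_of_nonneg (norm_nonneg _)]
  linarith [hs1 (c s)]

/-- `c` follows the characteristics of `E` on `[0, T]`. -/
def IsCharacteristic (E : ℝ → R3 → R3) (T : ℝ) (c : ℝ → Phase) : Prop :=
  ∀ t ∈ Icc 0 T, HasDerivWithinAt c ((c t).2, E t (c t).1) (Icc 0 T) t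

theorem IsCharacteristic.mono {T T' : ℝ} {c : ℝ → Phase} (h : IsCharacteristic E T c)
    (hT : T' ≤ T) : IsCharacteristic E T' c := fun t ht =>
  (h t ⟨ht.1, ht.2.trans hT⟩).mono (Icc_subset_Icc_right hT)

theorem IsCharacteristic.continuousOn {T : ℝ} {c : ℝ → Phase} (h : IsCharacteristic E T c) :
    ContinuousOn c (Icc 0 T) := fun t ht => (h t ht).continuousWithinAt

theorem IsCharacteristic.hasDerivWithinAt_right {T : ℝ} {c : ℝ → Phase}
    (h : IsCharacteristic E T c) {t : ℝ} (ht : t ∈ Ico 0 T) :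
    HasDerivWithinAt c ((c t).2, E t (c t).1) (Ici t) t := by
  refine (h t ⟨ht.1, ht.2.le⟩).mono_of_mem_nhdsWithin ?_
  exact mem_of_superset (Icc_mem_nhdsGE ht.2) (Icc_subset_Icc_left ht.1)

theorem IsFlow.isCharacteristic {Φ : ℝ → Phase → Phase} (h : IsFlow E Φ) (z : Phase) (T : ℝ) :
    IsCharacteristic E T (fun t => Φ t z) := fun t ht =>
  ((h z).2 t ht.1).mono Icc_subset_Ici_self

theorem IsCharacteristic.norm_sub_le (hE : RegularField B E) {T : ℝ} {p q : ℝ → Phase}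
    (hp : IsCharacteristic E T p) (hq : IsCharacteristic E T q) {t : ℝ} (ht : t ∈ Icc 0 T) :
    ‖p t - q t‖ ≤ Real.exp ((1 + B) * t) * ‖p 0 - q 0‖ := by
  have hB := hE.nonneg
  have h := norm_le_gronwallBound_of_norm_deriv_right_le (f := fun s => p s - q s)
    (f' := fun s => ((p s).2, E s (p s).1) - ((q s).2, E s (q s).1)) (a := 0) (b := T)
    (δ := ‖p 0 - q 0‖) (K := 1 + B) (ε := 0) (hp.continuousOn.sub hq.continuousOn)
    (fun s hs => (hp.hasDerivWithinAt_right hs).sub (hq.hasDerivWithinAt_right hs)) le_rfl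
    (fun s hs => ?_) t ht
  · rw [gronwallBound_ε0, sub_zero, mul_comm] at h
    exact h
  · have h0 := norm_nonneg (p s - q s)
    have h1 : ‖(p s).1 - (q s).1‖ ≤ ‖p s - q s‖ := norm_fst_le (p s - q s)
    have h2 : ‖(p s).2 - (q s).2‖ ≤ ‖p s - q s‖ := norm_snd_le (p s - q s)
    have h3 := hE.lipschitz s hs.1 (p s).1 (q s).1
    rw [Prod.mk_sub_mk, Prod.norm_mk, add_zero]
    refine max_le ?_ ?_ <;> nlinarith

theorem IsCharacteristic.eqOn (hE : RegularField B E) {T : ℝ} {p q : ℝ → Phase}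
    (hp : IsCharacteristic E T p) (hq : IsCharacteristic E T q) (h0 : p 0 = q 0) :
    EqOn p q (Icc 0 T) := fun t ht => by
  have := hp.norm_sub_le hE hq ht
  rw [h0, sub_self, norm_zero, mul_zero] at this
  exact sub_eq_zero.1 (norm_le_zero_iff.1 this)

theorem RegularField.exists_isCharacteristic (hE : RegularField B E) {T : ℝ} (hT : 0 ≤ T)
    (z : Phase) : ∃ c, c 0 = z ∧ IsCharacteristic E T c := by
  have hB := hE.nonneg
  -- Free transport is removed by the variables (x - tv, v). In them the field is bounded on all of
  -- phase space for t in [0,T], so a single Picard–Lindelöf step reaches time T; the original field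
  -- grows with v.
  set G : ℝ → Phase → Phase := fun t y => (-(t • E t (y.1 + t • y.2)), E t (y.1 + t • y.2)) with hG
  have hpl : IsPicardLindelof G (tmin := 0) (tmax := T) ⟨0, le_rfl, hT⟩ z
      (Real.toNNReal ((1 + T) * B * T)) 0 (Real.toNNReal ((1 + T) * B))
      (Real.toNNReal ((1 + T) * (B * (1 + T)))) := by
    refine ⟨fun t ht => ?_, fun y _ => ?_, fun t ht y _ => ?_, ?_⟩
    · refine (LipschitzWith.of_dist_le_mul fun y y' => ?_).lipschitzOnWith
      rw [Real.coe_toNNReal _ (by positivity), dist_eq_norm, dist_eq_norm]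
      have h1 : ‖y.1 - y'.1‖ ≤ ‖y - y'‖ := norm_fst_le (y - y')
      have h2 : ‖y.2 - y'.2‖ ≤ ‖y - y'‖ := norm_snd_le (y - y')
      have h3 := hE.lipschitz t ht.1 (y.1 + t • y.2) (y'.1 + t • y'.2)
      have h4 : ‖(y.1 + t • y.2) - (y'.1 + t • y'.2)‖ ≤ (1 + T) * ‖y - y'‖ := by
        rw [add_sub_add_comm, ← smul_sub]
        refine (norm_add_le _ _).trans ?_
        rw [norm_smul, Real.norm_of_nonneg ht.1]
        nlinarith [ht.1, ht.2, norm_nonneg (y.2 - y'.2)]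
      have h5 : ‖E t (y.1 + t • y.2) - E t (y'.1 + t • y'.2)‖ ≤ B * (1 + T) * ‖y - y'‖ := by
        refine h3.trans ?_
        rw [mul_assoc]
        gcongr
      have h6 : 0 ≤ B * (1 + T) * ‖y - y'‖ := by positivity
      rw [hG, Prod.mk_sub_mk, Prod.norm_mk]
      refine max_le ?_ ?_
      · rw [neg_sub_neg, ← smul_sub, norm_smul, Real.norm_of_nonneg ht.1, norm_sub_rev]
        calc _ ≤ T * (B * (1 + T) * ‖y - y'‖) :=
              mul_le_mul ht.2 h5 (norm_nonneg _) hT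
          _ ≤ _ := by nlinarith
      · nlinarith
    · have hc : ContinuousOn (fun t => E t (y.1 + t • y.2)) (Icc 0 T) :=
        (hE.continuousOn_comp (c := fun t => y.1 + t • y.2) (by fun_prop)).mono
          Icc_subset_Ici_self
      exact ((continuousOn_id.smul hc).neg).prodMk hc
    · have h1 := hE.bound t ht.1 (y.1 + t • y.2)
      rw [Real.coe_toNNReal _ (by positivity), hG, Prod.norm_mk]
      refine max_le ?_ ?_
      · rw [norm_neg, norm_smul, Real.norm_of_nonneg ht.1]
        calc _ ≤ T * B := mul_le_mul ht.2 h1 (norm_nonneg _) hT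
          _ ≤ _ := by nlinarith
      · nlinarith
    · rw [Real.coe_toNNReal _ (by positivity), Real.coe_toNNReal _ (by positivity)]
      simp [hT]
  obtain ⟨c, hc0, hc⟩ := hpl.exists_eq_forall_mem_Icc_hasDerivWithinAt₀
  refine ⟨fun t => ((c t).1 + t • (c t).2, (c t).2), by simpa using by rw [hc0], fun t ht => ?_⟩
  have h1 : HasDerivWithinAt (fun s => (c s).1) (G t (c t)).1 (Icc 0 T) t := (hc t ht).fst
  have h2 : HasDerivWithinAt (fun s => (c s).2) (G t (c t)).2 (Icc 0 T) t := (hc t ht).snd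
  have h3 : HasDerivWithinAt (fun s => ((c s).1 + s • (c s).2, (c s).2)) _ (Icc 0 T) t :=
    HasDerivWithinAt.prodMk (h1.add ((hasDerivWithinAt_id t (Icc 0 T)).smul h2)) h2
  convert h3 using 1
  simp [hG]

theorem RegularField.exists_isFlow (hE : RegularField B E) : ∃ Φ, IsFlow E Φ := by
  choose c hc0 hc using fun (n : ℕ) (z : Phase) =>
    hE.exists_isCharacteristic (Nat.cast_nonneg (α := ℝ) n) z
  have hagree : ∀ (n m : ℕ) (z : Phase) (t : ℝ), 0 ≤ t → t ≤ n → t ≤ m → c n z t = c m z t := by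
    intro n m z t h0 hn hm
    exact IsCharacteristic.eqOn hE ((hc n z).mono (min_le_left (n : ℝ) m))
      ((hc m z).mono (min_le_right (n : ℝ) m)) (by rw [hc0, hc0]) ⟨h0, le_min hn hm⟩
  -- The extra 1 puts t strictly inside the interval of its local solution, so the derivative at t
  -- can be read off from that one solution.
  refine ⟨fun t z => c (⌊t⌋₊ + 1) z t, fun z => ⟨hc0 _ z, fun t ht => ?_⟩⟩
  have hlt : t < ((⌊t⌋₊ + 1 : ℕ) : ℝ) := by exact_mod_cast Nat.lt_floor_add_one t
  have h1 := hc (⌊t⌋₊ + 1) z t ⟨ht, hlt.le⟩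
  have hm : Icc 0 ((⌊t⌋₊ + 1 : ℕ) : ℝ) ∈ 𝓝[Ici 0] t := by
    rw [← Ici_inter_Iic]
    exact inter_mem_nhdsWithin _ (Iic_mem_nhds hlt)
  refine (h1.mono_of_mem_nhdsWithin hm).congr_of_eventuallyEq ?_ rfl
  filter_upwards [hm, self_mem_nhdsWithin] with s hs hs0
  exact hagree _ _ z s hs0 (by exact_mod_cast (Nat.lt_floor_add_one s).le) hs.2

section Flow

variable {Φ : ℝ → Phase → Phase}

theorem IsFlow.continuousOn (hΦ : IsFlow E Φ) (z : Phase) :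
    ContinuousOn (fun t => Φ t z) (Ici 0) := fun t ht => ((hΦ z).2 t ht).continuousWithinAt

theorem IsFlow.norm_sub_le (hE : RegularField B E) (hΦ : IsFlow E Φ) {t : ℝ} (ht : 0 ≤ t)
    (z z' : Phase) : ‖Φ t z - Φ t z'‖ ≤ Real.exp ((1 + B) * t) * ‖z - z'‖ := by
  have := (hΦ.isCharacteristic z t).norm_sub_le hE (hΦ.isCharacteristic z' t) ⟨ht, le_rfl⟩
  rwa [(hΦ z).1, (hΦ z').1] at this

theorem IsFlow.continuous (hE : RegularField B E) (hΦ : IsFlow E Φ) {t : ℝ} (ht : 0 ≤ t) :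
    Continuous (Φ t) := by
  refine (LipschitzWith.of_dist_le_mul (K := Real.toNNReal (Real.exp ((1 + B) * t)))
    fun z z' => ?_).continuous
  rw [Real.coe_toNNReal _ (Real.exp_pos _).le, dist_eq_norm, dist_eq_norm]
  exact hΦ.norm_sub_le hE ht z z'

theorem IsFlow.add_apply (hE : RegularField B E) (hΦ : IsFlow E Φ) {s : ℝ} (hs : 0 ≤ s)
    {Ψ : ℝ → Phase → Phase} (hΨ : IsFlow (fun r => E (s + r)) Ψ) {t : ℝ} (ht : 0 ≤ t) (z : Phase) :
    Φ (s + t) z = Ψ t (Φ s z) := by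
  have h1 : IsCharacteristic (fun r => E (s + r)) t (fun r => Φ (s + r) z) := fun r hr => by
    have h := (hΦ z).2 (s + r) (add_nonneg hs hr.1)
    have h2 : HasDerivWithinAt (fun r : ℝ => s + r) 1 (Icc 0 t) r := by
      simpa using ((hasDerivAt_id r).const_add s).hasDerivWithinAt
    have := h.scomp r h2 (fun r hr => add_nonneg hs hr.1)
    simpa [Function.comp_def] using this
  exact h1.eqOn (hE.shift hs) (hΨ.isCharacteristic (Φ s z) t)
    (by simp [(hΨ (Φ s z)).1]) ⟨ht, le_rfl⟩

theorem IsFlow.norm_snd_sub_le (hE : RegularField B E) (hΦ : IsFlow E Φ) {t : ℝ} (ht : 0 ≤ t)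
    (z : Phase) : ‖(Φ t z).2 - z.2‖ ≤ B * t := by
  have h := norm_image_sub_le_of_norm_deriv_right_le_segment (f := fun s => (Φ s z).2)
    (f' := fun s => E s (Φ s z).1) (a := 0) (b := t) (C := B)
    (continuous_snd.comp_continuousOn (hΦ.isCharacteristic z t).continuousOn)
    (fun s hs => ((hΦ.isCharacteristic z t).hasDerivWithinAt_right hs).snd)
    (fun s hs => hE.bound s hs.1 _) t ⟨ht, le_rfl⟩
  simpa [(hΦ z).1] using h

theorem IsFlow.norm_fst_sub_le (hE : RegularField B E) (hΦ : IsFlow E Φ) {t : ℝ} (ht : 0 ≤ t)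
    (z : Phase) : ‖(Φ t z).1 - z.1‖ ≤ (‖z.2‖ + B * t) * t := by
  have hB := hE.nonneg
  have h := norm_image_sub_le_of_norm_deriv_right_le_segment (f := fun s => (Φ s z).1)
    (f' := fun s => (Φ s z).2) (a := 0) (b := t) (C := ‖z.2‖ + B * t)
    (continuous_fst.comp_continuousOn (hΦ.isCharacteristic z t).continuousOn)
    (fun s hs => ((hΦ.isCharacteristic z t).hasDerivWithinAt_right hs).fst)
    (fun s hs => ?_) t ⟨ht, le_rfl⟩
  · simpa [(hΦ z).1] using h
  · have h1 := hΦ.norm_snd_sub_le hE hs.1 z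
    have h2 : ‖(Φ s z).2‖ ≤ ‖z.2‖ + ‖(Φ s z).2 - z.2‖ := by
      simpa using norm_add_le z.2 ((Φ s z).2 - z.2)
    nlinarith [hs.1, hs.2]

/-- Grönwall for the second difference, with a source quadratic in the first differences. In the
exponent 3(1+B)t two factors come from squaring the Lipschitz bound of the flow and one from
Grönwall. This plays the role of a C^{1,1} bound without differentiating the flow. -/
theorem IsFlow.norm_second_difference_le (hE : RegularField B E) (hΦ : IsFlow E Φ) {t : ℝ}
    (ht : 0 ≤ t) (z k : Phase) :
    ‖Φ t (z + k) + Φ t (z - k) - (2 : ℝ) • Φ t z‖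
      ≤ 2 * B * Real.exp (3 * (1 + B) * t) * ‖k‖ ^ 2 := by
  have hB := hE.nonneg
  set M := Real.exp ((1 + B) * t) with hM
  have hch := fun y => hΦ.isCharacteristic y t
  have hlip : ∀ s ∈ Ico 0 t, ∀ y, ‖y - z‖ ≤ ‖k‖ → ‖(Φ s y).1 - (Φ s z).1‖ ≤ M * ‖k‖ := by
    intro s hs y hy
    refine (norm_fst_le (Φ s y - Φ s z)).trans ((hΦ.norm_sub_le hE hs.1 y z).trans ?_)
    have : Real.exp ((1 + B) * s) ≤ M := Real.exp_le_exp.2 (by nlinarith [hs.2])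
    gcongr
  have h := norm_le_gronwallBound_of_norm_deriv_right_le
    (f := fun s => Φ s (z + k) + Φ s (z - k) - (2 : ℝ) • Φ s z)
    (f' := fun s => ((Φ s (z + k)).2, E s (Φ s (z + k)).1) + ((Φ s (z - k)).2, E s (Φ s (z - k)).1)
      - (2 : ℝ) • ((Φ s z).2, E s (Φ s z).1)) (a := 0) (b := t)
    (δ := 0) (K := 1 + B) (ε := 2 * B * (M * ‖k‖) ^ 2)
    (((hch _).continuousOn.add (hch _).continuousOn).sub
      (ContinuousOn.const_smul (hch z).continuousOn (2 : ℝ)))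
    (fun s hs => (((hch _).hasDerivWithinAt_right hs).add ((hch _).hasDerivWithinAt_right hs)).sub
      (HasDerivWithinAt.const_smul (2 : ℝ) ((hch z).hasDerivWithinAt_right hs))) ?_ (fun s hs => ?_) t ⟨ht, le_rfl⟩
  · rw [gronwallBound_of_K_ne_0 (by positivity), sub_zero] at h
    simp only [zero_mul, zero_add, ← hM] at h
    refine h.trans ?_
    have hM0 : 0 < M := Real.exp_pos _
    have h1 : 2 * B * (M * ‖k‖) ^ 2 / (1 + B) ≤ 2 * B * (M * ‖k‖) ^ 2 :=
      div_le_self (by positivity) (by linarith)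
    calc _ ≤ 2 * B * (M * ‖k‖) ^ 2 * (M - 1) := by
            have : 1 ≤ M := Real.one_le_exp (by positivity)
            gcongr
      _ ≤ 2 * B * (M * ‖k‖) ^ 2 * M := by gcongr; linarith
      _ = 2 * B * (M ^ 3) * ‖k‖ ^ 2 := by ring
      _ = _ := by
        rw [hM, ← Real.exp_nat_mul]
        congr 3
        push_cast
        ring
  · simp only [(hΦ _).1]
    rw [two_smul, norm_le_zero_iff]
    abel
  · have h1 := hE.second s hs.1 (Φ s (z + k)).1 (Φ s (z - k)).1 (Φ s z).1
    have h2 := hlip s hs (z + k) (by simp)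
    have h3 := hlip s hs (z - k) (by simp)
    have h4 := pow_le_pow_left₀ (norm_nonneg _) h2 2
    have h5 := pow_le_pow_left₀ (norm_nonneg _) h3 2
    set D := Φ s (z + k) + Φ s (z - k) - (2 : ℝ) • Φ s z with hD
    have h6 : ‖(Φ s (z + k)).1 + (Φ s (z - k)).1 - (2 : ℝ) • (Φ s z).1‖ ≤ ‖D‖ := norm_fst_le D
    have h7 : ‖(Φ s (z + k)).2 + (Φ s (z - k)).2 - (2 : ℝ) • (Φ s z).2‖ ≤ ‖D‖ := norm_snd_le D
    have h8 : 0 ≤ 2 * B * (M * ‖k‖) ^ 2 := by positivity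
    rw [Prod.smul_mk, Prod.mk_add_mk, Prod.mk_sub_mk, Prod.norm_mk]
    have h9 := norm_nonneg D
    refine max_le ?_ ?_ <;> nlinarith

end Flow

end RegularField

/-! ### Taylor estimates and second differences. -/

instance : (volume : Measure Phase).IsNegInvariant :=
  Measure.IsAddHaarMeasure.isNegInvariant_of_regular _

section Taylor

variable {V W : Type*} [NormedAddCommGroup V] [NormedSpace ℝ V] [NormedAddCommGroup W]
  [NormedSpace ℝ W]

theorem norm_sub_sub_fderiv_le {F : V → W} (hF : Differentiable ℝ F) {K : ℝ} (hK : 0 ≤ K)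
    (h : ∀ x y, ‖fderiv ℝ F x - fderiv ℝ F y‖ ≤ K * ‖x - y‖) (a c : V) :
    ‖F a - F c - fderiv ℝ F c (a - c)‖ ≤ K * ‖a - c‖ ^ 2 := by
  have := (convex_closedBall c ‖a - c‖).norm_image_sub_le_of_norm_hasFDerivWithin_le'
    (f := F) (f' := fderiv ℝ F) (φ := fderiv ℝ F c) (C := K * ‖a - c‖) (x := c) (y := a)
    (fun x _ => (hF x).hasFDerivAt.hasFDerivWithinAt)
    (fun x hx => (h x c).trans (by
      have : ‖x - c‖ ≤ ‖a - c‖ := by simpa [dist_eq_norm] using hx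
      gcongr))
    (by simp) (by simp [dist_eq_norm])
  rwa [mul_assoc, ← sq] at this

theorem norm_add_sub_two_smul_le {F : V → W} (hF : Differentiable ℝ F) {K L : ℝ} (hK : 0 ≤ K)
    (h : ∀ x y, ‖fderiv ℝ F x - fderiv ℝ F y‖ ≤ K * ‖x - y‖) (hL : ∀ x, ‖fderiv ℝ F x‖ ≤ L)
    (a b c : V) :
    ‖F a + F b - (2 : ℝ) • F c‖
      ≤ L * ‖a + b - (2 : ℝ) • c‖ + K * (‖a - c‖ ^ 2 + ‖b - c‖ ^ 2) := by
  have h1 := norm_sub_sub_fderiv_le hF hK h a c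
  have h2 := norm_sub_sub_fderiv_le hF hK h b c
  have h3 : ‖fderiv ℝ F c (a + b - (2 : ℝ) • c)‖ ≤ L * ‖a + b - (2 : ℝ) • c‖ :=
    ((fderiv ℝ F c).le_opNorm _).trans (by gcongr; exact hL c)
  have h4 : F a + F b - (2 : ℝ) • F c = fderiv ℝ F c (a + b - (2 : ℝ) • c)
      + ((F a - F c - fderiv ℝ F c (a - c)) + (F b - F c - fderiv ℝ F c (b - c))) := by
    simp only [map_sub, map_add, two_smul]
    abel
  rw [h4]
  refine (norm_add_le _ _).trans ?_
  have := norm_add_le (F a - F c - fderiv ℝ F c (a - c)) (F b - F c - fderiv ℝ F c (b - c))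
  linarith

/-- The Taylor remainder e satisfies |e(2k) - 2e(k)| ≤ C|k|². Iterating along k/2ⁿ gives a
convergent geometric series plus 2ⁿ|e(k/2ⁿ)|, and the latter tends to 0 by differentiability at the
single point z. -/
theorem abs_sub_sub_fderiv_le_of_second_difference {F : V → ℝ} {C : ℝ} {z : V}
    (hF : DifferentiableAt ℝ F z) (hC : 0 ≤ C)
    (h : ∀ y k, |F (y + k) + F (y - k) - 2 * F y| ≤ C * ‖k‖ ^ 2) (k : V) :
    |F (z + k) - F z - fderiv ℝ F z k| ≤ C * ‖k‖ ^ 2 := by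
  set e : V → ℝ := fun k => F (z + k) - F z - fderiv ℝ F z k with he
  have h2 : ∀ k, |e ((2 : ℝ) • k)| ≥ 0 ∧ |e ((2 : ℝ) • k) - 2 * e k| ≤ C * ‖k‖ ^ 2 := by
    intro k
    refine ⟨abs_nonneg _, ?_⟩
    have := h (z + k) k
    simp only [he, map_smul, smul_eq_mul]
    rw [add_sub_cancel_right, add_assoc, ← two_smul ℝ k] at this
    convert this using 2
    ring
  have step : ∀ n : ℕ, |e k| ≤ 2 ^ n * |e ((1 / 2 : ℝ) ^ n • k)|
      + C * ‖k‖ ^ 2 * (1 - (1 / 2) ^ n) := by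
    intro n
    induction n with
    | zero => simp
    | succ n ih =>
      refine ih.trans ?_
      have h3 := (h2 ((1 / 2 : ℝ) ^ (n + 1) • k)).2
      have h4 : (2 : ℝ) • ((1 / 2 : ℝ) ^ (n + 1) • k) = (1 / 2 : ℝ) ^ n • k := by
        rw [smul_smul, pow_succ]
        congr 1
        ring
      rw [h4, norm_smul, Real.norm_of_nonneg (by positivity), mul_pow] at h3
      have h5 : |e ((1 / 2 : ℝ) ^ n • k)| ≤ 2 * |e ((1 / 2 : ℝ) ^ (n + 1) • k)|
          + C * (((1 / 2 : ℝ) ^ (n + 1)) ^ 2 * ‖k‖ ^ 2) := by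
        have h6 := abs_sub_abs_le_abs_sub (e ((1 / 2 : ℝ) ^ n • k))
          (2 * e ((1 / 2 : ℝ) ^ (n + 1) • k))
        rw [abs_mul, abs_two] at h6
        linarith
      have h6 : (2 : ℝ) ^ n * (((1 / 2 : ℝ) ^ (n + 1)) ^ 2) ≤ (1 / 2) ^ (n + 1) := by
        have : (2 : ℝ) ^ n * (1 / 2) ^ n = 1 := by rw [← mul_pow]; norm_num
        have hx : (0 : ℝ) < (1 / 2) ^ n := by positivity
        calc (2 : ℝ) ^ n * (((1 / 2 : ℝ) ^ (n + 1)) ^ 2)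
            = ((2 : ℝ) ^ n * (1 / 2) ^ n) * ((1 / 2) ^ n / 4) := by ring
          _ = (1 / 2) ^ n / 4 := by rw [this, one_mul]
          _ ≤ _ := by rw [pow_succ]; linarith
      have h7 : (0 : ℝ) ≤ C * ‖k‖ ^ 2 := by positivity
      calc _ ≤ 2 ^ n * (2 * |e ((1 / 2 : ℝ) ^ (n + 1) • k)|
          + C * (((1 / 2 : ℝ) ^ (n + 1)) ^ 2 * ‖k‖ ^ 2)) + C * ‖k‖ ^ 2 * (1 - (1 / 2) ^ n) := by
            gcongr
        _ = 2 ^ (n + 1) * |e ((1 / 2 : ℝ) ^ (n + 1) • k)|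
          + (C * ‖k‖ ^ 2) * (2 ^ n * (((1 / 2 : ℝ) ^ (n + 1)) ^ 2))
          + C * ‖k‖ ^ 2 * (1 - (1 / 2) ^ n) := by ring
        _ ≤ 2 ^ (n + 1) * |e ((1 / 2 : ℝ) ^ (n + 1) • k)|
          + (C * ‖k‖ ^ 2) * (1 / 2) ^ (n + 1)
          + C * ‖k‖ ^ 2 * (1 - (1 / 2) ^ n) := by gcongr
        _ = _ := by rw [pow_succ (1 / 2 : ℝ)]; ring
  refine le_of_forall_pos_le_add fun δ hδ => ?_
  have h9 := (hasFDerivAt_iff_isLittleO_nhds_zero.1 hF.hasFDerivAt).def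
    (c := δ / (‖k‖ + 1)) (by positivity)
  have h10 : Tendsto (fun n : ℕ => (1 / 2 : ℝ) ^ n • k) atTop (𝓝 0) := by
    have := (tendsto_pow_atTop_nhds_zero_of_lt_one (r := (1 / 2 : ℝ)) (by norm_num)
      (by norm_num)).smul_const k
    simpa using this
  obtain ⟨n, hn⟩ := (h10.eventually h9).exists
  have h11 := step n
  rw [Real.norm_eq_abs, norm_smul, Real.norm_of_nonneg (by positivity)] at hn
  have h12 : 2 ^ n * |e ((1 / 2 : ℝ) ^ n • k)| ≤ δ := by
    calc 2 ^ n * |e ((1 / 2 : ℝ) ^ n • k)| ≤ 2 ^ n * (δ / (‖k‖ + 1) * ((1 / 2) ^ n * ‖k‖)) := by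
          gcongr
      _ = ((2 : ℝ) ^ n * (1 / 2) ^ n) * (δ / (‖k‖ + 1) * ‖k‖) := by ring
      _ = δ / (‖k‖ + 1) * ‖k‖ := by rw [← mul_pow]; norm_num
      _ ≤ δ := by
        rw [div_mul_eq_mul_div, div_le_iff₀ (by positivity)]
        nlinarith
  have h13 : C * ‖k‖ ^ 2 * (1 - (1 / 2) ^ n) ≤ C * ‖k‖ ^ 2 := by
    have : (0 : ℝ) < (1 / 2) ^ n := by positivity
    have : (0 : ℝ) ≤ C * ‖k‖ ^ 2 := by positivity
    nlinarith
  linarith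

end Taylor

/-! ### Test functions with bounded second differences, and their mollification. -/

/-- `θ` is bounded by `M`, Lipschitz with constant `L`, has second differences bounded by `C`,
and vanishes outside the ball of radius `R`. -/
structure IsTestBounded (M L C R : ℝ) (θ : Phase → ℝ) : Prop where
  bound : ∀ z, |θ z| ≤ M
  lipschitz : ∀ z z', |θ z - θ z'| ≤ L * ‖z - z'‖
  second : ∀ z k, |θ (z + k) + θ (z - k) - 2 * θ z| ≤ C * ‖k‖ ^ 2
  support : ∀ z, R < ‖z‖ → θ z = 0

section TestBounded

variable {M L C R : ℝ} {θ : Phase → ℝ}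

theorem exists_norm_phase_eq_one : ∃ e : Phase, ‖e‖ = 1 :=
  ⟨dirX 0, by simp [dirX, Prod.norm_mk]⟩

theorem IsTestBounded.nonneg_lipschitz (h : IsTestBounded M L C R θ) : 0 ≤ L := by
  obtain ⟨e, he⟩ := exists_norm_phase_eq_one
  have := (abs_nonneg _).trans (h.lipschitz e 0)
  rwa [sub_zero, he, mul_one] at this

theorem IsTestBounded.nonneg_second (h : IsTestBounded M L C R θ) : 0 ≤ C := by
  obtain ⟨e, he⟩ := exists_norm_phase_eq_one
  have := (abs_nonneg _).trans (h.second 0 e)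
  rwa [he, one_pow, mul_one] at this

theorem IsTestBounded.lipschitzWith (h : IsTestBounded M L C R θ) :
    LipschitzWith (Real.toNNReal L) θ :=
  LipschitzWith.of_dist_le_mul fun z z' => by
    rw [Real.coe_toNNReal _ h.nonneg_lipschitz, Real.dist_eq, dist_eq_norm]
    exact h.lipschitz z z'

theorem IsTestBounded.continuous (h : IsTestBounded M L C R θ) : Continuous θ :=
  h.lipschitzWith.continuous

theorem IsTestBounded.hasCompactSupport (h : IsTestBounded M L C R θ) : HasCompactSupport θ := by
  refine HasCompactSupport.intro (isCompact_closedBall (0 : Phase) R) fun z hz => h.support z ?_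
  simpa using hz

theorem IsTestBounded.norm_fderiv_le (h : IsTestBounded M L C R θ) (z : Phase) :
    ‖fderiv ℝ θ z‖ ≤ L := by
  have := norm_fderiv_le_of_lipschitz ℝ (x₀ := z) h.lipschitzWith
  rwa [Real.coe_toNNReal _ h.nonneg_lipschitz] at this

theorem IsTestBounded.fderiv_eq_zero (h : IsTestBounded M L C R θ) {z : Phase} (hz : R < ‖z‖) :
    fderiv ℝ θ z = 0 := by
  have : θ =ᶠ[𝓝 z] fun _ => 0 := by
    filter_upwards [continuous_norm.continuousAt.eventually (lt_mem_nhds hz)] with y hy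
    exact h.support y hy
  rw [this.fderiv_eq]
  simp

/-- Averages of a continuous function against a normalised bump function of radius `ε`. -/
theorem abs_integral_bump_mul_le (φ : ContDiffBump (0 : Phase)) {G : Phase → ℝ} {K : ℝ}
    (h : ∀ y, ‖y‖ ≤ φ.rOut → |G y| ≤ K) :
    |∫ y, φ.normed volume y * G y| ≤ K := by
  have h1 : ∀ y, ‖φ.normed volume y * G y‖ ≤ φ.normed volume y * K := by
    intro y
    rw [norm_mul, Real.norm_of_nonneg (φ.nonneg_normed y), Real.norm_eq_abs]
    by_cases hy : ‖y‖ ≤ φ.rOut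
    · exact mul_le_mul_of_nonneg_left (h y hy) (φ.nonneg_normed y)
    · have : φ.normed volume y = 0 := by
        rw [← Function.notMem_support, φ.support_normed_eq]
        simp only [Metric.mem_ball, dist_zero_right, not_lt]
        exact (not_le.1 hy).le
      simp [this]
  have h2 := norm_integral_le_of_norm_le (φ.integrable_normed.mul_const K) (.of_forall h1)
  rwa [integral_mul_const, φ.integral_normed, one_mul] at h2

theorem integrable_bump_mul (φ : ContDiffBump (0 : Phase)) {G : Phase → ℝ} (hG : Continuous G) :
    Integrable (fun y => φ.normed volume y * G y) :=
  (φ.continuous_normed.mul hG).integrable_of_hasCompactSupport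
    φ.hasCompactSupport_normed.mul_right

/-- Averaging preserves the bounds M, L and C, so smoothing does not degrade the class as ε → 0. As
the bump is even, first-order errors cancel and the distance to θ is of order ε². -/
theorem IsTestBounded.exists_smooth (h : IsTestBounded M L C R θ) {ε : ℝ} (hε : 0 < ε)
    (hε1 : ε ≤ 1) : ∃ χ : Phase → ℝ, IsTestBounded M L C (R + 1) χ ∧ ContDiff ℝ ∞ χ ∧
      ∀ z, |χ z - θ z| ≤ C * ε ^ 2 := by
  let φ : ContDiffBump (0 : Phase) := ⟨ε / 2, ε, by positivity, by linarith⟩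
  have hc := h.continuous
  have hint : ∀ z, Integrable (fun y => φ.normed volume y * θ (z - y)) := fun z =>
    integrable_bump_mul φ (by fun_prop)
  refine ⟨fun z => ∫ y, φ.normed volume y * θ (z - y), ⟨fun z => ?_, fun z z' => ?_,
    fun z k => ?_, fun z hz => ?_⟩, ?_, fun z => ?_⟩
  · exact abs_integral_bump_mul_le φ fun y _ => h.bound _
  · rw [← integral_sub (hint z) (hint z')]
    simp_rw [← mul_sub]
    refine abs_integral_bump_mul_le φ fun y _ => ?_
    refine (h.lipschitz _ _).trans ?_
    rw [sub_sub_sub_cancel_right]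
  · have hadd : Integrable (fun y => φ.normed volume y * θ (z + k - y)
        + φ.normed volume y * θ (z - k - y)) := (hint _).add (hint _)
    rw [← integral_const_mul, ← integral_add (hint _) (hint _), ← integral_sub hadd
      ((hint _).const_mul 2)]
    have : ∀ y, φ.normed volume y * θ (z + k - y) + φ.normed volume y * θ (z - k - y)
        - 2 * (φ.normed volume y * θ (z - y)) = φ.normed volume y *
        (θ (z - y + k) + θ (z - y - k) - 2 * θ (z - y)) := by
      intro y
      rw [add_sub_right_comm z k y, sub_right_comm z k y]
      ring
    simp_rw [this]
    exact abs_integral_bump_mul_le φ fun y _ => h.second _ _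
  · have : |∫ y, φ.normed volume y * θ (z - y)| ≤ 0 := by
      refine abs_integral_bump_mul_le φ fun y hy => ?_
      rw [h.support, abs_zero]
      have h1 : ‖z‖ - ‖y‖ ≤ ‖z - y‖ := norm_sub_norm_le z y
      have h2 : ‖y‖ ≤ ε := hy
      linarith
    exact abs_nonpos_iff.1 this
  · have := φ.hasCompactSupport_normed (μ := (volume : Measure Phase))
      |>.contDiff_convolution_left (ContinuousLinearMap.lsmul ℝ ℝ)
      (φ.contDiff_normed (n := ⊤)) hc.locallyIntegrable (μ := volume)
    exact this
  · have h1 : ∫ y, φ.normed volume y * θ (z - y) = ∫ y, φ.normed volume y * θ (z + y) := by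
      rw [← integral_neg_eq_self]
      simp_rw [φ.normed_neg, sub_neg_eq_add]
    have h2 : θ z = ∫ y, φ.normed volume y * θ z := by
      rw [integral_mul_const, φ.integral_normed, one_mul]
    have hint2 : Integrable (fun y => φ.normed volume y * θ (z + y)) :=
      integrable_bump_mul φ (by fun_prop)
    have hint3 : Integrable (fun y => φ.normed volume y * θ z) :=
      integrable_bump_mul φ (by fun_prop)
    -- Symmetrising the average turns twice the error into an average of second differences of θ at
    -- z.
    have h3 : 2 * ((∫ y, φ.normed volume y * θ (z - y)) - θ z)
        = ∫ y, φ.normed volume y * (θ (z + y) + θ (z - y) - 2 * θ z) := by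
      have : ∀ y, φ.normed volume y * (θ (z + y) + θ (z - y) - 2 * θ z)
        = (φ.normed volume y * θ (z + y) + φ.normed volume y * θ (z - y))
          - 2 * (φ.normed volume y * θ z) := fun y => by ring
      simp_rw [this]
      have hadd : Integrable (fun y => φ.normed volume y * θ (z + y)
        + φ.normed volume y * θ (z - y)) := hint2.add (hint z)
      rw [integral_sub hadd (hint3.const_mul 2), integral_add hint2 (hint z),
        integral_const_mul, ← h2, ← h1]
      ring
    have h4 : |∫ y, φ.normed volume y * (θ (z + y) + θ (z - y) - 2 * θ z)| ≤ C * ε ^ 2 := by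
      refine abs_integral_bump_mul_le φ fun y hy => (h.second z y).trans ?_
      have : ‖y‖ ≤ ε := hy
      have := h.nonneg_second
      gcongr
    rw [← h3, abs_mul, abs_two] at h4
    have := abs_nonneg ((∫ y, φ.normed volume y * θ (z - y)) - θ z)
    linarith

end TestBounded

/-! ### The linear transport equation over a short time step. -/

/-- `f` is a weak solution in `C([0,∞); L¹)` of the linear transport equation along `(v, E)`. -/
structure IsTransported (E : ℝ → R3 → R3) (f : ℝ → Phase → ℝ) : Prop where
  integrable : ∀ t, 0 ≤ t → Integrable (f t)
  continuous : ∀ t, 0 ≤ t → Tendsto (fun s => ∫ z, |f s z - f t z|) (𝓝[Ici 0] t) (𝓝 0)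
  weak_form : ∀ φ : Phase → ℝ, ContDiff ℝ ∞ φ → HasCompactSupport φ → ∀ t, 0 ≤ t →
    HasDerivWithinAt (fun s => ∫ z, f s z * φ z)
      (∫ z, f t z * fderiv ℝ φ z (z.2, E t z.1)) (Ici 0) t

section Transport

variable {B M L C R : ℝ} {E : ℝ → R3 → R3} {f : ℝ → Phase → ℝ} {Φ : ℝ → Phase → Phase}
  {θ : Phase → ℝ}

theorem tendsto_const_add_nhdsWithin_Ici {s t : ℝ} (hs : 0 ≤ s) :
    Tendsto (fun r : ℝ => s + r) (𝓝[Ici 0] t) (𝓝[Ici 0] (s + t)) := by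
  refine tendsto_nhdsWithin_iff.2 ⟨?_, ?_⟩
  · exact ((continuous_const.add continuous_id).tendsto t).mono_left nhdsWithin_le_nhds
  · filter_upwards [self_mem_nhdsWithin] with r hr
    exact add_nonneg hs hr

theorem IsTransported.shift (hf : IsTransported E f) {s : ℝ} (hs : 0 ≤ s) :
    IsTransported (fun r => E (s + r)) (fun r => f (s + r)) where
  integrable t ht := hf.integrable _ (add_nonneg hs ht)
  continuous t ht := (hf.continuous _ (add_nonneg hs ht)).comp
    (tendsto_const_add_nhdsWithin_Ici hs)
  weak_form φ hφ hφc t ht := by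
    have h := hf.weak_form φ hφ hφc (s + t) (add_nonneg hs ht)
    have h2 : HasDerivWithinAt (fun r : ℝ => s + r) 1 (Ici 0) t := by
      simpa using ((hasDerivAt_id t).const_add s).hasDerivWithinAt
    have := h.scomp t h2 (fun r hr => add_nonneg hs hr)
    simpa [Function.comp_def] using this

theorem integrable_mul_of_bounded {g G : Phase → ℝ} (hg : Integrable g) (hG : Continuous G)
    {K : ℝ} (hK : ∀ z, |G z| ≤ K) : Integrable (fun z => g z * G z) :=
  hg.mul_bdd hG.aestronglyMeasurable (.of_forall hK)

theorem abs_integral_mul_le {g G : Phase → ℝ} (hg : Integrable g) {K : ℝ}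
    (hK : ∀ z, |G z| ≤ K) : |∫ z, g z * G z| ≤ (∫ z, |g z|) * K := by
  rw [← integral_mul_const]
  rw [← Real.norm_eq_abs]
  refine norm_integral_le_of_norm_le (hg.abs.mul_const K) (.of_forall fun z => ?_)
  rw [norm_mul, Real.norm_eq_abs, Real.norm_eq_abs]
  exact mul_le_mul_of_nonneg_left (hK z) (abs_nonneg _)

theorem IsFlow.norm_le_of_norm_apply_le (hE : RegularField B E) (hΦ : IsFlow E Φ) {h T : ℝ}
    (hh : 0 ≤ h) (hT : h ≤ T) {z : Phase} (hz : ‖Φ h z‖ ≤ R) :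
    ‖z‖ ≤ R + B * T + (R + 2 * B * T) * T := by
  have hB := hE.nonneg
  have hR : 0 ≤ R := (norm_nonneg _).trans hz
  have h1 := hΦ.norm_snd_sub_le hE hh z
  have h2 := hΦ.norm_fst_sub_le hE hh z
  have h3 := (norm_fst_le (Φ h z)).trans hz
  have h4 := (norm_snd_le (Φ h z)).trans hz
  have hBh : B * h ≤ B * T := by gcongr
  have h5 : ‖z.2‖ ≤ R + B * T := by
    have := norm_sub_norm_le z.2 (Φ h z).2
    rw [norm_sub_rev] at this
    linarith
  have h6 : (‖z.2‖ + B * h) * h ≤ (R + 2 * B * T) * T := by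
    have : ‖z.2‖ + B * h ≤ R + 2 * B * T := by linarith
    exact mul_le_mul this hT hh ((by positivity : 0 ≤ ‖z.2‖ + B * h).trans this)
  have h7 : ‖z.1‖ ≤ R + (R + 2 * B * T) * T := by
    have := norm_sub_norm_le z.1 (Φ h z).1
    rw [norm_sub_rev] at this
    linarith
  have hT0 : 0 ≤ T := hh.trans hT
  have h8 : 0 ≤ (R + 2 * B * T) * T := by positivity
  have h9 : 0 ≤ B * T := by positivity
  exact max_le (by linarith) (by linarith)

theorem IsFlow.norm_apply_sub_le (hE : RegularField B E) (hΦ : IsFlow E Φ) {h T : ℝ}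
    (hh : 0 ≤ h) (hT : h ≤ T) {z : Phase} (hz : ‖z‖ ≤ R) :
    ‖Φ h z - z‖ ≤ (R + B * T + B) * h := by
  have hB := hE.nonneg
  have h1 := hΦ.norm_snd_sub_le hE hh z
  have h2 := hΦ.norm_fst_sub_le hE hh z
  have h3 := (norm_snd_le z).trans hz
  have hR := (norm_nonneg _).trans hz
  have hBh : B * h ≤ B * T := by gcongr
  have hT0 : 0 ≤ T := hh.trans hT
  refine max_le (h2.trans (mul_le_mul_of_nonneg_right ?_ hh))
    (h1.trans (mul_le_mul_of_nonneg_right ?_ hh))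
  · linarith
  · have : 0 ≤ B * T := by positivity
    linarith

/-- The speed is unbounded in v, but only bounded z matter: if z is large, neither z nor its image
under the flow up to time T can lie in the support of θ. -/
theorem IsTestBounded.abs_comp_flow_sub_le (hE : RegularField B E) (hΦ : IsFlow E Φ)
    (hθ : IsTestBounded M L C R θ) (hR : 0 ≤ R) {h T : ℝ} (hh : 0 ≤ h) (hT : h ≤ T) (z : Phase) :
    |θ (Φ h z) - θ z| ≤ L * ((R + B * T + (R + 2 * B * T) * T + B * T + B) * h) := by
  have hB := hE.nonneg
  have hL := hθ.nonneg_lipschitz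
  have hT0 : 0 ≤ T := hh.trans hT
  by_cases hz : ‖z‖ ≤ R + B * T + (R + 2 * B * T) * T
  · refine (hθ.lipschitz _ _).trans ?_
    gcongr
    exact hΦ.norm_apply_sub_le hE hh hT hz
  · have h1 : θ z = 0 := by
      refine hθ.support z (lt_of_le_of_lt ?_ (not_le.1 hz))
      have : 0 ≤ B * T := by positivity
      have : 0 ≤ (R + 2 * B * T) * T := by positivity
      linarith
    have h2 : θ (Φ h z) = 0 := by
      refine hθ.support _ (not_le.1 fun h3 => hz ?_)
      exact hΦ.norm_le_of_norm_apply_le hE hh hT h3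
    rw [h1, h2, sub_self, abs_zero]
    positivity

/-- The derivative of a smooth function along the flow, to first order in time. -/
theorem IsTestBounded.abs_comp_flow_sub_sub_le (hE : RegularField B E) (hΦ : IsFlow E Φ)
    (hθ : IsTestBounded M L C R θ) (hd : Differentiable ℝ θ) (hR : 0 ≤ R) {h δ : ℝ}
    (hh : 0 ≤ h) (hh1 : h ≤ 1) (hδ : ∀ r ∈ Ico 0 h, ∀ x, ‖E r x - E 0 x‖ ≤ δ) (z : Phase)
    {c : ℝ} (hc : c = R + B + (R + 2 * B) + B + B) (hδ0 : 0 ≤ δ) :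
    |θ (Φ h z) - θ z - h * fderiv ℝ θ z (z.2, E 0 z.1)|
      ≤ h * (L * δ + (C * c ^ 2 + L * ((1 + B) * c)) * h) := by
  have hB := hE.nonneg
  have hL := hθ.nonneg_lipschitz
  have hC := hθ.nonneg_second
  have hc0 : 0 ≤ c := by rw [hc]; positivity
  by_cases hz : ‖z‖ ≤ R + B + (R + 2 * B)
  · have hdisp : ∀ r, 0 ≤ r → r ≤ h → ‖Φ r z - z‖ ≤ c * r := fun r hr hrh => by
      have := hΦ.norm_apply_sub_le hE hr (hrh.trans hh1) hz
      rw [hc]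
      simpa using this
    have h1 := abs_sub_sub_fderiv_le_of_second_difference (hd z) hC hθ.second (Φ h z - z)
    rw [add_sub_cancel] at h1
    have h2 : ‖Φ h z - z - h • (z.2, E 0 z.1)‖ ≤ ((1 + B) * (c * h) + δ) * h := by
      have := norm_image_sub_le_of_norm_deriv_right_le_segment
        (f := fun s => Φ s z - s • ((z.2, E 0 z.1) : Phase))
        (f' := fun s => ((Φ s z).2, E s (Φ s z).1) - (1 : ℝ) • ((z.2, E 0 z.1) : Phase))
        (a := 0) (b := h) (C := (1 + B) * (c * h) + δ)
        ((hΦ.isCharacteristic z h).continuousOn.sub (by fun_prop))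
        (fun s hs => ((hΦ.isCharacteristic z h).hasDerivWithinAt_right hs).sub
          ((hasDerivAt_id s).smul_const _).hasDerivWithinAt) (fun s hs => ?_) h ⟨hh, le_rfl⟩
      · simpa [(hΦ z).1, sub_right_comm] using this
      · have h3 := hdisp s hs.1 hs.2.le
        have h4 : ‖(Φ s z).1 - z.1‖ ≤ c * s := (norm_fst_le (Φ s z - z)).trans h3
        have h5 : ‖(Φ s z).2 - z.2‖ ≤ c * s := (norm_snd_le (Φ s z - z)).trans h3
        have h6 := hE.lipschitz s hs.1 (Φ s z).1 z.1
        have h7 := hδ s hs z.1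
        have h8 := norm_sub_le_norm_sub_add_norm_sub (E s (Φ s z).1) (E s z.1) (E 0 z.1)
        have h9 : c * s ≤ c * h := by gcongr; exact hs.2.le
        have h10 : 0 ≤ c * h := by positivity
        rw [one_smul, Prod.mk_sub_mk, Prod.norm_mk]
        refine max_le ?_ ?_ <;> nlinarith
    have h3 : ‖fderiv ℝ θ z (Φ h z - z - h • (z.2, E 0 z.1))‖
        ≤ L * (((1 + B) * (c * h) + δ) * h) :=
      ((fderiv ℝ θ z).le_opNorm _).trans
        (mul_le_mul (hθ.norm_fderiv_le z) h2 (norm_nonneg _) hL)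
    have h4 : θ (Φ h z) - θ z - h * fderiv ℝ θ z (z.2, E 0 z.1)
        = (θ (Φ h z) - θ z - fderiv ℝ θ z (Φ h z - z))
          + fderiv ℝ θ z (Φ h z - z - h • (z.2, E 0 z.1)) := by
      rw [map_sub _ (Φ h z - z), map_smul, smul_eq_mul]
      ring
    rw [h4]
    refine (abs_add_le _ _).trans ?_
    rw [Real.norm_eq_abs] at h3
    have h5 : C * ‖Φ h z - z‖ ^ 2 ≤ C * (c * h) ^ 2 := by
      gcongr
      exact hdisp h hh le_rfl
    calc _ ≤ C * (c * h) ^ 2 + L * (((1 + B) * (c * h) + δ) * h) := add_le_add (h1.trans h5) h3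
      _ = _ := by ring
  · have hRz : R < ‖z‖ := lt_of_le_of_lt (by linarith) (not_le.1 hz)
    have h2 : θ (Φ h z) = 0 := by
      refine hθ.support _ (not_le.1 fun h3 => hz ?_)
      simpa using hΦ.norm_le_of_norm_apply_le hE hh hh1 h3
    rw [hθ.support z hRz, h2, hθ.fderiv_eq_zero hRz]
    simp only [zero_apply, sub_self, mul_zero, abs_zero]
    positivity

theorem IsTestBounded.abs_fderiv_apply_le (hE : RegularField B E) (hθ : IsTestBounded M L C R θ)
    (hR : 0 ≤ R) {t : ℝ} (ht : 0 ≤ t) (z : Phase) :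
    |fderiv ℝ θ z (z.2, E t z.1)| ≤ L * (R + B) := by
  have hB := hE.nonneg
  have hL := hθ.nonneg_lipschitz
  by_cases hz : ‖z‖ ≤ R
  · refine ((fderiv ℝ θ z).le_opNorm _).trans
      (mul_le_mul (hθ.norm_fderiv_le z) ?_ (norm_nonneg _) hL)
    have := (norm_snd_le z).trans hz
    have := hE.bound t ht z.1
    rw [Prod.norm_mk]
    exact max_le (by linarith) (by linarith)
  · rw [hθ.fderiv_eq_zero (not_le.1 hz)]
    simp only [zero_apply, abs_zero]
    positivity

theorem RegularField.continuous_apply (hE : RegularField B E) {t : ℝ} (ht : 0 ≤ t) :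
    Continuous (E t) :=
  (LipschitzWith.of_dist_le_mul (K := Real.toNNReal B) fun x y => by
    rw [Real.coe_toNNReal _ hE.nonneg, dist_eq_norm, dist_eq_norm]
    exact hE.lipschitz t ht x y).continuous

theorem continuous_fderiv_apply_field (hE : RegularField B E) (hθ : ContDiff ℝ ∞ θ) {t : ℝ}
    (ht : 0 ≤ t) : Continuous fun z : Phase => fderiv ℝ θ z (z.2, E t z.1) := by
  have h1 := hθ.continuous_fderiv (by simp)
  have h2 := hE.continuous_apply ht
  exact h1.clm_apply (by fun_prop)

/-- The weak formulation, to first order in time. -/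
theorem IsTransported.abs_integral_sub_sub_le (hE : RegularField B E) (hf : IsTransported E f)
    (hθ : IsTestBounded M L C R θ) (hsm : ContDiff ℝ ∞ θ) (hR : 0 ≤ R) {h δ : ℝ} (hh : 0 ≤ h)
    (hδ : ∀ r ∈ Ico 0 h, ∀ x, ‖E r x - E 0 x‖ ≤ δ)
    (hδ' : ∀ r ∈ Ico 0 h, ∫ z, |f r z - f 0 z| ≤ δ) :
    |(∫ z, f h z * θ z) - (∫ z, f 0 z * θ z) - h * ∫ z, f 0 z * fderiv ℝ θ z (z.2, E 0 z.1)|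
      ≤ h * ((L * (R + B) + (∫ z, |f 0 z|) * L) * δ) := by
  have hB := hE.nonneg
  have hL := hθ.nonneg_lipschitz
  set I0 := ∫ z, f 0 z * fderiv ℝ θ z (z.2, E 0 z.1) with hI0
  have hw := hf.weak_form θ hsm hθ.hasCompactSupport
  have := norm_image_sub_le_of_norm_deriv_right_le_segment
    (f := fun s => (∫ z, f s z * θ z) - s * I0)
    (f' := fun s => (∫ z, f s z * fderiv ℝ θ z (z.2, E s z.1)) - 1 * I0)
    (a := 0) (b := h) (C := (L * (R + B) + (∫ z, |f 0 z|) * L) * δ)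
    (ContinuousOn.sub (fun s hs => (hw s hs.1).continuousWithinAt.mono Icc_subset_Ici_self)
      (by fun_prop))
    (fun s hs => ((hw s hs.1).mono (Ici_subset_Ici.2 hs.1)).sub
      ((hasDerivAt_id s).mul_const _).hasDerivWithinAt) (fun s hs => ?_) h ⟨hh, le_rfl⟩
  · simp only [zero_mul, sub_zero, Real.norm_eq_abs] at this
    rw [sub_right_comm] at this
    linarith
  · rw [one_mul, Real.norm_eq_abs]
    have hI1 := integrable_mul_of_bounded (hf.integrable s hs.1)
      (continuous_fderiv_apply_field hE hsm hs.1) (hθ.abs_fderiv_apply_le hE hR hs.1)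
    have hI2 := integrable_mul_of_bounded (hf.integrable 0 le_rfl)
      (continuous_fderiv_apply_field hE hsm hs.1) (hθ.abs_fderiv_apply_le hE hR hs.1)
    have hI3 := integrable_mul_of_bounded (hf.integrable 0 le_rfl)
      (continuous_fderiv_apply_field hE hsm le_rfl) (hθ.abs_fderiv_apply_le hE hR le_rfl)
    have h1 : (∫ z, f s z * fderiv ℝ θ z (z.2, E s z.1)) - I0
        = (∫ z, (f s z - f 0 z) * fderiv ℝ θ z (z.2, E s z.1))
          + ∫ z, f 0 z * (fderiv ℝ θ z (z.2, E s z.1) - fderiv ℝ θ z (z.2, E 0 z.1)) := by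
      simp_rw [sub_mul, mul_sub]
      rw [integral_sub hI1 hI2, integral_sub hI2 hI3]
      ring
    rw [h1]
    have h2 := abs_integral_mul_le ((hf.integrable s hs.1).sub (hf.integrable 0 le_rfl))
      (hθ.abs_fderiv_apply_le hE hR hs.1)
    have h3 := abs_integral_mul_le (hf.integrable 0 le_rfl) (K := L * δ)
      (G := fun z => fderiv ℝ θ z (z.2, E s z.1) - fderiv ℝ θ z (z.2, E 0 z.1)) fun z => by
        rw [← map_sub, ← Real.norm_eq_abs]
        refine ((fderiv ℝ θ z).le_opNorm _).trans
          (mul_le_mul (hθ.norm_fderiv_le z) ?_ (norm_nonneg _) hL)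
        rw [Prod.mk_sub_mk, sub_self, Prod.norm_mk, norm_zero]
        exact max_le ((norm_nonneg _).trans (hδ s hs z.1)) (hδ s hs z.1)
    refine (abs_add_le _ _).trans ?_
    have h4 : (∫ z, |f s z - f 0 z|) * (L * (R + B)) ≤ δ * (L * (R + B)) := by
      gcongr
      exact hδ' s hs
    simp only [Pi.sub_apply] at h2
    linarith

/-- Over a step h, testing f with θ and composing θ with the flow agree up to o(h). The smallness of
h is uniform over the whole class of θ; this is essential because the test function used later
changes with the step. -/
theorem IsTransported.eventually_abs_sub_le (hE : RegularField B E) (hf : IsTransported E f)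
    (hΦ : IsFlow E Φ) (hL : 0 ≤ L) (hC : 0 ≤ C) (hR : 0 ≤ R) {δ : ℝ} (hδ : 0 < δ) :
    ∀ᶠ h in 𝓝[>] (0 : ℝ), ∀ θ, IsTestBounded M L C R θ →
      |(∫ z, f h z * θ z) - ∫ z, f 0 z * θ (Φ h z)| ≤ δ * h := by
  have hB := hE.nonneg
  set m := ∫ z, |f 0 z| with hm
  have hm0 : 0 ≤ m := integral_nonneg fun z => abs_nonneg _
  set c := (R + 1) + B + ((R + 1) + 2 * B) + B + B with hc
  have hc0 : 0 ≤ c := by positivity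
  -- K₁ collects the terms proportional to the oscillation δ₁ of E and f near time 0, and K₂ those
  -- quadratic in h.
  set K₁ := L * (R + 1 + B) + m * L + m * L with hK₁
  set K₂ := (m + 1) * C + m * (C * c ^ 2 + L * ((1 + B) * c)) + m * C with hK₂
  have hK₁0 : 0 ≤ K₁ := by positivity
  have hK₂0 : 0 ≤ K₂ := by positivity
  set δ₁ := min 1 (δ / (2 * (K₁ + 1))) with hδ₁
  have hδ₁0 : 0 < δ₁ := by positivity
  have hδ₁1 : δ₁ ≤ 1 := min_le_left _ _
  have hδ₁K : K₁ * δ₁ ≤ δ / 2 := by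
    calc K₁ * δ₁ ≤ (K₁ + 1) * (δ / (2 * (K₁ + 1))) := by
          refine mul_le_mul (by linarith) (min_le_right _ _) hδ₁0.le (by positivity)
      _ = δ / 2 := by field_simp
  have h1 := hE.continuous 0 le_rfl δ₁ hδ₁0
  have h2 : ∀ᶠ s in 𝓝[Ici 0] (0 : ℝ), ∫ z, |f s z - f 0 z| ≤ δ₁ :=
    (hf.continuous 0 le_rfl).eventually (ge_mem_nhds hδ₁0)
  obtain ⟨u, hu0, hu⟩ := mem_nhdsGE_iff_exists_Ico_subset.1 (h1.and h2)
  have hr : 0 < min u (min 1 (δ / (2 * (K₂ + 1)))) :=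
    lt_min hu0 (lt_min one_pos (by positivity))
  filter_upwards [Ioo_mem_nhdsGT hr] with h hh θ hθ
  have hh0 : 0 < h := hh.1
  have hhu : h < u := hh.2.trans_le (min_le_left _ _)
  have hh1 : h ≤ 1 := hh.2.le.trans ((min_le_right _ _).trans (min_le_left _ _))
  have hhK : K₂ * h ≤ δ / 2 := by
    calc K₂ * h ≤ (K₂ + 1) * (δ / (2 * (K₂ + 1))) := by
          refine mul_le_mul (by linarith) (hh.2.le.trans ((min_le_right _ _).trans
            (min_le_right _ _))) hh0.le (by positivity)
      _ = δ / 2 := by field_simp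
  -- The mollification scale equals the time step, so replacing θ by χ costs C h² = o(h), while the
  -- first-order expansions for χ use constants independent of h.
  obtain ⟨χ, hχ, hχs, hχθ⟩ := hθ.exists_smooth hh0 hh1
  have hR1 : 0 ≤ R + 1 := by linarith
  have hfh := hf.integrable h hh0.le
  have hf0 := hf.integrable 0 le_rfl
  have hΦc := hΦ.continuous hE hh0.le
  have e1 := hf.abs_integral_sub_sub_le hE hχ hχs hR1 hh0.le (δ := δ₁)
    (fun r hr => (hu ⟨hr.1, hr.2.trans hhu⟩).1) (fun r hr => (hu ⟨hr.1, hr.2.trans hhu⟩).2)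
  have e2 := abs_integral_mul_le hf0 (fun z => hχ.abs_comp_flow_sub_sub_le hE hΦ
    (hχs.differentiable (by simp)) hR1 hh0.le hh1
    (fun r hr => (hu ⟨hr.1, hr.2.trans hhu⟩).1) z hc hδ₁0.le)
  have e3 := abs_integral_mul_le hfh hχθ
  have e4 := abs_integral_mul_le hf0 fun z => hχθ (Φ h z)
  have e5 : ∫ z, |f h z| ≤ m + 1 := by
    have h3 : ∫ z, |f h z - f 0 z| ≤ δ₁ := (hu ⟨hh0.le, hhu⟩).2
    have h4 : ∫ z, |f h z| ≤ ∫ z, (|f h z - f 0 z| + |f 0 z|) := by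
      refine integral_mono hfh.abs ((hfh.sub hf0).abs.add hf0.abs) fun z => ?_
      have := abs_add_le (f h z - f 0 z) (f 0 z)
      rwa [sub_add_cancel] at this
    have i0 : Integrable fun z => |f h z - f 0 z| := (hfh.sub hf0).abs
    rw [integral_add i0 hf0.abs] at h4
    linarith
  have i1 := integrable_mul_of_bounded hfh hχ.continuous hχ.bound
  have i2 := integrable_mul_of_bounded hfh hθ.continuous hθ.bound
  have i3 := integrable_mul_of_bounded hf0 hχ.continuous hχ.bound
  have i4 := integrable_mul_of_bounded hf0 (hχ.continuous.comp hΦc) fun z => hχ.bound _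
  have i5 := integrable_mul_of_bounded hf0 (hθ.continuous.comp hΦc) fun z => hθ.bound _
  have i6 := integrable_mul_of_bounded hf0
    (continuous_fderiv_apply_field hE hχs le_rfl) (hχ.abs_fderiv_apply_le hE hR1 le_rfl)
  simp only [Function.comp] at i4 i5
  have j2 : ∫ z, f 0 z * (χ (Φ h z) - χ z - h * fderiv ℝ χ z (z.2, E 0 z.1))
      = (∫ z, f 0 z * χ (Φ h z)) - (∫ z, f 0 z * χ z)
        - h * ∫ z, f 0 z * fderiv ℝ χ z (z.2, E 0 z.1) := by
    have i7 : Integrable fun z => f 0 z * χ (Φ h z) - f 0 z * χ z := i4.sub i3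
    rw [← integral_const_mul, ← integral_sub i4 i3, ← integral_sub i7 (i6.const_mul h)]
    congr 1
    ext z
    ring
  have j3 : ∫ z, f h z * (χ z - θ z) = (∫ z, f h z * χ z) - ∫ z, f h z * θ z := by
    rw [← integral_sub i1 i2]
    simp_rw [mul_sub]
  have j4 : ∫ z, f 0 z * (χ (Φ h z) - θ (Φ h z))
      = (∫ z, f 0 z * χ (Φ h z)) - ∫ z, f 0 z * θ (Φ h z) := by
    rw [← integral_sub i4 i5]
    simp_rw [mul_sub]
  rw [j2] at e2
  rw [j3] at e3
  rw [j4] at e4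
  rw [← hm] at e1 e2 e4
  have k3 : (∫ z, |f h z|) * (C * h ^ 2) ≤ (m + 1) * (C * h ^ 2) := by gcongr
  have key : |(∫ z, f h z * θ z) - ∫ z, f 0 z * θ (Φ h z)|
      ≤ (m + 1) * (C * h ^ 2) + h * ((L * (R + 1 + B) + m * L) * δ₁)
        + m * (h * (L * δ₁ + (C * c ^ 2 + L * ((1 + B) * c)) * h)) + m * (C * h ^ 2) := by
    rw [abs_le] at *
    constructor <;> linarith [e1.1, e1.2, e2.1, e2.2, e3.1, e3.2, e4.1, e4.2]
  refine key.trans ?_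
  have : (m + 1) * (C * h ^ 2) + h * ((L * (R + 1 + B) + m * L) * δ₁)
        + m * (h * (L * δ₁ + (C * c ^ 2 + L * ((1 + B) * c)) * h)) + m * (C * h ^ 2)
      = (K₁ * δ₁ + K₂ * h) * h := by
    rw [hK₁, hK₂]
    ring
  rw [this]
  gcongr
  linarith

end Transport

/-! ### The weak solution as push-forward of its initial datum. -/

section FlowMeasure

variable {B : ℝ} {E : ℝ → R3 → R3} {f : ℝ → Phase → ℝ} {Φ : ℝ → Phase → Phase}

theorem exists_bounds_of_contDiff_of_hasCompactSupport {ψ : Phase → ℝ} (hψ : ContDiff ℝ ∞ ψ)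
    (hc : HasCompactSupport ψ) : ∃ M L C R : ℝ, 0 ≤ L ∧ 0 ≤ C ∧ 0 ≤ R ∧ (∀ z, |ψ z| ≤ M) ∧
      (∀ z z', |ψ z - ψ z'| ≤ L * ‖z - z'‖) ∧
      (∀ a b c, |ψ a + ψ b - 2 * ψ c|
        ≤ L * ‖a + b - (2 : ℝ) • c‖ + C * (‖a - c‖ ^ 2 + ‖b - c‖ ^ 2)) ∧
      ∀ z, R < ‖z‖ → ψ z = 0 := by
  obtain ⟨M, hM⟩ := hc.exists_bound_of_continuous hψ.continuous
  obtain ⟨L, hL⟩ := hψ.lipschitzWith_of_hasCompactSupport hc (by simp)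
  obtain ⟨C, hC⟩ := (hψ.fderiv_right (m := 1) (by norm_cast)).lipschitzWith_of_hasCompactSupport
    (hc.fderiv (𝕜 := ℝ)) (by simp)
  obtain ⟨R, hR⟩ := hc.isCompact.isBounded.subset_closedBall (0 : Phase)
  refine ⟨M, L, C, max R 0, L.2, C.2, le_max_right _ _, hM, fun z z' => ?_, fun a b c => ?_,
    fun z hz => ?_⟩
  · have := hL.dist_le_mul z z'
    rwa [Real.dist_eq, dist_eq_norm] at this
  · have := norm_add_sub_two_smul_le (hψ.differentiable (by simp)) C.2 (fun x y => by
      have := hC.dist_le_mul x y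
      rwa [dist_eq_norm, dist_eq_norm] at this)
      (fun x => norm_fderiv_le_of_lipschitz ℝ hL) a b c
    simpa using this
  · refine image_eq_zero_of_notMem_tsupport fun h => ?_
    have := hR h
    simp only [Metric.mem_closedBall, dist_zero_right] at this
    exact absurd (this.trans (le_max_left _ _)) (not_le.2 hz)

theorem IsFlow.isTestBounded_comp (hE : RegularField B E) (hΦ : IsFlow E Φ) {M L C R : ℝ}
    {ψ : Phase → ℝ} (hL : 0 ≤ L) (hC : 0 ≤ C) (hM : ∀ z, |ψ z| ≤ M)
    (hψL : ∀ z z', |ψ z - ψ z'| ≤ L * ‖z - z'‖)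
    (hψ2 : ∀ a b c, |ψ a + ψ b - 2 * ψ c|
        ≤ L * ‖a + b - (2 : ℝ) • c‖ + C * (‖a - c‖ ^ 2 + ‖b - c‖ ^ 2))
    (hψR : ∀ z, R < ‖z‖ → ψ z = 0) {t T : ℝ} (ht : 0 ≤ t) (hT : t ≤ T) :
    IsTestBounded M (L * Real.exp ((1 + B) * T))
      (L * (2 * B * Real.exp (3 * (1 + B) * T)) + 2 * C * Real.exp ((1 + B) * T) ^ 2)
      (R + B * T + (R + 2 * B * T) * T) (fun z => ψ (Φ t z)) where
  bound z := hM _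
  lipschitz z z' := by
    have hB := hE.nonneg
    refine (hψL _ _).trans ?_
    rw [mul_assoc]
    gcongr
    refine (hΦ.norm_sub_le hE ht z z').trans ?_
    gcongr
  second z k := by
    have hB := hE.nonneg
    refine (hψ2 _ _ _).trans ?_
    have h1 := hΦ.norm_second_difference_le hE ht z k
    have h2 := hΦ.norm_sub_le hE ht (z + k) z
    have h3 := hΦ.norm_sub_le hE ht (z - k) z
    rw [add_sub_cancel_left] at h2
    rw [sub_sub_cancel_left, norm_neg] at h3
    have h4 : Real.exp ((1 + B) * t) ≤ Real.exp ((1 + B) * T) := by gcongr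
    have h5 : Real.exp (3 * (1 + B) * t) ≤ Real.exp (3 * (1 + B) * T) := by gcongr
    calc _ ≤ L * (2 * B * Real.exp (3 * (1 + B) * T) * ‖k‖ ^ 2)
          + C * ((Real.exp ((1 + B) * T) * ‖k‖) ^ 2 + (Real.exp ((1 + B) * T) * ‖k‖) ^ 2) := by
          gcongr
          · exact h1.trans (by gcongr)
          · exact h2.trans (by gcongr)
          · exact h3.trans (by gcongr)
      _ = _ := by ring
  support z hz := hψR _ (not_le.1 fun h => (not_lt.2 (hΦ.norm_le_of_norm_apply_le hE ht hT h)) hz)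

/-- Duality: with θ_s the composition of ψ with the flow from time s to T, the pairing of f(s) with
θ_s is constant on [0,T], and its two endpoint values are the two sides. By the semigroup law θ_s is
θ_r composed with the flow from s to r, so the right increments are o(r - s). -/
theorem IsTransported.integral_eq_of_contDiff (hE : RegularField B E) (hf : IsTransported E f)
    (hΦ : IsFlow E Φ) {T : ℝ} (hT : 0 ≤ T) {ψ : Phase → ℝ} (hψ : ContDiff ℝ ∞ ψ)
    (hψc : HasCompactSupport ψ) : ∫ z, f T z * ψ z = ∫ z, f 0 z * ψ (Φ T z) := by
  have hB := hE.nonneg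
  obtain ⟨M, L, C, R, hL, hC, hR, hM, hψL, hψ2, hψR⟩ :=
    exists_bounds_of_contDiff_of_hasCompactSupport hψ hψc
  -- A forward flow restarted at each s ≥ 0; the value for negative s is a dummy.
  have hex : ∀ s : ℝ, ∃ Ψ, 0 ≤ s → IsFlow (fun r => E (s + r)) Ψ := fun s => by
    by_cases hs : 0 ≤ s
    · obtain ⟨Ψ, h⟩ := (hE.shift hs).exists_isFlow
      exact ⟨Ψ, fun _ => h⟩
    · exact ⟨Φ, fun h => absurd h hs⟩
  choose Ψ hΨ using hex
  set θ : ℝ → Phase → ℝ := fun s z => ψ (Ψ s (T - s) z) with hθ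
  obtain ⟨L', C', R', hL', hC', hR', htest⟩ : ∃ L' C' R', 0 ≤ L' ∧ 0 ≤ C' ∧ 0 ≤ R' ∧
      ∀ s ∈ Icc 0 T, IsTestBounded M L' C' R' (θ s) := by
    refine ⟨L * Real.exp ((1 + B) * T),
      L * (2 * B * Real.exp (3 * (1 + B) * T)) + 2 * C * Real.exp ((1 + B) * T) ^ 2,
      R + B * T + (R + 2 * B * T) * T, by positivity, by positivity, by positivity,
      fun s hs => ?_⟩
    exact (hΨ s hs.1).isTestBounded_comp (hE.shift hs.1) hL hC hM hψL hψ2 hψR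
      (sub_nonneg.2 hs.2) (by linarith [hs.1])
  have hsemi : ∀ s ∈ Icc 0 T, ∀ h, 0 ≤ h → s + h ≤ T → ∀ z,
      θ s z = θ (s + h) (Ψ s h z) := by
    intro s hs h hh hsh z
    have h1 : IsFlow (fun r => E (s + (h + r))) (Ψ (s + h)) := by
      have := hΨ (s + h) (add_nonneg hs.1 hh)
      simpa only [add_assoc] using this
    have h2 := (hΨ s hs.1).add_apply (hE.shift hs.1) hh h1
      (t := T - (s + h)) (by linarith) z
    simp only [hθ]
    rw [← h2]
    congr 2
    ring
  set c := R' + B * T + (R' + 2 * B * T) * T + B * T + B with hc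
  have hdiff : ∀ s ∈ Icc 0 T, ∀ s' ∈ Icc 0 T, ∀ z, |θ s z - θ s' z| ≤ L' * (c * |s - s'|) := by
    have key : ∀ s ∈ Icc 0 T, ∀ s' ∈ Icc 0 T, s ≤ s' → ∀ z,
        |θ s z - θ s' z| ≤ L' * (c * |s - s'|) := by
      intro s hs s' hs' hss z
      have h1 := hsemi s hs (s' - s) (by linarith) (by linarith [hs'.2]) z
      have h2 := (htest s' hs').abs_comp_flow_sub_le (hE.shift hs.1) (hΨ s hs.1) hR'
        (h := s' - s) (T := T) (by linarith) (by linarith [hs.1, hs'.2]) z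
      rw [add_sub_cancel] at h1
      rwa [h1, abs_sub_comm s, abs_of_nonneg (sub_nonneg.2 hss)]
    intro s hs s' hs' z
    rcases le_total s s' with h | h
    · exact key s hs s' hs' h z
    · rw [abs_sub_comm, abs_sub_comm s]
      exact key s' hs' s hs h z
  set g : ℝ → ℝ := fun s => ∫ z, f s z * θ s z with hg
  have hint : ∀ s ∈ Icc 0 T, ∀ s' ∈ Icc 0 T, Integrable fun z => f s z * θ s' z :=
    fun s hs s' hs' => integrable_mul_of_bounded (hf.integrable s hs.1)
      (htest s' hs').continuous (htest s' hs').bound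
  have hgc : ContinuousOn g (Icc 0 T) := by
    intro s₀ hs₀
    rw [ContinuousWithinAt, tendsto_iff_norm_sub_tendsto_zero]
    have h1 := ((hf.continuous s₀ hs₀.1).mono_left
      (nhdsWithin_mono s₀ (Icc_subset_Ici_self : Icc 0 T ⊆ Ici 0))).mul_const M
    have h2 : Tendsto (fun s => (∫ z, |f s₀ z|) * (L' * (c * |s - s₀|))) (𝓝[Icc 0 T] s₀)
        (𝓝 ((∫ z, |f s₀ z|) * (L' * (c * |s₀ - s₀|)))) :=
      ((by fun_prop : Continuous fun s => (∫ z, |f s₀ z|) * (L' * (c * |s - s₀|))).tendsto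
        s₀).mono_left nhdsWithin_le_nhds
    have h3 := h1.add h2
    simp only [zero_mul, sub_self, abs_zero, mul_zero, add_zero] at h3
    refine squeeze_zero' (.of_forall fun _ => norm_nonneg _) ?_ h3
    filter_upwards [self_mem_nhdsWithin] with s hs
    have h4 : g s - g s₀ = (∫ z, (f s z - f s₀ z) * θ s z)
        + ∫ z, f s₀ z * (θ s z - θ s₀ z) := by
      simp_rw [sub_mul, mul_sub]
      rw [integral_sub (hint s hs s hs) (hint s₀ hs₀ s hs),
        integral_sub (hint s₀ hs₀ s hs) (hint s₀ hs₀ s₀ hs₀)]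
      ring
    rw [h4]
    refine (norm_add_le _ _).trans (add_le_add ?_ ?_)
    · exact abs_integral_mul_le ((hf.integrable s hs.1).sub (hf.integrable s₀ hs₀.1))
        (htest s hs).bound
    · exact abs_integral_mul_le (hf.integrable s₀ hs₀.1) (hdiff s hs s₀ hs₀)
  have hzero := norm_sub_le_of_eventually_increment_le (B := fun _ => 0) (B' := fun _ => 0) hT hgc
    continuousOn_const (fun x _ => hasDerivWithinAt_const _ _ _) (fun s hs ε hε => ?_)
  · have h1 : g T = g 0 := by
      rw [sub_self] at hzero
      exact sub_eq_zero.1 (norm_le_zero_iff.1 hzero)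
    have h2 : g T = ∫ z, f T z * ψ z := by
      simp only [hg, hθ, sub_self, (hΨ T hT _).1]
    have h3 : g 0 = ∫ z, f 0 z * ψ (Φ T z) := by
      simp only [hg, hθ, sub_zero]
      congr 1
      ext z
      have := hΦ.add_apply hE le_rfl (hΨ 0 le_rfl) hT z
      rw [zero_add, (hΦ z).1] at this
      rw [this]
    rw [← h2, h1, h3]
  · have hsI : s ∈ Icc 0 T := ⟨hs.1, hs.2.le⟩
    have h1 := (hf.shift hs.1).eventually_abs_sub_le (hE.shift hs.1) (hΨ s hs.1) (M := M)
      hL' hC' hR' hε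
    have h2 : Tendsto (fun r : ℝ => r - s) (𝓝[>] s) (𝓝[>] 0) := by
      refine tendsto_nhdsWithin_iff.2 ⟨?_, ?_⟩
      · have : Tendsto (fun r : ℝ => r - s) (𝓝 s) (𝓝 (s - s)) :=
          (continuous_id.sub continuous_const).tendsto s
        rw [sub_self] at this
        exact this.mono_left nhdsWithin_le_nhds
      · filter_upwards [self_mem_nhdsWithin] with r hr
        exact mem_Ioi.2 (sub_pos.2 (mem_Ioi.1 hr))
    filter_upwards [h2.eventually h1, Ioc_mem_nhdsGT hs.2] with r hr hrs
    have hrI : r ∈ Icc 0 T := ⟨hs.1.trans hrs.1.le, hrs.2⟩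
    -- The test function depends on r itself, which is where uniformity in θ is used.
    have h3 := hr (θ r) (htest r hrI)
    simp only [add_zero, add_sub_cancel] at h3
    have h4 : ∀ z, θ s z = θ r (Ψ s (r - s) z) := fun z => by
      have := hsemi s hsI (r - s) (by linarith [hrs.1]) (by linarith [hrs.2]) z
      rwa [add_sub_cancel] at this
    rw [zero_add, Real.norm_eq_abs]
    simp only [hg]
    simp_rw [h4 _]
    exact h3

theorem IsTransported.integral_eq_of_continuous (hE : RegularField B E) (hf : IsTransported E f)
    (hΦ : IsFlow E Φ) {T : ℝ} (hT : 0 ≤ T) {ψ : Phase → ℝ} (hψ : Continuous ψ)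
    (hψc : HasCompactSupport ψ) : ∫ z, f T z * ψ z = ∫ z, f 0 z * ψ (Φ T z) := by
  obtain ⟨M, hM⟩ := hψc.exists_bound_of_continuous hψ
  let φ : ℕ → ContDiffBump (0 : Phase) := fun n =>
    ⟨1 / ((n : ℝ) + 1) / 2, 1 / ((n : ℝ) + 1), by positivity, half_lt_self (by positivity)⟩
  have hφ : Tendsto (fun n => (φ n).rOut) atTop (𝓝 0) := tendsto_one_div_add_atTop_nhds_zero_nat
  set χ : ℕ → Phase → ℝ := fun n => convolution ((φ n).normed volume) ψ
    (ContinuousLinearMap.lsmul ℝ ℝ) volume with hχ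
  have hlim : ∀ z, Tendsto (fun n => χ n z) atTop (𝓝 (ψ z)) := fun z =>
    ContDiffBump.convolution_tendsto_right_of_continuous hφ hψ z
  have hsm : ∀ n, ContDiff ℝ ∞ (χ n) := fun n =>
    (φ n).hasCompactSupport_normed.contDiff_convolution_left (ContinuousLinearMap.lsmul ℝ ℝ)
      ((φ n).contDiff_normed (n := ⊤)) hψ.locallyIntegrable
  have hcs : ∀ n, HasCompactSupport (χ n) := fun n =>
    HasCompactSupport.convolution _ (φ n).hasCompactSupport_normed hψc
  have hb : ∀ n z, ‖χ n z‖ ≤ M := fun n z =>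
    abs_integral_bump_mul_le (φ n) fun y _ => hM (z - y)
  have h1 : Tendsto (fun n => ∫ z, f T z * χ n z) atTop (𝓝 (∫ z, f T z * ψ z)) := by
    refine tendsto_integral_of_dominated_convergence (fun z => |f T z| * M) (fun n => ?_)
      ((hf.integrable T hT).abs.mul_const M) (fun n => .of_forall fun z => ?_)
      (.of_forall fun z => (hlim z).const_mul _)
    · exact (hf.integrable T hT).aestronglyMeasurable.mul
        (hsm n).continuous.aestronglyMeasurable
    · rw [norm_mul, Real.norm_eq_abs]
      exact mul_le_mul_of_nonneg_left (hb n z) (abs_nonneg _)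
  have h2 : Tendsto (fun n => ∫ z, f 0 z * χ n (Φ T z)) atTop (𝓝 (∫ z, f 0 z * ψ (Φ T z))) := by
    refine tendsto_integral_of_dominated_convergence (fun z => |f 0 z| * M) (fun n => ?_)
      ((hf.integrable 0 le_rfl).abs.mul_const M) (fun n => .of_forall fun z => ?_)
      (.of_forall fun z => (hlim _).const_mul _)
    · exact (hf.integrable 0 le_rfl).aestronglyMeasurable.mul
        ((hsm n).continuous.comp (hΦ.continuous hE hT)).aestronglyMeasurable
    · rw [norm_mul, Real.norm_eq_abs]
      exact mul_le_mul_of_nonneg_left (hb n _) (abs_nonneg _)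
  refine tendsto_nhds_unique h1 (h2.congr fun n => ?_)
  exact (hf.integral_eq_of_contDiff hE hΦ hT (hsm n) (hcs n)).symm

/-- The solution at time `T` is the push-forward of the initial datum by the flow. -/
theorem IsTransported.map_withDensity (hE : RegularField B E) (hf : IsTransported E f)
    (hΦ : IsFlow E Φ) {T : ℝ} (hT : 0 ≤ T) (h0 : ∀ᵐ z, 0 ≤ f 0 z) (hT0 : ∀ᵐ z, 0 ≤ f T z) :
    (volume.withDensity fun z => ENNReal.ofReal (f 0 z)).map (Φ T)
      = volume.withDensity fun z => ENNReal.ofReal (f T z) := by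
  have hm := hΦ.continuous hE hT
  have : IsFiniteMeasure (volume.withDensity fun z => ENNReal.ofReal (f 0 z)) :=
    isFiniteMeasure_withDensity_ofReal (hf.integrable 0 le_rfl).2
  have : IsFiniteMeasure (volume.withDensity fun z => ENNReal.ofReal (f T z)) :=
    isFiniteMeasure_withDensity_ofReal (hf.integrable T hT).2
  have key : ∀ s, 0 ≤ s → (∀ᵐ z, 0 ≤ f s z) → ∀ φ : Phase → ℝ,
      ∫ z, φ z ∂(volume.withDensity fun z => ENNReal.ofReal (f s z)) = ∫ z, f s z * φ z := by
    intro s hs hs0 φ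
    rw [integral_withDensity_eq_integral_toReal_smul₀
      (hf.integrable s hs).aestronglyMeasurable.aemeasurable.ennreal_ofReal (by simp)]
    refine integral_congr_ae ?_
    filter_upwards [hs0] with z hz
    rw [ENNReal.toReal_ofReal hz, smul_eq_mul]
  -- Both measures are finite, hence determined by their integrals of compactly supported continuous
  -- functions.
  refine Measure.ext_of_integral_eq_on_compactlySupported fun φ => ?_
  have hφ : Continuous (fun z => φ z) := φ.continuous
  rw [integral_map hm.aemeasurable hφ.aestronglyMeasurable, key 0 le_rfl h0,
    key T hT hT0]
  exact (hf.integral_eq_of_continuous hE hΦ hT φ.continuous φ.hasCompactSupport).symm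

end FlowMeasure

/-! ### The self-consistent force: regularity and Lagrangian representation. -/

theorem lintegral_singular_lt_top {β : ℝ} (hβ : β < 3) :
    ∫⁻ y in Metric.ball (0 : R3) 1, ENNReal.ofReal (‖y‖ ^ (-β)) < ⊤ := by
  have := (integrableOn_norm_rpow_ball hβ).lintegral_lt_top
  exact this

theorem ofReal_norm_rpow_le {β : ℝ} (hβ : 0 ≤ β) (y : R3) :
    ENNReal.ofReal (‖y‖ ^ (-β))
      ≤ 1 + (Metric.ball (0 : R3) 1).indicator (fun y => ENNReal.ofReal (‖y‖ ^ (-β))) y := by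
  by_cases hy : y ∈ Metric.ball (0 : R3) 1
  · rw [indicator_of_mem hy]
    exact le_add_self
  · rw [indicator_of_notMem hy, add_zero, ENNReal.ofReal_le_one]
    exact Real.rpow_le_one_of_one_le_of_nonpos (by simpa using hy) (by linarith)

theorem measurable_ofReal_norm_rpow (β : ℝ) :
    Measurable fun y : R3 => ENNReal.ofReal (‖y‖ ^ (-β)) := by
  fun_prop

theorem lintegral_ball_kernel_le {α : ℝ} (hα : 0 < α) (hα1 : α < 1) (x a : R3) (r : ℝ) :
    ∫⁻ y in Metric.ball x r, ‖rieszKernel α (y - a)‖ₑ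
      ≤ 2 * volume (Metric.ball (0 : R3) r)
        + ∫⁻ y in Metric.ball (0 : R3) 1, ENNReal.ofReal (‖y‖ ^ (-(2 + α))) := by
  set J : R3 → ℝ≥0∞ := (Metric.ball (0 : R3) 1).indicator
    (fun y => ENNReal.ofReal (‖y‖ ^ (-(2 + α)))) with hJ
  have hJm : Measurable J := (measurable_ofReal_norm_rpow _).indicator measurableSet_ball
  have h1 : ∀ y : R3, ‖rieszKernel α y‖ₑ ≤ 2 + J y := by
    intro y
    rw [← ofReal_norm]
    refine (ENNReal.ofReal_le_ofReal (norm_rieszKernel_le (by linarith) y)).trans ?_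
    rw [ENNReal.ofReal_add zero_le_one (by positivity), ENNReal.ofReal_one]
    refine (add_le_add_right (ofReal_norm_rpow_le (by linarith) y) 1).trans ?_
    rw [← add_assoc, one_add_one_eq_two]
  calc ∫⁻ y in Metric.ball x r, ‖rieszKernel α (y - a)‖ₑ
      ≤ ∫⁻ y in Metric.ball x r, (2 + J (y - a)) := lintegral_mono fun y => h1 _
    _ = 2 * volume (Metric.ball (0 : R3) r) + ∫⁻ y in Metric.ball x r, J (y - a) := by
      rw [lintegral_add_left measurable_const, setLIntegral_const,
        Measure.addHaar_ball_center]
    _ ≤ 2 * volume (Metric.ball (0 : R3) r) + ∫⁻ y, J (y - a) := by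
      gcongr
      exact Measure.restrict_le_self
    _ = _ := by
      rw [lintegral_sub_right_eq_self J a, hJ, lintegral_indicator measurableSet_ball]

section Solution

variable {α lam : ℝ} {f₀ : Phase → ℝ} {f : ℝ → Phase → ℝ}

theorem IsSolution.integrable (hf : IsSolution α lam f₀ f) {t : ℝ} (ht : 0 ≤ t) :
    Integrable (f t) := memLp_one_iff_integrable.1 (hf.memL1 t ht)

/-- Since f is nonnegative, integrating |f| in velocity returns the density; absolute convergence of
the spatial integral therefore yields integrability on phase space, and Fubini applies. -/
theorem IsSolution.integrable_kernel (hα : 0 < α) (hlam : lam ≠ 0) (hf : IsSolution α lam f₀ f)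
    {t : ℝ} (ht : 0 ≤ t) (x : R3) :
    Integrable (fun z : Phase => f t z • rieszKernel α (x - z.1)) ∧
      forceField α lam (f t) x = (α * lam) • ∫ z, f t z • rieszKernel α (x - z.1) := by
  have hfi : Integrable (f t) ((volume : Measure R3).prod volume) := hf.integrable ht
  have h0 : ∀ᵐ z ∂((volume : Measure R3).prod (volume : Measure R3)), 0 ≤ f t z := hf.nonneg t ht
  have hk := measurable_rieszKernel α
  have hg := hf.force_integrable t ht x
  simp_rw [gradient_potential hα hlam, smul_comm _ (-(α * lam))] at hg
  have hne : -(α * lam) ≠ 0 := neg_ne_zero.2 (mul_ne_zero hα.ne' hlam)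
  have hg' : Integrable fun y => density (f t) y • rieszKernel α (x - y) :=
    (integrable_fun_smul_iff hne _).1 hg
  have hmeas : AEStronglyMeasurable (fun z : Phase => f t z • rieszKernel α (x - z.1))
      ((volume : Measure R3).prod volume) :=
    hfi.aestronglyMeasurable.smul
      (hk.comp (measurable_const.sub measurable_fst)).aestronglyMeasurable
  have hint : Integrable (fun z : Phase => f t z • rieszKernel α (x - z.1))
      ((volume : Measure R3).prod volume) := by
    refine (integrable_prod_iff hmeas).2 ⟨?_, ?_⟩
    · filter_upwards [hfi.prod_right_ae] with y hy
      exact hy.smul_const _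
    · refine hg'.norm.congr ?_
      filter_upwards [Measure.ae_ae_of_ae_prod h0] with y hy
      simp_rw [norm_smul]
      rw [integral_mul_const, density, Real.norm_of_nonneg (integral_nonneg_of_ae hy)]
      congr 1
      refine integral_congr_ae ?_
      filter_upwards [hy] with v hv
      rw [Real.norm_of_nonneg hv]
  refine ⟨hint, ?_⟩
  rw [forceField]
  simp_rw [gradient_potential hα hlam, smul_comm _ (-(α * lam))]
  rw [integral_smul, neg_smul, neg_neg]
  congr 1
  refine Eq.symm ((integral_prod _ hint).trans ?_)
  congr 1
  ext1 y
  rw [density]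
  exact integral_smul_const (fun v => f t (y, v)) (rieszKernel α (x - y))

/-- The kernel is unbounded, so closeness of f(s) and f(t) in L¹ does not bound the force difference
at one point. Averaged over a ball of radius r, the kernel is bounded uniformly in its centre, while
the Lipschitz bound makes each force vary by at most Br there. Both sides are kept multiplied by the
volume of the ball. -/
theorem IsSolution.force_sub_le (hα : 0 < α) (hα1 : α < 1) (hlam : lam ≠ 0)
    (hf : IsSolution α lam f₀ f) {B : ℝ}
    (hlip : ∀ t, 0 ≤ t → ∀ x y,
      ‖forceField α lam (f t) x - forceField α lam (f t) y‖ ≤ B * ‖x - y‖)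
    {s t r : ℝ} (hs : 0 ≤ s) (ht : 0 ≤ t) (hB : 0 ≤ B) (x : R3) :
    volume (Metric.ball (0 : R3) r) * ‖forceField α lam (f s) x - forceField α lam (f t) x‖ₑ
      ≤ ENNReal.ofReal |α * lam| * (eLpNorm (f s - f t) 1 volume *
          (2 * volume (Metric.ball (0 : R3) r)
            + ∫⁻ y in Metric.ball (0 : R3) 1, ENNReal.ofReal (‖y‖ ^ (-(2 + α)))))
        + volume (Metric.ball (0 : R3) r) * ENNReal.ofReal (2 * B * r) := by
  set F := fun u => forceField α lam (f u) with hF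
  have hk := measurable_rieszKernel α
  have h1 : ∀ y ∈ Metric.ball x r,
      ‖F s x - F t x‖ₑ ≤ ‖F s y - F t y‖ₑ + ENNReal.ofReal (2 * B * r) := by
    intro y hy
    rw [Metric.mem_ball, dist_eq_norm, norm_sub_rev] at hy
    have h2 := hlip s hs x y
    have h3 := hlip t ht x y
    have h4 : ‖F s x - F t x‖ ≤ ‖F s y - F t y‖ + 2 * B * r := by
      have e : F s x - F t x = (F s y - F t y) + ((F s x - F s y) - (F t x - F t y)) := by abel
      rw [e]
      refine (norm_add_le _ _).trans ?_
      have := norm_sub_le (F s x - F s y) (F t x - F t y)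
      have h5 : B * ‖x - y‖ ≤ B * r := by gcongr
      simp only [hF] at *
      linarith
    rw [← ofReal_norm, ← ofReal_norm]
    refine (ENNReal.ofReal_le_ofReal h4).trans ENNReal.ofReal_add_le
  have h2 : ∀ y, ‖F s y - F t y‖ₑ
      ≤ ENNReal.ofReal |α * lam| * ∫⁻ z : Phase, ‖f s z - f t z‖ₑ * ‖rieszKernel α (y - z.1)‖ₑ := by
    intro y
    obtain ⟨i1, e1⟩ := hf.integrable_kernel hα hlam hs y
    obtain ⟨i2, e2⟩ := hf.integrable_kernel hα hlam ht y
    simp only [hF]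
    rw [e1, e2, ← smul_sub, ← integral_sub i1 i2, enorm_smul, ← ofReal_norm (α * lam),
      Real.norm_eq_abs]
    gcongr
    refine (enorm_integral_le_lintegral_enorm _).trans (lintegral_mono fun z => ?_)
    rw [← sub_smul, enorm_smul]
  have hfm : AEMeasurable (fun z => ‖f s z - f t z‖ₑ) (volume : Measure Phase) :=
    ((hf.integrable hs).sub (hf.integrable ht)).aestronglyMeasurable.enorm
  calc volume (Metric.ball (0 : R3) r) * ‖F s x - F t x‖ₑ
      = ∫⁻ _ in Metric.ball x r, ‖F s x - F t x‖ₑ := by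
        rw [setLIntegral_const, Measure.addHaar_ball_center volume x r, mul_comm]
    _ ≤ ∫⁻ y in Metric.ball x r, (ENNReal.ofReal |α * lam| * ∫⁻ z : Phase,
          ‖f s z - f t z‖ₑ * ‖rieszKernel α (y - z.1)‖ₑ) + ENNReal.ofReal (2 * B * r) := by
        refine setLIntegral_mono' measurableSet_ball fun y hy => (h1 y hy).trans ?_
        gcongr
        exact h2 y
    _ = ENNReal.ofReal |α * lam| * (∫⁻ y in Metric.ball x r, ∫⁻ z : Phase,
          ‖f s z - f t z‖ₑ * ‖rieszKernel α (y - z.1)‖ₑ)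
          + volume (Metric.ball (0 : R3) r) * ENNReal.ofReal (2 * B * r) := by
        rw [lintegral_add_right _ measurable_const, lintegral_const_mul' _ _ ENNReal.ofReal_ne_top,
          setLIntegral_const, Measure.addHaar_ball_center, mul_comm (ENNReal.ofReal (2 * B * r))]
    _ = ENNReal.ofReal |α * lam| * (∫⁻ z : Phase, ∫⁻ y in Metric.ball x r,
          ‖f s z - f t z‖ₑ * ‖rieszKernel α (y - z.1)‖ₑ)
          + volume (Metric.ball (0 : R3) r) * ENNReal.ofReal (2 * B * r) := by
        congr 2
        refine lintegral_lintegral_swap ?_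
        refine hfm.comp_snd.mul ?_
        exact (hk.comp (measurable_fst.sub (measurable_fst.comp measurable_snd))).enorm.aemeasurable
    _ ≤ ENNReal.ofReal |α * lam| * (∫⁻ z : Phase, ‖f s z - f t z‖ₑ *
          (2 * volume (Metric.ball (0 : R3) r)
            + ∫⁻ y in Metric.ball (0 : R3) 1, ENNReal.ofReal (‖y‖ ^ (-(2 + α)))))
          + volume (Metric.ball (0 : R3) r) * ENNReal.ofReal (2 * B * r) := by
        gcongr with z
        rw [lintegral_const_mul' _ _ enorm_ne_top]
        gcongr
        exact lintegral_ball_kernel_le hα hα1 x z.1 r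
    _ = _ := by
        rw [lintegral_mul_const'' _ hfm, eLpNorm_one_eq_lintegral_enorm]
        rfl

theorem IsSolution.eventually_force_sub_le (hα : 0 < α) (hα1 : α < 1) (hlam : lam ≠ 0)
    (hf : IsSolution α lam f₀ f) {B : ℝ}
    (hlip : ∀ t, 0 ≤ t → ∀ x y,
      ‖forceField α lam (f t) x - forceField α lam (f t) y‖ ≤ B * ‖x - y‖)
    {t : ℝ} (ht : 0 ≤ t) (hB : 0 ≤ B) {ε : ℝ} (hε : 0 < ε) :
    ∀ᶠ s in 𝓝[Ici 0] t, ∀ x,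
      ‖forceField α lam (f s) x - forceField α lam (f t) x‖ ≤ ε := by
  -- The radius is fixed first so that the spatial variation 2Br is at most ε/2; s is then taken
  -- close to t for that radius.
  set r := ε / (4 * (B + 1)) with hr
  have hr0 : 0 < r := by positivity
  have hBr : 2 * B * r ≤ ε / 2 := by
    calc 2 * B * r ≤ 2 * (B + 1) * (ε / (4 * (B + 1))) := by gcongr; linarith
      _ = ε / 2 := by field_simp; norm_num
  set m := volume (Metric.ball (0 : R3) r) with hm
  have hm0 : m ≠ 0 := (Metric.measure_ball_pos _ _ hr0).ne'
  have hmt : m ≠ ⊤ := measure_ball_lt_top.ne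
  set K := 2 * m + ∫⁻ y in Metric.ball (0 : R3) 1, ENNReal.ofReal (‖y‖ ^ (-(2 + α))) with hK
  have hKt : K ≠ ⊤ := by
    refine ENNReal.add_ne_top.2 ⟨ENNReal.mul_ne_top (by simp) hmt, ?_⟩
    exact (lintegral_singular_lt_top (by linarith)).ne
  have h1 : Tendsto (fun s => ENNReal.ofReal |α * lam| * (eLpNorm (f s - f t) 1 volume * K))
      (𝓝[Ici 0] t) (𝓝 0) := by
    have := ENNReal.Tendsto.const_mul (a := ENNReal.ofReal |α * lam|)
      (ENNReal.Tendsto.mul_const (b := K) (hf.continuousL1 t ht) (Or.inr hKt))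
      (Or.inr ENNReal.ofReal_ne_top)
    simpa using this
  have hpos : 0 < m * ENNReal.ofReal (ε / 2) :=
    ENNReal.mul_pos hm0 (by simpa using hε)
  filter_upwards [h1.eventually (ge_mem_nhds hpos), self_mem_nhdsWithin] with s hs hs0 x
  have h2 := hf.force_sub_le hα hα1 hlam hlip (r := r) hs0 ht hB x
  have h3 : m * ‖forceField α lam (f s) x - forceField α lam (f t) x‖ₑ
      ≤ m * ENNReal.ofReal ε := by
    refine h2.trans ((add_le_add hs (mul_le_mul_right (ENNReal.ofReal_le_ofReal hBr) m)).trans ?_)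
    rw [← mul_add, ← ENNReal.ofReal_add (by positivity) (by positivity), add_halves]
  rw [ENNReal.mul_le_mul_iff_right hm0 hmt, ← ofReal_norm,
    ENNReal.ofReal_le_ofReal_iff hε.le] at h3
  exact h3

theorem le_of_bracket_rpow_mul_le {t p y B : ℝ} (hp : 0 ≤ p) (hy : 0 ≤ y)
    (h : bracket t ^ p * y ≤ B) : y ≤ B := by
  have := Real.one_le_rpow (one_le_bracket t) hp
  nlinarith

/-- The spatial bounds come from the dispersion estimates by dropping the time weights; continuity
in time comes from the L¹-continuity of f. -/
theorem IsSolution.regularField (hα : 0 < α) (hα1 : α < 1) (hlam : lam ≠ 0)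
    (hf : IsSolution α lam f₀ f) {B : ℝ}
    (hE : DispersionBound α B (fun t => forceField α lam (f t))) :
    RegularField B (fun t => forceField α lam (f t)) := by
  have hbd : ∀ t, 0 ≤ t → ∀ x, ‖fderiv ℝ (forceField α lam (f t)) x‖ ≤ B := fun t ht x =>
    le_of_bracket_rpow_mul_le (by linarith) (norm_nonneg _) (hE.bound_deriv t ht x)
  have hB : 0 ≤ B := (norm_nonneg _).trans (hbd 0 le_rfl 0)
  have hlip : ∀ t, 0 ≤ t → ∀ x y,
      ‖forceField α lam (f t) x - forceField α lam (f t) y‖ ≤ B * ‖x - y‖ := by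
    intro t ht x y
    exact convex_univ.norm_image_sub_le_of_norm_fderiv_le
      (fun z _ => (hE.differentiable t ht) z) (fun z _ => hbd t ht z) (mem_univ y) (mem_univ x)
  refine ⟨fun t ht x => ?_, hlip, fun t ht x y c => ?_, fun t ht ε hε => ?_⟩
  · exact le_of_bracket_rpow_mul_le (by linarith) (norm_nonneg _) (hE.bound t ht x)
  · exact norm_add_sub_two_smul_le (hE.differentiable t ht) hB (fun a b =>
      le_of_bracket_rpow_mul_le (t := t) (p := 3) (by norm_num) (norm_nonneg _)
        (by
          have := hE.bound_deriv_two t ht a b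
          exact this)) (hbd t ht) x y c
  · exact hf.eventually_force_sub_le hα hα1 hlam hlip ht hB hε

theorem IsSolution.isTransported (hf : IsSolution α lam f₀ f) :
    IsTransported (fun t => forceField α lam (f t)) f where
  integrable t ht := hf.integrable ht
  continuous t ht := by
    have h := (ENNReal.tendsto_toReal ENNReal.zero_ne_top).comp (hf.continuousL1 t ht)
    refine h.congr' ?_
    filter_upwards [self_mem_nhdsWithin] with s hs
    have hi := ((hf.integrable hs).sub (hf.integrable ht))
    have := integral_norm_eq_lintegral_enorm hi.aestronglyMeasurable
    simp only [Function.comp, eLpNorm_one_eq_lintegral_enorm]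
    rw [← this]
    rfl
  weak_form := hf.weak_form

/-- The force field expressed by the initial datum and the characteristic flow. -/
theorem IsSolution.forceField_eq (hα : 0 < α) (hα1 : α < 1) (hlam : lam ≠ 0)
    (hf : IsSolution α lam f₀ f) {B : ℝ}
    (hE : DispersionBound α B (fun t => forceField α lam (f t))) {Φ : ℝ → Phase → Phase}
    (hΦ : IsFlow (fun t => forceField α lam (f t)) Φ) {t : ℝ} (ht : 0 ≤ t) (x : R3) :
    forceField α lam (f t) x
      = (α * lam) • ∫ z, f₀ z • rieszKernel α (x - (Φ t z).1) := by
  have hR := hf.regularField hα hα1 hlam hE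
  have hmap := hf.isTransported.map_withDensity hR hΦ ht (hf.nonneg 0 le_rfl) (hf.nonneg t ht)
  have hk := measurable_rieszKernel α
  have key : ∀ s, 0 ≤ s → ∀ φ : Phase → R3,
      ∫ z, φ z ∂(volume.withDensity fun z => ENNReal.ofReal (f s z)) = ∫ z, f s z • φ z := by
    intro s hs φ
    rw [integral_withDensity_eq_integral_toReal_smul₀
      (hf.integrable hs).aestronglyMeasurable.aemeasurable.ennreal_ofReal (by simp)]
    refine integral_congr_ae ?_
    filter_upwards [hf.nonneg s hs] with z hz
    rw [ENNReal.toReal_ofReal hz]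
  have hkx : Measurable fun z : Phase => rieszKernel α (x - z.1) := by fun_prop
  rw [(hf.integrable_kernel hα hlam ht x).2, ← key t ht, ← hmap,
    integral_map (hΦ.continuous hR ht).aemeasurable
      hkx.aestronglyMeasurable, key 0 le_rfl]
  congr 1
  refine integral_congr_ae ?_
  filter_upwards [hf.initial] with z hz
  rw [hz]

end Solution

/-! ### Expansion of the flow in the initial velocity. -/

theorem hasDerivAt_one_add_rpow (p : ℝ) {s : ℝ} (hs : 0 ≤ s) :
    HasDerivAt (fun s : ℝ => (1 + s) ^ p) (p * (1 + s) ^ (p - 1)) s := by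
  have := ((hasDerivAt_id s).const_add 1).rpow_const (p := p) (Or.inl (by simp; linarith))
  simpa using this

theorem norm_sub_le_of_norm_deriv_le_rpow {F : Type*} [NormedAddCommGroup F] [NormedSpace ℝ F]
    {f f' : ℝ → F} {K α a b : ℝ} (hα : 0 < α) (hK : 0 ≤ K) (ha : 0 ≤ a) (hab : a ≤ b)
    (hf : ContinuousOn f (Icc a b))
    (hf' : ∀ x ∈ Ico a b, HasDerivWithinAt f (f' x) (Ici x) x)
    (h : ∀ x ∈ Ico a b, ‖f' x‖ ≤ K * (1 + x) ^ (-(1 + α))) :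
    ‖f b - f a‖ ≤ K / α * (1 + a) ^ (-α) := by
  have hB : ∀ x, 0 ≤ x → HasDerivAt (fun x : ℝ => -(K / α) * (1 + x) ^ (-α))
      (K * (1 + x) ^ (-(1 + α))) x := by
    intro x hx
    refine ((hasDerivAt_one_add_rpow (-α) hx).const_mul (-(K / α))).congr_deriv ?_
    rw [show -α - 1 = -(1 + α) by ring]
    field_simp
  have := norm_sub_le_of_norm_deriv_right_le hab hf hf'
    (fun x hx => (hB x (ha.trans hx.1)).continuousAt.continuousWithinAt)
    (fun x hx => (hB x (ha.trans hx.1)).hasDerivWithinAt) h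
  have h2 : 0 ≤ K / α * (1 + b) ^ (-α) := by
    have : 0 ≤ 1 + b := by linarith
    positivity
  linarith

section Expanding

variable {E : ℝ → R3 → R3} {Φ : ℝ → Phase → Phase} {α κ : ℝ}

theorem IsFlow.hasDerivWithinAt_fst (hΦ : IsFlow E Φ) (z : Phase) {t : ℝ} (ht : 0 ≤ t) :
    HasDerivWithinAt (fun s => (Φ s z).1) (Φ t z).2 (Ici t) t :=
  (((hΦ z).2 t ht).mono (Ici_subset_Ici.2 ht)).fst

theorem IsFlow.hasDerivWithinAt_snd (hΦ : IsFlow E Φ) (z : Phase) {t : ℝ} (ht : 0 ≤ t) :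
    HasDerivWithinAt (fun s => (Φ s z).2) (E t (Φ t z).1) (Ici t) t :=
  (((hΦ z).2 t ht).mono (Ici_subset_Ici.2 ht)).snd

theorem IsFlow.continuousOn_fst (hΦ : IsFlow E Φ) (z : Phase) :
    ContinuousOn (fun s => (Φ s z).1) (Ici 0) := continuous_fst.comp_continuousOn (hΦ.continuousOn z)

theorem IsFlow.continuousOn_snd (hΦ : IsFlow E Φ) (z : Phase) :
    ContinuousOn (fun s => (Φ s z).2) (Ici 0) := continuous_snd.comp_continuousOn (hΦ.continuousOn z)

/-- For a force with small, decaying Lipschitz constant, the flow is at fixed initial position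
a small perturbation of free transport. -/
theorem IsFlow.norm_sub_sub_le (hΦ : IsFlow E Φ) (hα : 0 < α) (hκ : 0 ≤ κ) (hκα : κ / α ≤ 1 / 4)
    (hE : ∀ t, 0 ≤ t → ∀ x y, ‖E t x - E t y‖ ≤ κ * (1 + t) ^ (-(2 + α)) * ‖x - y‖)
    {t : ℝ} (ht : 0 ≤ t) (x v v' : R3) :
    ‖((Φ t (x, v)).2 - (Φ t (x, v')).2) - (v - v')‖ ≤ 1 / 2 * ‖v - v'‖ ∧
    ‖((Φ t (x, v)).1 - (Φ t (x, v')).1) - t • (v - v')‖ ≤ 1 / 2 * t * ‖v - v'‖ := by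
  set p : ℝ → R3 := fun s => (Φ s (x, v)).2 - (Φ s (x, v')).2 with hp
  set u : ℝ → R3 := fun s => (Φ s (x, v)).1 - (Φ s (x, v')).1 with hu
  have hsub : Icc 0 t ⊆ Ici (0 : ℝ) := Icc_subset_Ici_self
  have hpc : ContinuousOn p (Icc 0 t) :=
    ((hΦ.continuousOn_snd _).sub (hΦ.continuousOn_snd _)).mono hsub
  have huc : ContinuousOn u (Icc 0 t) :=
    ((hΦ.continuousOn_fst _).sub (hΦ.continuousOn_fst _)).mono hsub
  have hp0 : p 0 = v - v' := by simp [hp, (hΦ _).1]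
  have hu0 : u 0 = 0 := by simp [hu, (hΦ _).1]
  have hu' : ∀ s, 0 ≤ s → HasDerivWithinAt u (p s) (Ici s) s := fun s hs =>
    (hΦ.hasDerivWithinAt_fst _ hs).sub (hΦ.hasDerivWithinAt_fst _ hs)
  have hp' : ∀ s, 0 ≤ s → HasDerivWithinAt p
      (E s (Φ s (x, v)).1 - E s (Φ s (x, v')).1) (Ici s) s := fun s hs =>
    (hΦ.hasDerivWithinAt_snd _ hs).sub (hΦ.hasDerivWithinAt_snd _ hs)
  -- Bootstrap on the maximum M of the velocity difference over [0,t]. Positions separate by at most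
  -- Ms, the resulting force difference integrates to at most κM/α ≤ M/4, hence M ≤ (4/3)|v - v'|
  -- and the deviation stays below |v - v'|/2.
  obtain ⟨s₀, hs₀, hmax⟩ := isCompact_Icc.exists_isMaxOn (nonempty_Icc.2 ht) hpc.norm
  set M := ‖p s₀‖ with hM
  have hM0 : 0 ≤ M := norm_nonneg _
  have hpM : ∀ s ∈ Icc 0 t, ‖p s‖ ≤ M := fun s hs => hmax hs
  have huM : ∀ s ∈ Icc 0 t, ‖u s‖ ≤ M * s := by
    intro s hs
    have := norm_image_sub_le_of_norm_deriv_right_le_segment (f := u) (f' := p) (a := 0) (b := s)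
      (C := M) (huc.mono (Icc_subset_Icc_right hs.2)) (fun r hr => hu' r hr.1)
      (fun r hr => hpM r ⟨hr.1, hr.2.le.trans hs.2⟩) s ⟨hs.1, le_rfl⟩
    simpa [hu0] using this
  have hdiff : ∀ s ∈ Icc 0 t, ‖p s - (v - v')‖ ≤ M / 4 := by
    intro s hs
    have := norm_sub_le_of_norm_deriv_le_rpow (f := p) (K := κ * M) hα (by positivity) le_rfl hs.1
      (hpc.mono (Icc_subset_Icc_right hs.2)) (fun r hr => hp' r hr.1) (fun r hr => ?_)
    · rw [hp0, add_zero, Real.one_rpow, mul_one] at this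
      refine this.trans ?_
      have : κ * M / α = κ / α * M := by ring
      rw [this]
      nlinarith
    · have h1 := hE r hr.1 (Φ r (x, v)).1 (Φ r (x, v')).1
      have h2 := huM r ⟨hr.1, hr.2.le.trans hs.2⟩
      have hr0 : 0 < 1 + r := by linarith [hr.1]
      have h3 : (1 + r) ^ (-(1 + α)) = (1 + r) ^ (-(2 + α)) * (1 + r) := by
        rw [← Real.rpow_add_one hr0.ne']
        congr 1
        ring
      have h4 : 0 ≤ (1 + r) ^ (-(2 + α)) := by positivity
      refine h1.trans ?_
      rw [h3]
      calc κ * (1 + r) ^ (-(2 + α)) * ‖u r‖ ≤ κ * (1 + r) ^ (-(2 + α)) * (M * (1 + r)) := by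
            gcongr
            nlinarith
        _ = _ := by ring
  have hMle : M ≤ 4 / 3 * ‖v - v'‖ := by
    have h1 := hdiff s₀ hs₀
    have h2 := norm_sub_norm_le (p s₀) (v - v')
    linarith
  have hdiff' : ∀ s ∈ Icc 0 t, ‖p s - (v - v')‖ ≤ 1 / 2 * ‖v - v'‖ := fun s hs =>
    (hdiff s hs).trans (by linarith [norm_nonneg (v - v')])
  refine ⟨hdiff' t ⟨ht, le_rfl⟩, ?_⟩
  have := norm_image_sub_le_of_norm_deriv_right_le_segment (f := fun s => u s - s • (v - v'))
    (f' := fun s => p s - (1 : ℝ) • (v - v')) (a := 0) (b := t)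
    (C := 1 / 2 * ‖v - v'‖) (huc.sub (by fun_prop)) (fun r hr => (hu' r hr.1).sub
      ((hasDerivAt_id r).smul_const _).hasDerivWithinAt)
    (fun r hr => by
      rw [one_smul]
      exact hdiff' r ⟨hr.1, hr.2.le⟩) t ⟨ht, le_rfl⟩
  simp only [hu0, zero_smul, sub_zero] at this
  linarith

theorem IsFlow.expanding_snd (hΦ : IsFlow E Φ) (hα : 0 < α) (hκ : 0 ≤ κ) (hκα : κ / α ≤ 1 / 4)
    (hE : ∀ t, 0 ≤ t → ∀ x y, ‖E t x - E t y‖ ≤ κ * (1 + t) ^ (-(2 + α)) * ‖x - y‖)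
    {t : ℝ} (ht : 0 ≤ t) (x v v' : R3) :
    1 / 2 * ‖v - v'‖ ≤ ‖(Φ t (x, v)).2 - (Φ t (x, v')).2‖ := by
  have h1 := (hΦ.norm_sub_sub_le hα hκ hκα hE ht x v v').1
  have h2 := norm_sub_norm_le (v - v') ((Φ t (x, v)).2 - (Φ t (x, v')).2)
  rw [norm_sub_rev (v - v')] at h2
  linarith

theorem IsFlow.expanding_fst (hΦ : IsFlow E Φ) (hα : 0 < α) (hκ : 0 ≤ κ) (hκα : κ / α ≤ 1 / 4)
    (hE : ∀ t, 0 ≤ t → ∀ x y, ‖E t x - E t y‖ ≤ κ * (1 + t) ^ (-(2 + α)) * ‖x - y‖)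
    {t : ℝ} (ht : 0 < t) (x v v' : R3) :
    1 / 2 * ‖v - v'‖ ≤ ‖t⁻¹ • (Φ t (x, v)).1 - t⁻¹ • (Φ t (x, v')).1‖ := by
  have h1 := (hΦ.norm_sub_sub_le hα hκ hκα hE ht.le x v v').2
  have h2 := norm_sub_norm_le (t • (v - v')) ((Φ t (x, v)).1 - (Φ t (x, v')).1)
  rw [norm_sub_rev (t • (v - v')), norm_smul, Real.norm_of_nonneg ht.le] at h2
  rw [← smul_sub, norm_smul, norm_inv, Real.norm_of_nonneg ht.le, inv_mul_eq_div, le_div_iff₀ ht]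
  linarith

end Expanding

/-! ### Singular integrals of the datum against an expanding map. -/

/-- The integral of `|y - G(z)|^{-β}` against a datum in `L¹ ∩ L¹_x L^∞_v`, for `G` expanding
in `v`. -/
theorem lintegral_singular_le {β c : ℝ} (hβ : 0 ≤ β) (hβ3 : β < 3) (hc : 0 < c)
    {g : Phase → ℝ} (hg : AEStronglyMeasurable g) {G : Phase → R3} (hG : Measurable G)
    (hGe : ∀ x v v', c * ‖v - v'‖ ≤ ‖G (x, v) - G (x, v')‖) (y : R3) :
    ∫⁻ z, ‖g z‖ₑ * ENNReal.ofReal (‖y - G z‖ ^ (-β))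
      ≤ (∫⁻ z, ‖g z‖ₑ) + normL1xLinfv g * (ENNReal.ofReal (c⁻¹ ^ 3) *
        ∫⁻ y in Metric.ball (0 : R3) 1, ENNReal.ofReal (‖y‖ ^ (-β))) := by
  set J : R3 → ℝ≥0∞ := (Metric.ball (0 : R3) 1).indicator
    (fun y => ENNReal.ofReal (‖y‖ ^ (-β))) with hJ
  have hJm : Measurable J := (measurable_ofReal_norm_rpow _).indicator measurableSet_ball
  have hgm : AEMeasurable (fun z => ‖g z‖ₑ) (volume : Measure Phase) := hg.enorm
  have hJG : Measurable fun z : Phase => J (y - G z) := hJm.comp (measurable_const.sub hG)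
  calc ∫⁻ z, ‖g z‖ₑ * ENNReal.ofReal (‖y - G z‖ ^ (-β))
      ≤ ∫⁻ z, (‖g z‖ₑ + ‖g z‖ₑ * J (y - G z)) := by
        refine lintegral_mono fun z => ?_
        refine (mul_le_mul_right (ofReal_norm_rpow_le hβ _) _).trans ?_
        rw [mul_add, mul_one]
    _ = (∫⁻ z, ‖g z‖ₑ) + ∫⁻ z, ‖g z‖ₑ * J (y - G z) := lintegral_add_left' hgm _
    _ ≤ _ := by
      gcongr
      have hprod : ∫⁻ z, ‖g z‖ₑ * J (y - G z)
          = ∫⁻ x : R3, ∫⁻ v : R3, ‖g (x, v)‖ₑ * J (y - G (x, v)) :=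
        lintegral_prod _ (hgm.mul hJG.aemeasurable)
      rw [hprod, normL1xLinfv]
      have hJt : ∀ x : R3, ∫⁻ v : R3, J (y - G (x, v))
          ≤ ENNReal.ofReal (c⁻¹ ^ 3) * ∫⁻ w, J w := by
        intro x
        rw [← lintegral_sub_left_eq_self J y]
        exact lintegral_comp_le_of_expanding (h := fun w => J (y - w)) hc
          (hG.comp measurable_prodMk_left) (hGe x) (hJm.comp (measurable_const.sub measurable_id))
      rw [← lintegral_indicator measurableSet_ball, ← hJ]
      calc ∫⁻ x : R3, ∫⁻ v : R3, ‖g (x, v)‖ₑ * J (y - G (x, v))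
          ≤ ∫⁻ x : R3, eLpNorm (fun v : R3 => g (x, v)) ⊤ volume *
              (ENNReal.ofReal (c⁻¹ ^ 3) * ∫⁻ w, J w) := by
            refine lintegral_mono fun x => ?_
            calc ∫⁻ v : R3, ‖g (x, v)‖ₑ * J (y - G (x, v))
                ≤ ∫⁻ v : R3, eLpNorm (fun v : R3 => g (x, v)) ⊤ volume * J (y - G (x, v)) := by
                  refine lintegral_mono_ae ?_
                  filter_upwards [ae_le_eLpNormEssSup (f := fun v : R3 => g (x, v))
                    (μ := volume)] with v hv
                  rw [eLpNorm_exponent_top]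
                  gcongr
              _ = eLpNorm (fun v : R3 => g (x, v)) ⊤ volume * ∫⁻ v : R3, J (y - G (x, v)) :=
                  lintegral_const_mul _ (hJG.comp measurable_prodMk_left)
              _ ≤ _ := by
                  gcongr
                  exact hJt x
        _ ≤ _ := by
            rw [lintegral_mul_const']
            refine ENNReal.mul_ne_top ENNReal.ofReal_ne_top ?_
            rw [hJ, lintegral_indicator measurableSet_ball]
            exact (lintegral_singular_lt_top hβ3).ne

/-- The norm is an infimum over representatives that is not known to be attained; doubling η gives
one below the bound. -/
theorem exists_isWeakDeriv_lt {N : (Phase → ℝ) → ℝ≥0∞} {l : List Phase} {u : Phase → ℝ}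
    {η : ℝ} (hη : 0 < η) (h : weakDerivNorm N l u ≤ ENNReal.ofReal η) :
    ∃ g, IsWeakDeriv l u g ∧ N g ≤ ENNReal.ofReal (2 * η) := by
  have h1 : weakDerivNorm N l u < ENNReal.ofReal (2 * η) :=
    h.trans_lt ((ENNReal.ofReal_lt_ofReal_iff (by linarith)).2 (by linarith))
  obtain ⟨g, hg⟩ := iInf_lt_iff.1 h1
  obtain ⟨hw, hlt⟩ := iInf_lt_iff.1 hg
  exact ⟨g, hw, hlt.le⟩

theorem IsWeakDeriv.ae_eq {u g : Phase → ℝ} (h : IsWeakDeriv [] u g) : u =ᵐ[volume] g := by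
  obtain ⟨h1, h2, h3⟩ := h
  refine ae_eq_of_integral_contDiff_smul_eq h1 h2 fun φ hφ hc => ?_
  have := h3 φ hφ hc
  simp only [iterDeriv, List.length_nil, pow_zero, one_mul] at this
  simp_rw [smul_eq_mul, mul_comm (φ _)]
  exact this

/-- The part of the smallness assumption on the datum that controls the singular integrals. -/
theorem exists_representative_of_weightedDataNorm_le {f₀ : Phase → ℝ} {η : ℝ} (hη : 0 < η)
    (h : weightedDataNorm f₀ ≤ ENNReal.ofReal η) :
    ∃ g : Phase → ℝ, (fun z : Phase => bracket z.1 * f₀ z) =ᵐ[volume] g ∧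
      AEStronglyMeasurable g ∧ ∫⁻ z, ‖g z‖ₑ ≤ ENNReal.ofReal (2 * η) ∧
      normL1xLinfv g ≤ ENNReal.ofReal (2 * η) := by
  set u : Phase → ℝ := fun z => bracket z.1 * f₀ z with hu
  have hw : weightedDataNorm f₀ = max (sobolevNorm 1 u) (sobolevNorm ⊤ u)
    + max (mixedNormXV u) (mixedNormVX u) := rfl
  rw [hw] at h
  have h1 : weakDerivNorm (fun g => eLpNorm g 1 volume) [] u ≤ ENNReal.ofReal η := by
    refine le_trans ?_ h
    refine le_trans ?_ le_self_add
    refine le_trans ?_ (le_max_left _ _)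
    rw [sobolevNorm, add_assoc]
    exact le_self_add
  have h2 : weakDerivNorm normL1xLinfv [] u ≤ ENNReal.ofReal η := by
    refine le_trans ?_ h
    refine le_trans ?_ le_add_self
    refine le_trans ?_ (le_max_left _ _)
    rw [mixedNormXV]
    refine le_trans ?_ (Finset.single_le_sum (f := fun m : Option (Fin 3) =>
      ∑ m' : Option (Fin 3), weakDerivNorm normL1xLinfv (multiX m ++ multiV m') u)
      (fun _ _ => zero_le) (Finset.mem_univ none))
    exact Finset.single_le_sum (f := fun m' : Option (Fin 3) =>
      weakDerivNorm normL1xLinfv (multiX none ++ multiV m') u)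
      (fun _ _ => zero_le) (Finset.mem_univ none)
  -- The L¹ and mixed norms may produce different representatives. The one for the mixed norm is
  -- kept, since the L¹ norm transfers across almost everywhere equality at once.
  obtain ⟨g₁, hg₁, hn₁⟩ := exists_isWeakDeriv_lt hη h1
  obtain ⟨g₂, hg₂, hn₂⟩ := exists_isWeakDeriv_lt hη h2
  refine ⟨g₂, hg₂.ae_eq, hg₂.2.1.aestronglyMeasurable, ?_, hn₂⟩
  rw [← eLpNorm_one_eq_lintegral_enorm, eLpNorm_congr_ae (hg₂.ae_eq.symm.trans hg₁.ae_eq)]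
  exact hn₁

/-- The constant in the estimates of the singular integrals. -/
noncomputable def singularConst (α : ℝ) : ℝ :=
  2 + 16 * (∫⁻ y in Metric.ball (0 : R3) 1, ENNReal.ofReal (‖y‖ ^ (-(2 + α)))).toReal

theorem singularConst_pos (α : ℝ) : 0 < singularConst α := by
  unfold singularConst
  positivity

/-- The weight ⟨x⟩ stays in the integrand because it will absorb the growth of 𝒳 - t𝒱 with the
initial position of the source particle. -/
theorem integrable_singular {α : ℝ} (hα : 0 < α) (hα1 : α < 1) {f₀ : Phase → ℝ} {η : ℝ}
    (hη : 0 < η) (h : weightedDataNorm f₀ ≤ ENNReal.ofReal η) {G : Phase → R3} (hG : Measurable G)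
    (hGe : ∀ x v v', 1 / 2 * ‖v - v'‖ ≤ ‖G (x, v) - G (x, v')‖) (y : R3) :
    Integrable (fun z : Phase => bracket z.1 * |f₀ z| * ‖y - G z‖ ^ (-(2 + α))) ∧
      ∫ z : Phase, bracket z.1 * |f₀ z| * ‖y - G z‖ ^ (-(2 + α)) ≤ singularConst α * η := by
  obtain ⟨g, hug, hgm, hg1, hg2⟩ := exists_representative_of_weightedDataNorm_le hη h
  set J := ∫⁻ y in Metric.ball (0 : R3) 1, ENNReal.ofReal (‖y‖ ^ (-(2 + α))) with hJ
  have hJt : J ≠ ⊤ := (lintegral_singular_lt_top (by linarith)).ne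
  have hbound : ∫⁻ z, ‖g z‖ₑ * ENNReal.ofReal (‖y - G z‖ ^ (-(2 + α)))
      ≤ ENNReal.ofReal (singularConst α * η) := by
    refine (lintegral_singular_le (by linarith) (by linarith) (by norm_num) hgm hG hGe y).trans ?_
    rw [← hJ]
    -- Both norms are at most 2η, and expansion by 1/2 contributes 2³; hence the constants 2 and 16
    -- in `singularConst`.
    calc _ ≤ ENNReal.ofReal (2 * η) + ENNReal.ofReal (2 * η) *
          (ENNReal.ofReal ((1 / 2 : ℝ)⁻¹ ^ 3) * J) := by gcongr
      _ = _ := by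
        rw [← ENNReal.ofReal_toReal hJt, ← ENNReal.ofReal_mul (by norm_num),
          ← ENNReal.ofReal_mul (by positivity), ← ENNReal.ofReal_add (by positivity)
          (by positivity), singularConst, ← hJ]
        congr 1
        norm_num
        ring
  have hae : (fun z : Phase => bracket z.1 * |f₀ z| * ‖y - G z‖ ^ (-(2 + α)))
      =ᵐ[volume] fun z => |g z| * ‖y - G z‖ ^ (-(2 + α)) := by
    filter_upwards [hug] with z hz
    rw [← hz, abs_mul, abs_of_nonneg (zero_le_one.trans (one_le_bracket z.1))]
  have hm : AEStronglyMeasurable (fun z => |g z| * ‖y - G z‖ ^ (-(2 + α))) volume := by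
    have h1 : Measurable fun z : Phase => ‖y - G z‖ ^ (-(2 + α)) := by fun_prop
    exact hgm.norm.mul h1.aestronglyMeasurable
  have hen : ∀ z, ENNReal.ofReal (|g z| * ‖y - G z‖ ^ (-(2 + α)))
      = ‖g z‖ₑ * ENNReal.ofReal (‖y - G z‖ ^ (-(2 + α))) := fun z => by
    rw [ENNReal.ofReal_mul (abs_nonneg _), ← Real.norm_eq_abs, ofReal_norm]
  have hnn : ∀ z, 0 ≤ |g z| * ‖y - G z‖ ^ (-(2 + α)) := fun z => by positivity
  have hi : Integrable (fun z => |g z| * ‖y - G z‖ ^ (-(2 + α))) := by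
    refine ⟨hm, ?_⟩
    rw [hasFiniteIntegral_iff_ofReal (.of_forall hnn)]
    simp_rw [hen]
    exact hbound.trans_lt ENNReal.ofReal_lt_top
  refine ⟨hi.congr hae.symm, ?_⟩
  rw [integral_congr_ae hae, integral_eq_lintegral_of_nonneg_ae (.of_forall hnn) hm]
  simp_rw [hen]
  exact ENNReal.toReal_le_of_le_ofReal (by have := singularConst_pos α; positivity) hbound

theorem integrable_smul_rieszKernel {α : ℝ} (hα : 0 < α) {f₀ : Phase → ℝ} (hf : Integrable f₀)
    {G : Phase → R3} (hG : Measurable G) {y : R3}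
    (h : Integrable (fun z : Phase => bracket z.1 * |f₀ z| * ‖y - G z‖ ^ (-(2 + α)))) :
    Integrable (fun z => f₀ z • rieszKernel α (y - G z)) := by
  have hk := measurable_rieszKernel α
  have hkG : Measurable fun z => rieszKernel α (y - G z) := by fun_prop
  refine (hf.abs.add h).mono' (hf.aestronglyMeasurable.smul hkG.aestronglyMeasurable)
    (.of_forall fun z => ?_)
  rw [norm_smul, Real.norm_eq_abs]
  refine (mul_le_mul_of_nonneg_left (norm_rieszKernel_le (by linarith) _) (abs_nonneg _)).trans ?_
  rw [mul_add, mul_one]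
  refine add_le_add le_rfl (mul_le_mul_of_nonneg_right ?_ (by positivity))
  exact le_mul_of_one_le_left (abs_nonneg _) (one_le_bracket _)

/-! ### The velocity correction and the asymptotics of trajectories. -/

theorem correctionIntegrand_eq {α lam : ℝ} (hα : 0 < α) (hlam : lam ≠ 0) (f₀ : Phase → ℝ)
    (Φ : ℝ → Phase → Phase) (t : ℝ) (v : R3) (z : Phase) :
    correctionIntegrand α lam f₀ Φ t v z
      = (-(α * lam)) • (f₀ z • rieszKernel α (v - (Φ t z).2)) := by
  rw [correctionIntegrand, gradient_potential hα hlam, smul_comm]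

/-- The velocity correction, up to the factor `αλ`. -/
noncomputable def velocityKernel (α : ℝ) (f₀ : Phase → ℝ) (Φ : ℝ → Phase → Phase) (t : ℝ)
    (v : R3) : R3 :=
  ∫ z, f₀ z • rieszKernel α (v - (Φ t z).2)

theorem correction_eq {α lam : ℝ} (hα : 0 < α) (hlam : lam ≠ 0) (f₀ : Phase → ℝ)
    (Φ : ℝ → Phase → Phase) (t : ℝ) (v : R3) :
    correction α lam f₀ Φ t v = (α * lam) • velocityKernel α f₀ Φ t v := by
  rw [correction]
  simp_rw [correctionIntegrand_eq hα hlam]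
  rw [integral_smul, neg_smul, neg_neg, velocityKernel]

/-- The characteristic flow of a self-consistent force field `E` with decay `κ t^{-1-α}`, for
which the singular integrals of the datum against the flow are controlled by `m`. -/
structure IsDispersiveFlow (α lam κ m : ℝ) (f₀ : Phase → ℝ) (E : ℝ → R3 → R3)
    (Φ : ℝ → Phase → Phase) : Prop where
  isFlow : IsFlow E Φ
  measurable : ∀ t, 0 ≤ t → Measurable (Φ t)
  integrable : Integrable f₀
  nonneg : 0 ≤ κ
  le_one : κ ≤ 1
  nonneg' : 0 ≤ m
  force_le : ∀ t, 0 ≤ t → ∀ x, ‖E t x‖ ≤ κ * (1 + t) ^ (-(1 + α))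
  force_eq : ∀ t, 0 ≤ t → ∀ x, E t x = (α * lam) • ∫ z, f₀ z • rieszKernel α (x - (Φ t z).1)
  singular_fst : ∀ t, 0 < t → ∀ y,
    Integrable (fun z : Phase => bracket z.1 * |f₀ z| * ‖y - (Φ t z).1‖ ^ (-(2 + α))) ∧
      ∫ z : Phase, bracket z.1 * |f₀ z| * ‖y - (Φ t z).1‖ ^ (-(2 + α)) ≤ m * t ^ (-(2 + α))
  singular_snd : ∀ t, 0 ≤ t → ∀ y,
    Integrable (fun z : Phase => bracket z.1 * |f₀ z| * ‖y - (Φ t z).2‖ ^ (-(2 + α))) ∧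
      ∫ z : Phase, bracket z.1 * |f₀ z| * ‖y - (Φ t z).2‖ ^ (-(2 + α)) ≤ m

namespace IsDispersiveFlow

variable {α lam κ m : ℝ} {f₀ : Phase → ℝ} {E : ℝ → R3 → R3} {Φ : ℝ → Phase → Phase}

theorem integrable_fst (h : IsDispersiveFlow α lam κ m f₀ E Φ) (hα : 0 < α) {t : ℝ} (ht : 0 < t)
    (y : R3) : Integrable (fun z => f₀ z • rieszKernel α (y - (Φ t z).1)) :=
  integrable_smul_rieszKernel hα h.integrable (measurable_fst.comp (h.measurable t ht.le))
    (h.singular_fst t ht y).1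

theorem integrable_snd (h : IsDispersiveFlow α lam κ m f₀ E Φ) (hα : 0 < α) {t : ℝ} (ht : 0 ≤ t)
    (y : R3) : Integrable (fun z => f₀ z • rieszKernel α (y - (Φ t z).2)) :=
  integrable_smul_rieszKernel hα h.integrable (measurable_snd.comp (h.measurable t ht))
    (h.singular_snd t ht y).1

theorem norm_snd_sub_le_mul (h : IsDispersiveFlow α lam κ m f₀ E Φ) (hα : 0 < α) {s t : ℝ}
    (hs : 0 ≤ s) (hst : s ≤ t) (z : Phase) :
    ‖(Φ t z).2 - (Φ s z).2‖ ≤ κ * (1 + s) ^ (-(1 + α)) * (t - s) := by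
  refine norm_image_sub_le_of_norm_deriv_right_le_segment (f := fun r => (Φ r z).2)
    (f' := fun r => E r (Φ r z).1) (a := s) (b := t)
    ((h.isFlow.continuousOn_snd z).mono fun _ hr => hs.trans hr.1)
    (fun _ hr => h.isFlow.hasDerivWithinAt_snd z (hs.trans hr.1)) (fun r hr => ?_) t ⟨hst, le_rfl⟩
  refine (h.force_le r (hs.trans hr.1) _).trans ?_
  have := h.nonneg
  refine mul_le_mul_of_nonneg_left ?_ this
  exact Real.rpow_le_rpow_of_nonpos (by linarith) (by linarith [hr.1]) (by linarith)

theorem norm_snd_sub_le (h : IsDispersiveFlow α lam κ m f₀ E Φ) (hα : 0 < α) {s t : ℝ}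
    (hs : 0 ≤ s) (hst : s ≤ t) (z : Phase) :
    ‖(Φ t z).2 - (Φ s z).2‖ ≤ κ / α * (1 + s) ^ (-α) :=
  norm_sub_le_of_norm_deriv_le_rpow (f := fun r => (Φ r z).2) hα h.nonneg hs hst
    ((h.isFlow.continuousOn_snd z).mono fun _ hr => hs.trans hr.1)
    (fun _ hr => h.isFlow.hasDerivWithinAt_snd z (hs.trans hr.1))
    (fun r hr => h.force_le r (hs.trans hr.1) _)

/-- The velocity terms cancel, leaving only the force: this is the position with free transport
undone. -/
theorem hasDerivWithinAt_sub_smul (h : IsDispersiveFlow α lam κ m f₀ E Φ) (z : Phase) {t : ℝ}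
    (ht : 0 ≤ t) :
    HasDerivWithinAt (fun s => (Φ s z).1 - s • (Φ s z).2) (-(t • E t (Φ t z).1)) (Ici t) t := by
  have h1 := h.isFlow.hasDerivWithinAt_fst z ht
  have h2 := h.isFlow.hasDerivWithinAt_snd z ht
  refine (h1.sub ((hasDerivWithinAt_id t (Ici t)).smul h2)).congr_deriv ?_
  simp only [id, one_smul]
  abel

theorem continuousOn_sub_smul (h : IsDispersiveFlow α lam κ m f₀ E Φ) (z : Phase) :
    ContinuousOn (fun s => (Φ s z).1 - s • (Φ s z).2) (Ici 0) :=
  (h.isFlow.continuousOn_fst z).sub (continuousOn_id.smul (h.isFlow.continuousOn_snd z))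

theorem norm_sub_smul_sub_le_of_le_one (h : IsDispersiveFlow α lam κ m f₀ E Φ) (hα : 0 < α)
    {t : ℝ} (ht : 0 ≤ t) (ht1 : t ≤ 1) (z : Phase) :
    ‖(Φ t z).1 - t • (Φ t z).2 - z.1‖ ≤ κ := by
  have := norm_image_sub_le_of_norm_deriv_right_le_segment
    (f := fun r => (Φ r z).1 - r • (Φ r z).2) (f' := fun r => -(r • E r (Φ r z).1))
    (a := 0) (b := t) (C := κ) ((h.continuousOn_sub_smul z).mono Icc_subset_Ici_self)
    (fun r hr => h.hasDerivWithinAt_sub_smul z hr.1) (fun r hr => ?_) t ⟨ht, le_rfl⟩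
  · simp only [(h.isFlow z).1, zero_smul, sub_zero] at this
    have := h.nonneg
    nlinarith
  · rw [norm_neg, norm_smul, Real.norm_of_nonneg hr.1]
    have h1 := h.force_le r hr.1 (Φ r z).1
    have h2 : (1 + r) ^ (-(1 + α)) ≤ 1 :=
      Real.rpow_le_one_of_one_le_of_nonpos (by linarith [hr.1]) (by linarith)
    have h3 : ‖E r (Φ r z).1‖ ≤ κ := h1.trans (mul_le_of_le_one_right h.nonneg h2)
    have h4 : r ≤ 1 := hr.2.le.trans ht1
    exact (mul_le_of_le_one_left (norm_nonneg _) h4).trans h3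

/-- The derivative -tE is at most (1+t)^{-α}, as κ ≤ 1, and integrates to (1+t)^{1-α}/(1-α) ≤
2t^{1-α}/(1-α); the initial position gives the summand 1. -/
theorem norm_sub_smul_le (h : IsDispersiveFlow α lam κ m f₀ E Φ) (hα : 0 < α) (hα1 : α < 1)
    {t : ℝ} (ht : 1 ≤ t) (z : Phase) :
    ‖(Φ t z).1 - t • (Φ t z).2‖ ≤ (1 + 2 / (1 - α)) * bracket z.1 * t ^ (1 - α) := by
  have h1α : 0 < 1 - α := by linarith
  have hB : ∀ x : ℝ, 0 ≤ x → HasDerivAt (fun x : ℝ => 1 / (1 - α) * (1 + x) ^ (1 - α))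
      ((1 + x) ^ (-α)) x := by
    intro x hx
    refine ((hasDerivAt_one_add_rpow (1 - α) hx).const_mul (1 / (1 - α))).congr_deriv ?_
    rw [show 1 - α - 1 = -α by ring]
    field_simp
  have h0 := norm_sub_le_of_norm_deriv_right_le (f := fun r => (Φ r z).1 - r • (Φ r z).2)
    (f' := fun r => -(r • E r (Φ r z).1)) (a := 0) (b := t) (by linarith)
    ((h.continuousOn_sub_smul z).mono Icc_subset_Ici_self)
    (fun r hr => h.hasDerivWithinAt_sub_smul z hr.1)
    (fun x hx => (hB x hx.1).continuousAt.continuousWithinAt)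
    (fun x hx => (hB x hx.1).hasDerivWithinAt) (fun r hr => ?_)
  · simp only [(h.isFlow z).1, zero_smul, sub_zero] at h0
    have h2 : (1 + t) ^ (1 - α) ≤ 2 * t ^ (1 - α) := by
      calc (1 + t) ^ (1 - α) ≤ (2 * t) ^ (1 - α) :=
            Real.rpow_le_rpow (by linarith) (by linarith) h1α.le
        _ = 2 ^ (1 - α) * t ^ (1 - α) := Real.mul_rpow (by norm_num) (by linarith)
        _ ≤ 2 * t ^ (1 - α) := by
          gcongr
          calc (2 : ℝ) ^ (1 - α) ≤ 2 ^ (1 : ℝ) :=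
                Real.rpow_le_rpow_of_exponent_le (by norm_num) (by linarith)
            _ = 2 := Real.rpow_one 2
    have h3 : 1 ≤ t ^ (1 - α) := Real.one_le_rpow ht h1α.le
    have h4 := norm_le_bracket z.1
    have h5 := one_le_bracket z.1
    have h6 := norm_sub_norm_le ((Φ t z).1 - t • (Φ t z).2) z.1
    have h7 : 0 < 1 / (1 - α) := by positivity
    have h8 : 1 / (1 - α) * (1 + t) ^ (1 - α) ≤ 2 / (1 - α) * bracket z.1 * t ^ (1 - α) := by
      calc 1 / (1 - α) * (1 + t) ^ (1 - α) ≤ 1 / (1 - α) * (2 * t ^ (1 - α)) := by gcongr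
        _ = 2 / (1 - α) * 1 * t ^ (1 - α) := by ring
        _ ≤ _ := by gcongr
    have h9 : bracket z.1 ≤ bracket z.1 * t ^ (1 - α) :=
      le_mul_of_one_le_right (by linarith) h3
    have h10 : 0 ≤ 1 / (1 - α) * (1 + (0 : ℝ)) ^ (1 - α) := by positivity
    calc ‖(Φ t z).1 - t • (Φ t z).2‖
        ≤ bracket z.1 * t ^ (1 - α) + 2 / (1 - α) * bracket z.1 * t ^ (1 - α) := by linarith
      _ = _ := by ring
  · rw [norm_neg, norm_smul, Real.norm_of_nonneg hr.1]
    have h1 := h.force_le r hr.1 (Φ r z).1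
    have hr0 : 0 < 1 + r := by linarith [hr.1]
    have h2 : ‖E r (Φ r z).1‖ ≤ (1 + r) ^ (-(1 + α)) :=
      h1.trans (mul_le_of_le_one_left (by positivity) h.le_one)
    calc r * ‖E r (Φ r z).1‖ ≤ (1 + r) * (1 + r) ^ (-(1 + α)) :=
          mul_le_mul (by linarith) h2 (norm_nonneg _) hr0.le
      _ = (1 + r) ^ (-α) := by
          rw [mul_comm, ← Real.rpow_add_one hr0.ne']
          congr 1
          ring

/-- Along a trajectory the velocity correction is Lipschitz in time with decaying constant. -/
theorem norm_velocityKernel_sub_le (h : IsDispersiveFlow α lam κ m f₀ E Φ) (hα : 0 < α)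
    {s t : ℝ} (hs : 0 < s) (hst : s ≤ t) (z : Phase) :
    ‖velocityKernel α f₀ Φ t (Φ t z).2 - velocityKernel α f₀ Φ s (Φ s z).2‖
      ≤ 4 * (2 + α) * m * s ^ (-(1 + α)) * (t - s) := by
  have ht : 0 < t := hs.trans_le hst
  have i1 := h.integrable_snd hα ht.le (Φ t z).2
  have i2 := h.integrable_snd hα hs.le (Φ s z).2
  obtain ⟨j1, b1⟩ := h.singular_snd t ht.le (Φ t z).2
  obtain ⟨j2, b2⟩ := h.singular_snd s hs.le (Φ s z).2
  -- The 2 counts the two velocities that move, that of the trajectory and that of the source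
  -- particle. The other factor 2 in the final 4 comes from the singular integrals at times s and t.
  set K := (2 + α) * (2 * (s ^ (-(1 + α)) * (t - s))) with hK
  have hK0 : 0 ≤ K := by
    have : 0 ≤ t - s := by linarith
    positivity
  have hV : ∀ y, ‖(Φ t y).2 - (Φ s y).2‖ ≤ s ^ (-(1 + α)) * (t - s) := by
    intro y
    refine (h.norm_snd_sub_le_mul hα hs.le hst y).trans ?_
    refine mul_le_mul_of_nonneg_right ?_ (by linarith)
    refine (mul_le_of_le_one_left (by positivity) h.le_one).trans ?_
    exact Real.rpow_le_rpow_of_nonpos hs (by linarith) (by linarith)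
  rw [velocityKernel, velocityKernel, ← integral_sub i1 i2]
  have hbd := norm_integral_le_of_norm_le ((j1.add j2).const_mul K)
    (f := fun y => f₀ y • rieszKernel α ((Φ t z).2 - (Φ t y).2)
      - f₀ y • rieszKernel α ((Φ s z).2 - (Φ s y).2)) (.of_forall fun y => ?_)
  · refine hbd.trans ?_
    simp only [Pi.add_apply]
    rw [integral_const_mul, integral_add j1 j2]
    calc K * _ ≤ K * (m + m) := by gcongr
      _ = _ := by rw [hK]; ring
  · rw [← smul_sub, norm_smul, Real.norm_eq_abs]
    have h1 := norm_rieszKernel_sub_le (α := α) (by linarith) ((Φ t z).2 - (Φ t y).2)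
      ((Φ s z).2 - (Φ s y).2)
    have h2 : ‖((Φ t z).2 - (Φ t y).2) - ((Φ s z).2 - (Φ s y).2)‖
        ≤ 2 * (s ^ (-(1 + α)) * (t - s)) := by
      rw [sub_sub_sub_comm]
      have := norm_sub_le ((Φ t z).2 - (Φ s z).2) ((Φ t y).2 - (Φ s y).2)
      linarith [hV z, hV y]
    have h3 := one_le_bracket y.1
    simp only [Pi.add_apply]
    set p := ‖(Φ t z).2 - (Φ t y).2‖ ^ (-(2 + α)) with hp
    set q := ‖(Φ s z).2 - (Φ s y).2‖ ^ (-(2 + α)) with hq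
    have hp0 : 0 ≤ p := by positivity
    have hq0 : 0 ≤ q := by positivity
    calc |f₀ y| * _ ≤ |f₀ y| * ((2 + α) * (2 * (s ^ (-(1 + α)) * (t - s))) * (p + q)) := by
          refine mul_le_mul_of_nonneg_left (h1.trans ?_) (abs_nonneg _)
          gcongr
      _ = K * (1 * |f₀ y| * p + 1 * |f₀ y| * q) := by rw [hK]; ring
      _ ≤ _ := by gcongr

/-- The force along a trajectory is asymptotic to the rescaled velocity correction. -/
theorem norm_force_sub_le (h : IsDispersiveFlow α lam κ m f₀ E Φ) (hα : 0 < α) (hα1 : α < 1)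
    {t : ℝ} (ht : 1 ≤ t) (z : Phase) :
    ‖E t (Φ t z).1 - t ^ (-(1 + α)) • (α * lam) • velocityKernel α f₀ Φ t (Φ t z).2‖
      ≤ |α * lam| * (4 * (2 + α) * (1 + 2 / (1 - α))) * m * bracket z.1 * t ^ (-(1 + 2 * α)) := by
  have ht0 : 0 < t := by linarith
  have i1 := h.integrable_fst hα ht0 (Φ t z).1
  have i2 := h.integrable_snd hα ht0.le (Φ t z).2
  obtain ⟨j1, b1⟩ := h.singular_fst t ht0 (Φ t z).1
  obtain ⟨j2, b2⟩ := h.singular_snd t ht0.le (Φ t z).2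
  have h1α : 0 < 1 - α := by linarith
  set c := 1 + 2 / (1 - α) with hc
  have hc0 : 0 < c := by positivity
  have hbz := one_le_bracket z.1
  set K := (2 + α) * (2 * c * bracket z.1 * t ^ (1 - α)) with hK
  have hK0 : 0 ≤ K := by positivity
  set τ := t ^ (-(2 + α)) with hτ
  have hτ0 : 0 ≤ τ := by positivity
  have e1 : E t (Φ t z).1 - t ^ (-(1 + α)) • (α * lam) • velocityKernel α f₀ Φ t (Φ t z).2
      = (α * lam) • ∫ y, (f₀ y • rieszKernel α ((Φ t z).1 - (Φ t y).1)
        - t ^ (-(1 + α)) • f₀ y • rieszKernel α ((Φ t z).2 - (Φ t y).2)) := by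
    have i3 : Integrable fun y => t ^ (-(1 + α)) • f₀ y • rieszKernel α ((Φ t z).2 - (Φ t y).2) :=
      i2.smul (t ^ (-(1 + α)))
    rw [integral_sub i1 i3, integral_smul, smul_sub, h.force_eq t ht0.le,
      velocityKernel, smul_comm (t ^ (-(1 + α)))]
  rw [e1, norm_smul, Real.norm_eq_abs]
  have hbd := norm_integral_le_of_norm_le ((j1.add (j2.const_mul τ)).const_mul K)
    (f := fun y => f₀ y • rieszKernel α ((Φ t z).1 - (Φ t y).1)
        - t ^ (-(1 + α)) • f₀ y • rieszKernel α ((Φ t z).2 - (Φ t y).2))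
    (.of_forall fun y => ?_)
  -- The displacement t^{1-α} times the singular integral, of size t^{-(2+α)}, gives the rate.
  · have e2 : t ^ (1 - α) * τ = t ^ (-(1 + 2 * α)) := by
      rw [hτ, ← Real.rpow_add ht0]
      congr 1
      ring
    calc |α * lam| * _ ≤ |α * lam| * (K * (m * τ + τ * m)) := by
          refine mul_le_mul_of_nonneg_left (hbd.trans ?_) (abs_nonneg _)
          simp only [Pi.add_apply]
          rw [integral_const_mul, integral_add j1 (j2.const_mul τ), integral_const_mul]
          gcongr
      _ = |α * lam| * (4 * (2 + α) * c) * m * bracket z.1 * (t ^ (1 - α) * τ) := by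
          rw [hK]; ring
      _ = _ := by rw [e2]
  -- Homogeneity moves t^{-(1+α)} inside the kernel, so two values of the same kernel are compared,
  -- at the position difference and at t times the velocity difference.
  · rw [smul_comm (t ^ (-(1 + α))), ← rieszKernel_smul α ht0, ← smul_sub, norm_smul,
      Real.norm_eq_abs]
    have h1 := norm_rieszKernel_sub_le (α := α) (by linarith) ((Φ t z).1 - (Φ t y).1)
      (t • ((Φ t z).2 - (Φ t y).2))
    have hby := one_le_bracket y.1
    have h2 : ‖((Φ t z).1 - (Φ t y).1) - t • ((Φ t z).2 - (Φ t y).2)‖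
        ≤ 2 * c * bracket z.1 * t ^ (1 - α) * bracket y.1 := by
      rw [smul_sub, sub_sub_sub_comm]
      have h3 := norm_sub_le ((Φ t z).1 - t • (Φ t z).2) ((Φ t y).1 - t • (Φ t y).2)
      have h4 := h.norm_sub_smul_le hα hα1 ht z
      have h5 := h.norm_sub_smul_le hα hα1 ht y
      have h6 : 0 ≤ c * t ^ (1 - α) := by positivity
      have h7 : bracket z.1 ≤ bracket z.1 * bracket y.1 :=
        le_mul_of_one_le_right (by linarith) hby
      have h8 : bracket y.1 ≤ bracket z.1 * bracket y.1 :=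
        le_mul_of_one_le_left (by linarith) hbz
      -- The sum of the weights is bounded by twice their product: ⟨y⟩ goes into the weighted
      -- integral of the datum and ⟨x⟩ becomes the weight in the result.
      calc _ ≤ c * t ^ (1 - α) * (bracket z.1 + bracket y.1) := by linarith
        _ ≤ c * t ^ (1 - α) * (bracket z.1 * bracket y.1 + bracket z.1 * bracket y.1) := by
            gcongr
        _ = _ := by ring
    simp only [Pi.add_apply]
    rw [norm_smul, Real.norm_of_nonneg ht0.le, Real.mul_rpow ht0.le (norm_nonneg _), ← hτ] at h1
    set p := ‖(Φ t z).1 - (Φ t y).1‖ ^ (-(2 + α)) with hp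
    set q := ‖(Φ t z).2 - (Φ t y).2‖ ^ (-(2 + α)) with hq
    have hp0 : 0 ≤ p := by positivity
    have hq0 : 0 ≤ q := by positivity
    calc |f₀ y| * _ ≤ |f₀ y| * ((2 + α) * (2 * c * bracket z.1 * t ^ (1 - α) * bracket y.1)
            * (p + τ * q)) := by
          refine mul_le_mul_of_nonneg_left (h1.trans ?_) (abs_nonneg _)
          gcongr
      _ = _ := by rw [hK]; ring

/-- The first component of the modified wave operator. -/
noncomputable def modifiedPosition (α lam : ℝ) (f₀ : Phase → ℝ) (Φ : ℝ → Phase → Phase)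
    (z : Phase) (t : ℝ) : R3 :=
  (Φ t z).1 - t • (Φ t z).2
    + ((t ^ (1 - α) - 1) / (1 - α)) • (α * lam) • velocityKernel α f₀ Φ t (Φ t z).2

/-- The constant in the convergence rate of the modified wave operator. -/
noncomputable def rateConst (α lam : ℝ) : ℝ :=
  |α * lam| * (4 * (2 + α) * (1 + 2 / (1 - α))) + 2 / (1 - α) * (|α * lam| * (4 * (2 + α)))

theorem rateConst_nonneg (hα : 0 < α) (hα1 : α < 1) (lam : ℝ) : 0 ≤ rateConst α lam := by
  have : 0 < 1 - α := by linarith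
  unfold rateConst
  positivity

theorem hasDerivAt_rpow_sub_one_div (hα1 : α < 1) {t : ℝ} (ht : 0 < t) :
    HasDerivAt (fun t : ℝ => (t ^ (1 - α) - 1) / (1 - α)) (t ^ (-α)) t := by
  have h1 : 1 - α ≠ 0 := by linarith
  refine (((Real.hasDerivAt_rpow_const (p := 1 - α) (Or.inl ht.ne')).sub_const 1).div_const
    (1 - α)).congr_deriv ?_
  rw [show 1 - α - 1 = -α by ring]
  field_simp

theorem continuousOn_velocityKernel (h : IsDispersiveFlow α lam κ m f₀ E Φ) (hα : 0 < α)
    (z : Phase) : ContinuousOn (fun t => velocityKernel α f₀ Φ t (Φ t z).2) (Ici 1) := by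
  have hm := h.nonneg'
  have key : ∀ s ∈ Ici (1 : ℝ), ∀ t ∈ Ici (1 : ℝ), s ≤ t →
      dist (velocityKernel α f₀ Φ t (Φ t z).2) (velocityKernel α f₀ Φ s (Φ s z).2)
        ≤ 4 * (2 + α) * m * dist t s := by
    intro s hs t _ hst
    have hs1 : 1 ≤ s := hs
    rw [dist_eq_norm, Real.dist_eq, abs_of_nonneg (sub_nonneg.2 hst)]
    refine (h.norm_velocityKernel_sub_le hα (by linarith) hst z).trans ?_
    refine mul_le_mul_of_nonneg_right ?_ (by linarith)
    exact mul_le_of_le_one_right (by positivity)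
      (Real.rpow_le_one_of_one_le_of_nonpos hs1 (by linarith))
  refine (LipschitzOnWith.of_dist_le_mul (K := Real.toNNReal (4 * (2 + α) * m))
    fun t ht s hs => ?_).continuousOn
  rw [Real.coe_toNNReal _ (by positivity)]
  rcases le_total s t with hst | hst
  · exact key s hs t ht hst
  · rw [dist_comm, dist_comm t]
    exact key t ht s hs hst

/-- The leading force cancels against the derivative of the correction coefficient. The velocity
correction is only known to be Lipschitz along the trajectory, not differentiable, so the speed is
estimated through right increments. Integrating Q x^{-2α} from s to t is where α > 1/2 is needed. -/
theorem norm_modifiedPosition_sub_le (h : IsDispersiveFlow α lam κ m f₀ E Φ) (hα : 1 / 2 < α)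
    (hα1 : α < 1) {s t : ℝ} (hs : 1 ≤ s) (hst : s ≤ t) (z : Phase) :
    ‖modifiedPosition α lam f₀ Φ z t - modifiedPosition α lam f₀ Φ z s‖
      ≤ rateConst α lam * m * bracket z.1 / (2 * α - 1) * s ^ (-(2 * α - 1)) := by
  have hα0 : 0 < α := by linarith
  have h1α : 0 < 1 - α := by linarith
  have h2α : 0 < 2 * α - 1 := by linarith
  have hm := h.nonneg'
  have hbz := one_le_bracket z.1
  set Q := rateConst α lam * m * bracket z.1 with hQ
  have hQ0 : 0 ≤ Q := by
    have := rateConst_nonneg hα0 hα1 lam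
    positivity
  set a : ℝ → R3 := fun t => velocityKernel α f₀ Φ t (Φ t z).2 with ha
  set k : ℝ → ℝ := fun t => (t ^ (1 - α) - 1) / (1 - α) with hk
  have hBder : ∀ x : ℝ, 0 < x → HasDerivAt (fun x : ℝ => -(Q / (2 * α - 1)) * x ^ (-(2 * α - 1)))
      (Q * x ^ (-(2 * α))) x := by
    intro x hx
    refine ((Real.hasDerivAt_rpow_const (p := -(2 * α - 1)) (Or.inl hx.ne')).const_mul
      (-(Q / (2 * α - 1)))).congr_deriv ?_
    rw [show -(2 * α - 1) - 1 = -(2 * α) by ring]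
    field_simp
  have hk' : ∀ r : ℝ, 0 < r → HasDerivAt k (r ^ (-α)) r := fun r hr =>
    hasDerivAt_rpow_sub_one_div hα1 hr
  have hac : ContinuousOn a (Ici 1) := h.continuousOn_velocityKernel hα0 z
  have hsub : Icc s t ⊆ Ici 1 := fun r hr => hs.trans hr.1
  have hcont : ContinuousOn (modifiedPosition α lam f₀ Φ z) (Icc s t) := by
    have hkc : ContinuousOn k (Icc s t) := fun r hr =>
      (hk' r (zero_lt_one.trans_le (hsub hr))).continuousAt.continuousWithinAt
    have ha2 : ContinuousOn (fun r => (α * lam) • a r) (Icc s t) :=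
      (hac.mono hsub).const_smul (α * lam)
    exact ((h.continuousOn_sub_smul z).mono fun r hr =>
      mem_Ici.2 (zero_le_one.trans (mem_Ici.1 (hsub hr)))).add (hkc.smul ha2)
  have main := norm_sub_le_of_eventually_increment_le
    (f := modifiedPosition α lam f₀ Φ z) (B := fun x : ℝ => -(Q / (2 * α - 1)) * x ^ (-(2 * α - 1)))
    (B' := fun x => Q * x ^ (-(2 * α))) hst hcont
    (fun x hx => (hBder x (zero_lt_one.trans_le (hsub hx))).continuousAt.continuousWithinAt)
    (fun x hx => (hBder x (zero_lt_one.trans_le (hs.trans hx.1))).hasDerivWithinAt)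
    (fun r hr ε hε => ?_)
  · have h3 : 0 ≤ Q / (2 * α - 1) * t ^ (-(2 * α - 1)) := by
      have : 0 ≤ t := by linarith
      positivity
    linarith
  · have hr1 : 1 ≤ r := hs.trans hr.1
    have hr0 : 0 < r := by linarith
    -- The velocity correction is frozen at time r. This makes H right-differentiable at r, and its
    -- derivative contains the cancellation; the variation of the correction is added back
    -- separately.
    set H : ℝ → R3 := fun x => (Φ x z).1 - x • (Φ x z).2 + k x • (α * lam) • a r with hH
    have hHd : HasDerivWithinAt H (-(r • E r (Φ r z).1) + r ^ (-α) • (α * lam) • a r)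
        (Ici r) r :=
      (h.hasDerivWithinAt_sub_smul z hr0.le).add
        ((hk' r hr0).hasDerivWithinAt.smul_const _)
    have hH' : ‖-(r • E r (Φ r z).1) + r ^ (-α) • (α * lam) • a r‖
        ≤ |α * lam| * (4 * (2 + α) * (1 + 2 / (1 - α))) * m * bracket z.1 * r ^ (-(2 * α)) := by
      have e1 : -(r • E r (Φ r z).1) + r ^ (-α) • (α * lam) • a r
          = -(r • (E r (Φ r z).1 - r ^ (-(1 + α)) • (α * lam) • a r)) := by
        rw [smul_sub, smul_smul r, mul_comm r, ← Real.rpow_add_one hr0.ne',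
          show -(1 + α) + 1 = -α by ring]
        abel
      rw [e1, norm_neg, norm_smul, Real.norm_of_nonneg hr0.le]
      calc _ ≤ r * (|α * lam| * (4 * (2 + α) * (1 + 2 / (1 - α))) * m * bracket z.1
              * r ^ (-(1 + 2 * α))) :=
            mul_le_mul_of_nonneg_left (h.norm_force_sub_le hα0 hα1 hr1 z) hr0.le
        _ = |α * lam| * (4 * (2 + α) * (1 + 2 / (1 - α))) * m * bracket z.1
              * (r ^ (-(1 + 2 * α)) * r) := by ring
        _ = _ := by
          rw [← Real.rpow_add_one hr0.ne']
          congr 2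
          ring
    have hlo := (hHd.isLittleO.def hε).filter_mono (nhdsWithin_mono r Ioi_subset_Ici_self)
    -- Staying below 2r lets the coefficient at x be bounded by a power of r.
    filter_upwards [hlo, Ioo_mem_nhdsGT (show r < 2 * r by linarith)] with x hx hxr
    have hrx : 0 < x - r := sub_pos.2 hxr.1
    rw [Real.norm_of_nonneg hrx.le] at hx
    have e2 : modifiedPosition α lam f₀ Φ z x - modifiedPosition α lam f₀ Φ z r
        = (H x - H r) + k x • (α * lam) • (a x - a r) := by
      simp only [modifiedPosition, hH, ha, hk, smul_sub]
      abel
    have h4 : ‖H x - H r‖ ≤ (|α * lam| * (4 * (2 + α) * (1 + 2 / (1 - α))) * m * bracket z.1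
        * r ^ (-(2 * α)) + ε) * (x - r) := by
      have h5 := norm_add_le (H x - H r - (x - r) • (-(r • E r (Φ r z).1)
        + r ^ (-α) • (α * lam) • a r)) ((x - r) • (-(r • E r (Φ r z).1)
        + r ^ (-α) • (α * lam) • a r))
      rw [sub_add_cancel, norm_smul, Real.norm_of_nonneg hrx.le] at h5
      nlinarith
    have hx1 : 1 ≤ x := hr1.trans hxr.1.le
    have hkx0 : 0 ≤ k x :=
      div_nonneg (sub_nonneg.2 (Real.one_le_rpow hx1 h1α.le)) h1α.le
    have hkx : k x ≤ 2 / (1 - α) * r ^ (1 - α) := by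
      have h6 : x ^ (1 - α) ≤ 2 * r ^ (1 - α) := by
        calc x ^ (1 - α) ≤ (2 * r) ^ (1 - α) :=
              Real.rpow_le_rpow (by linarith) hxr.2.le h1α.le
          _ = 2 ^ (1 - α) * r ^ (1 - α) := Real.mul_rpow (by norm_num) hr0.le
          _ ≤ 2 * r ^ (1 - α) := by
            gcongr
            calc (2 : ℝ) ^ (1 - α) ≤ 2 ^ (1 : ℝ) :=
                  Real.rpow_le_rpow_of_exponent_le (by norm_num) (by linarith)
              _ = 2 := Real.rpow_one 2
      rw [div_mul_eq_mul_div]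
      exact div_le_div_of_nonneg_right (by linarith) h1α.le
    have h7 := h.norm_velocityKernel_sub_le hα0 hr0 hxr.1.le z
    have h8 : ‖k x • (α * lam) • (a x - a r)‖
        ≤ 2 / (1 - α) * (|α * lam| * (4 * (2 + α))) * m * bracket z.1 * r ^ (-(2 * α))
          * (x - r) := by
      rw [norm_smul, norm_smul, Real.norm_of_nonneg hkx0, Real.norm_eq_abs]
      have e3 : r ^ (1 - α) * r ^ (-(1 + α)) = r ^ (-(2 * α)) := by
        rw [← Real.rpow_add hr0]
        congr 1
        ring
      have hx0 : 0 ≤ x - r := hrx.le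
      calc _ ≤ (2 / (1 - α) * r ^ (1 - α)) * (|α * lam| * (4 * (2 + α) * m * r ^ (-(1 + α))
              * (x - r))) := by gcongr
        _ = 2 / (1 - α) * (|α * lam| * (4 * (2 + α))) * m * 1
              * (r ^ (1 - α) * r ^ (-(1 + α))) * (x - r) := by ring
        _ ≤ 2 / (1 - α) * (|α * lam| * (4 * (2 + α))) * m * bracket z.1
              * (r ^ (1 - α) * r ^ (-(1 + α))) * (x - r) := by gcongr
        _ = _ := by rw [e3]
    rw [e2]
    refine (norm_add_le _ _).trans ((add_le_add h4 h8).trans (le_of_eq ?_))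
    rw [hQ, rateConst]
    ring

end IsDispersiveFlow

/-! ### Passage to the limit and choice of constants. -/

theorem exists_tendsto_of_norm_sub_le_rpow {W : ℝ → R3} {K p : ℝ} (hp : 0 < p)
    (h : ∀ s t, 1 ≤ s → s ≤ t → ‖W t - W s‖ ≤ K * s ^ (-p)) :
    ∃ L, Tendsto W atTop (𝓝 L) ∧ ∀ s, 1 ≤ s → ‖W s - L‖ ≤ K * s ^ (-p) := by
  have hK : 0 ≤ K := by simpa using (norm_nonneg _).trans (h 1 1 le_rfl le_rfl)
  have hlim : Tendsto (fun s : ℝ => K * s ^ (-p)) atTop (𝓝 0) := by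
    simpa using (tendsto_rpow_neg_atTop hp).const_mul K
  have hdist : ∀ s t, 1 ≤ s → 1 ≤ t → ∀ N, 1 ≤ N → N ≤ s → N ≤ t →
      dist (W s) (W t) ≤ K * N ^ (-p) := by
    have key : ∀ s t, 1 ≤ s → s ≤ t → ∀ N, 1 ≤ N → N ≤ s → ‖W t - W s‖ ≤ K * N ^ (-p) :=
      fun s t hs hst N hN hNs => (h s t hs hst).trans (mul_le_mul_of_nonneg_left
        (Real.rpow_le_rpow_of_nonpos (by linarith) hNs (by linarith)) hK)
    intro s t hs ht N hN hNs hNt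
    rw [dist_eq_norm]
    rcases le_total s t with hst | hst
    · rw [norm_sub_rev]
      exact key s t hs hst N hN hNs
    · exact key t s ht hst N hN hNt
  have hc : CauchySeq W := by
    rw [Metric.cauchySeq_iff]
    intro ε hε
    obtain ⟨N, hN, hN1⟩ := ((hlim.eventually (gt_mem_nhds hε)).and (eventually_ge_atTop 1)).exists
    exact ⟨N, fun s hs t ht =>
      (hdist s t (hN1.trans hs) (hN1.trans ht) N hN1 hs ht).trans_lt hN⟩
  obtain ⟨L, hL⟩ := cauchySeq_tendsto_of_complete hc
  refine ⟨L, hL, fun s hs => ?_⟩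
  have h1 : Tendsto (fun t => ‖W t - W s‖) atTop (𝓝 ‖L - W s‖) := (hL.sub_const _).norm
  rw [norm_sub_rev]
  refine le_of_tendsto h1 ?_
  filter_upwards [eventually_ge_atTop s] with t ht
  exact h s t hs ht

/-- With κ = 8Dη, the 8 coming from the change of time weight, η ≤ α/(32D) gives κ/α ≤ 1/4, the
smallness needed for expansion, and also κ ≤ 1. -/
theorem IsSolution.isDispersiveFlow {α lam D η : ℝ} {f₀ : Phase → ℝ} {f : ℝ → Phase → ℝ}
    {Φ : ℝ → Phase → Phase} (hα : 0 < α) (hα1 : α < 1) (hlam : lam ≠ 0) (hD : 0 < D)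
    (hη : 0 < η) (hη₀ : η ≤ α / (32 * D)) (hf₀ : weightedDataNorm f₀ ≤ ENNReal.ofReal η)
    (hf : IsSolution α lam f₀ f)
    (hE : DispersionBound α (D * η) (fun t => forceField α lam (f t)))
    (hΦ : IsFlow (fun t => forceField α lam (f t)) Φ) :
    IsDispersiveFlow α lam (8 * (D * η)) (singularConst α * η) f₀
      (fun t => forceField α lam (f t)) Φ := by
  have hS := singularConst_pos α
  have hR := hf.regularField hα hα1 hlam hE
  have hsmall : 8 * (D * η) ≤ α / 4 := by
    have : D * η ≤ D * (α / (32 * D)) := by gcongr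
    have e : D * (α / (32 * D)) = α / 32 := by field_simp
    linarith
  have hκα : 8 * (D * η) / α ≤ 1 / 4 := by
    rw [div_le_iff₀ hα]
    linarith
  have hκ : 0 ≤ 8 * (D * η) := by positivity
  have hmeas : ∀ t, 0 ≤ t → Measurable (Φ t) := fun t ht => (hΦ.continuous hR ht).measurable
  have hlip : ∀ t, 0 ≤ t → ∀ x y, ‖forceField α lam (f t) x - forceField α lam (f t) y‖
      ≤ 8 * (D * η) * (1 + t) ^ (-(2 + α)) * ‖x - y‖ := fun t ht x y =>
    convex_univ.norm_image_sub_le_of_norm_fderiv_le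
      (fun z _ => (hE.differentiable t ht) z)
      (fun z _ => le_mul_rpow_of_bracket_rpow_mul_le ht (by linarith) (by linarith)
        (norm_nonneg _) (hE.bound_deriv t ht z)) (mem_univ y) (mem_univ x)
  refine ⟨hΦ, hmeas, (hf.integrable le_rfl).congr hf.initial, hκ, by linarith, by positivity,
    fun t ht x => le_mul_rpow_of_bracket_rpow_mul_le ht (by linarith) (by linarith)
      (norm_nonneg _) (hE.bound t ht x),
    fun t ht x => hf.forceField_eq hα hα1 hlam hE hΦ ht x, fun t ht y => ?_, fun t ht y => ?_⟩
  · have hG : Measurable fun z => t⁻¹ • (Φ t z).1 :=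
      (measurable_fst.comp (hmeas t ht.le)).const_smul t⁻¹
    obtain ⟨h1, h2⟩ := integrable_singular hα hα1 hη hf₀ hG
      (fun x v v' => hΦ.expanding_fst hα hκ hκα hlip ht x v v') (t⁻¹ • y)
    -- It is 𝒳/t that expands uniformly in t; undoing the rescaling produces the factor t^{-(2+α)}.
    have e : ∀ z : Phase, bracket z.1 * |f₀ z| * ‖y - (Φ t z).1‖ ^ (-(2 + α))
        = t ^ (-(2 + α)) * (bracket z.1 * |f₀ z| * ‖t⁻¹ • y - t⁻¹ • (Φ t z).1‖ ^ (-(2 + α))) := by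
      intro z
      have e1 : ‖y - (Φ t z).1‖ = t * ‖t⁻¹ • y - t⁻¹ • (Φ t z).1‖ := by
        rw [← smul_sub, norm_smul, norm_inv, Real.norm_of_nonneg ht.le,
          mul_inv_cancel_left₀ ht.ne']
      rw [e1, Real.mul_rpow ht.le (norm_nonneg _)]
      ring
    simp_rw [e]
    refine ⟨h1.const_mul _, ?_⟩
    rw [integral_const_mul, mul_comm (singularConst α * η)]
    gcongr
  · exact integrable_singular hα hα1 hη hf₀ (measurable_snd.comp (hmeas t ht))
      (fun x v v' => hΦ.expanding_snd hα hκ hκα hlip ht x v v') y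

theorem waveOp_fst {α lam : ℝ} (hα : 0 < α) (hlam : lam ≠ 0) (f₀ : Phase → ℝ)
    (Φ : ℝ → Phase → Phase) (t : ℝ) (z : Phase) :
    (waveOp α lam f₀ Φ t z).1 = IsDispersiveFlow.modifiedPosition α lam f₀ Φ z t := by
  change (Φ t z).1 - t • (Φ t z).2
    + ((t ^ (1 - α) - 1) / (1 - α)) • correction α lam f₀ Φ t (Φ t z).2 = _
  rw [correction_eq hα hlam, IsDispersiveFlow.modifiedPosition]

theorem waveOp_snd (α lam : ℝ) (f₀ : Phase → ℝ) (Φ : ℝ → Phase → Phase) (t : ℝ) (z : Phase) :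
    (waveOp α lam f₀ Φ t z).2 = (Φ t z).2 := rfl

namespace IsDispersiveFlow

variable {α lam κ m : ℝ} {f₀ : Phase → ℝ} {E : ℝ → R3 → R3} {Φ : ℝ → Phase → Phase}

/-- At t = 1 the correction coefficient vanishes, so only the displacement accumulated on [0,1]
remains. -/
theorem norm_modifiedPosition_one_sub_le (h : IsDispersiveFlow α lam κ m f₀ E Φ) (hα : 0 < α)
    (z : Phase) : ‖modifiedPosition α lam f₀ Φ z 1 - z.1‖ ≤ κ := by
  have := h.norm_sub_smul_sub_le_of_le_one hα zero_le_one le_rfl z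
  simpa [modifiedPosition] using this

theorem norm_snd_sub_le_div_rpow (h : IsDispersiveFlow α lam κ m f₀ E Φ) (hα : 0 < α) {s t : ℝ}
    (hs : 1 ≤ s) (hst : s ≤ t) (z : Phase) : ‖(Φ t z).2 - (Φ s z).2‖ ≤ κ / α * s ^ (-α) := by
  have := h.nonneg
  refine (h.norm_snd_sub_le hα (by linarith) hst z).trans ?_
  refine mul_le_mul_of_nonneg_left ?_ (by positivity)
  exact Real.rpow_le_rpow_of_nonpos (by linarith) (by linarith) (by linarith)

theorem norm_snd_sub_snd_le (h : IsDispersiveFlow α lam κ m f₀ E Φ) (hα : 0 < α) {t : ℝ}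
    (ht : 0 ≤ t) (z : Phase) : ‖(Φ t z).2 - z.2‖ ≤ κ / α := by
  simpa [(h.isFlow z).1] using h.norm_snd_sub_le hα le_rfl ht z

end IsDispersiveFlow

end VlasovRiesz

theorem proposition3p4 (α lam D : ℝ) (hα : 1 / 2 < α) (hα' : α < 1) (hlam : lam ≠ 0)
    (hD : 0 < D) :
    ∃ η₀ C : ℝ, 0 < η₀ ∧ 0 < C ∧
      ∀ (η : ℝ) (f₀ : Phase → ℝ) (f : ℝ → Phase → ℝ),
        0 < η → η ≤ η₀ →
        (∀ᵐ z, 0 ≤ f₀ z) →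
        weightedDataNorm f₀ ≤ ENNReal.ofReal η →
        IsSolution α lam f₀ f →
        DispersionBound α (D * η) (fun t => forceField α lam (f t)) →
        (∃ Φ : ℝ → Phase → Phase, IsFlow (fun t => forceField α lam (f t)) Φ) ∧
        ∀ Φ : ℝ → Phase → Phase, IsFlow (fun t => forceField α lam (f t)) Φ →
          (∀ t, 0 ≤ t → ∀ v, Integrable (correctionIntegrand α lam f₀ Φ t v) volume) ∧
          ∃ Wplus : Phase → Phase,
            (∀ z, Tendsto (fun t => waveOp α lam f₀ Φ t z) atTop (𝓝 (Wplus z))) ∧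
            (∀ t, 1 ≤ t → ∀ x v : R3,
              ‖(waveOp α lam f₀ Φ t (x, v)).1 - (Wplus (x, v)).1‖ / bracket x
                  ≤ C * η / t ^ (2 * α - 1) ∧
              ‖(waveOp α lam f₀ Φ t (x, v)).2 - (Wplus (x, v)).2‖ ≤ C * η / t ^ α) ∧
            (∀ t, 1 ≤ t → ∀ x v : R3,
              ‖(waveOp α lam f₀ Φ t (x, v)).1 - x‖ / bracket x ≤ C * η ∧
              ‖(waveOp α lam f₀ Φ t (x, v)).2 - v‖ ≤ C * η) ∧
            (∀ x v : R3,
              ‖(Wplus (x, v)).1 - x‖ / bracket x ≤ C * η ∧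
              ‖(Wplus (x, v)).2 - v‖ ≤ C * η) := by
  have hα0 : 0 < α := by linarith
  have h2α : 0 < 2 * α - 1 := by linarith
  have hS := singularConst_pos α
  have hrate := IsDispersiveFlow.rateConst_nonneg hα0 hα' lam
  set C₁ := IsDispersiveFlow.rateConst α lam * singularConst α / (2 * α - 1) with hC₁
  have hC₁0 : 0 ≤ C₁ := by positivity
  -- C₁ is the position rate, C₁ + 8D adds the displacement up to time 1 for the almost-identity
  -- bound, and 8D/α is the velocity constant κ/(αη).
  obtain ⟨C, hC, hC₁C, hC₂C, hC₃C⟩ : ∃ C, 0 < C ∧ C₁ ≤ C ∧ C₁ + 8 * D ≤ C ∧ 8 * D / α ≤ C := by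
    have h1 : 0 < 8 * D / α := by positivity
    exact ⟨C₁ + 8 * D + 8 * D / α, by positivity, by linarith, by linarith, by linarith⟩
  refine ⟨α / (32 * D), C, by positivity, hC,
    fun η f₀ f hη hη₀ _ hf₀ hf hE => ⟨(hf.regularField hα0 hα' hlam hE).exists_isFlow,
      fun Φ hΦ => ?_⟩⟩
  have h := hf.isDispersiveFlow hα0 hα' hlam hD hη hη₀ hf₀ hE hΦ
  have hpos : ∀ z s t, 1 ≤ s → s ≤ t →
      ‖IsDispersiveFlow.modifiedPosition α lam f₀ Φ z t - IsDispersiveFlow.modifiedPosition α lam f₀ Φ z s‖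
        ≤ C₁ * η * bracket z.1 * s ^ (-(2 * α - 1)) := by
    intro z s t hs hst
    refine (h.norm_modifiedPosition_sub_le hα hα' hs hst z).trans (le_of_eq ?_)
    rw [hC₁]
    ring
  choose L₁ hL₁ hL₁r using fun z => exists_tendsto_of_norm_sub_le_rpow h2α (hpos z)
  choose L₂ hL₂ hL₂r using fun z => exists_tendsto_of_norm_sub_le_rpow hα0
    (fun s t hs hst => h.norm_snd_sub_le_div_rpow hα0 hs hst z)
  have hDα : 8 * (D * η) / α = 8 * D / α * η := by ring
  have hDα0 : 0 ≤ 8 * D / α * η := by positivity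
  have hC₁η : 0 ≤ C₁ * η := by positivity
  have hDη : 0 ≤ 8 * D * η := by positivity
  -- The drift from time 1 to t is added to the displacement at time 1.
  have hid : ∀ t, 1 ≤ t → ∀ z,
      ‖IsDispersiveFlow.modifiedPosition α lam f₀ Φ z t - z.1‖ ≤ (C₁ + 8 * D) * η * bracket z.1 := by
    intro t ht z
    have h1 := hpos z 1 t le_rfl ht
    rw [Real.one_rpow, mul_one] at h1
    have h2 := h.norm_modifiedPosition_one_sub_le hα0 z
    have h3 := norm_sub_le_norm_sub_add_norm_sub (IsDispersiveFlow.modifiedPosition α lam f₀ Φ z t)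
      (IsDispersiveFlow.modifiedPosition α lam f₀ Φ z 1) z.1
    have h4 := one_le_bracket z.1
    nlinarith
  refine ⟨fun t ht v => ?_, fun z => (L₁ z, L₂ z), fun z => ?_, fun t ht x v => ⟨?_, ?_⟩,
    fun t ht x v => ⟨?_, ?_⟩, fun x v => ⟨?_, ?_⟩⟩
  · have := (h.integrable_snd hα0 ht v).smul (-(α * lam))
    exact this.congr (.of_forall fun z => (correctionIntegrand_eq hα0 hlam f₀ Φ t v z).symm)
  · refine Tendsto.prodMk_nhds ?_ (hL₂ z)
    exact (hL₁ z).congr fun t => (waveOp_fst hα0 hlam f₀ Φ t z).symm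
  · rw [waveOp_fst hα0 hlam, div_le_iff₀ (zero_lt_one.trans_le (one_le_bracket x)), div_eq_mul_inv,
      ← Real.rpow_neg (by linarith)]
    refine (hL₁r (x, v) t ht).trans ?_
    have h1 := one_le_bracket x
    have h2 : 0 ≤ t ^ (-(2 * α - 1)) := Real.rpow_nonneg (by linarith) _
    calc C₁ * η * bracket x * t ^ (-(2 * α - 1))
        = C₁ * η * t ^ (-(2 * α - 1)) * bracket x := by ring
      _ ≤ _ := by
        gcongr
  · rw [waveOp_snd, div_eq_mul_inv, ← Real.rpow_neg (by linarith)]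
    refine (hL₂r (x, v) t ht).trans ?_
    rw [hDα]
    have h2 : 0 ≤ t ^ (-α) := Real.rpow_nonneg (by linarith) _
    gcongr
  · rw [waveOp_fst hα0 hlam, div_le_iff₀ (zero_lt_one.trans_le (one_le_bracket x))]
    have h1 := one_le_bracket x
    refine (hid t ht (x, v)).trans ?_
    gcongr
  · rw [waveOp_snd]
    refine (h.norm_snd_sub_snd_le hα0 (by linarith) (x, v)).trans ?_
    rw [hDα]
    gcongr
  · rw [div_le_iff₀ (zero_lt_one.trans_le (one_le_bracket x))]
    have h1 := one_le_bracket x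
    have h2 : ‖L₁ (x, v) - x‖ ≤ (C₁ + 8 * D) * η * bracket x :=
      le_of_tendsto ((hL₁ (x, v)).sub_const x).norm (by
        filter_upwards [eventually_ge_atTop 1] with t ht
        exact hid t ht (x, v))
    refine h2.trans ?_
    gcongr
  · have h2 : ‖L₂ (x, v) - v‖ ≤ 8 * (D * η) / α :=
      le_of_tendsto ((hL₂ (x, v)).sub_const v).norm (by
        filter_upwards [eventually_ge_atTop 0] with t ht
        exact h.norm_snd_sub_snd_le hα0 ht (x, v))
    refine h2.trans ?_
    rw [hDα]
    gcongr
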